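/- Let $X$ be a smooth projective (irreducible) curve over an algebraically closed field $\mathbb K$ of characteristic $\neq 2$, and let $E$ be an orthogonal bundle on $X$, i.e. a vector bundle, of some rank $r$, with a non-degenerate symmetric $\mathcal O_X$-bilinear form $b : E\times E\to\mathcal O_X$. For a closed point $x\in X$ with maximal ideal $\mathfrak m_x\subset\mathcal O_{X,x}$ let $E_{2x}=\widehat E_x\otimes\mathcal O_{X,x}/\mathfrak m_x^2$, where $\widehat E_x$ is the stalk of $E$ at $x$. A submodule $L\subset E_{2x}$ is called Lagrangian if it is isotropic for the $\mathcal O_{X,x}/\mathfrak m_x^2$-valued form induced by $b$ and $\dim_{\mathbb K}L=r$. The orthogonal Hecke transform of $E$ with respect to $L$ is the orthogonal bundle $\mathcal H(E,L)=E'\otimes\mathcal O_X(x)$, where $E'=\ker(E\to E_{2x}/L)$, with the form induced by $b$. An orthogonal bundle is called stable if each of its isotropic subbundles of positive rank has negative degree, and $E$ is called superstable if $\mathcal H(E,L)$ is stable for every closed point $x\in X$ and every Lagrangian submodule $L\subset E_{2x}$. Then $E$ is superstable if and only if every isotropic subbundle $F\subset E$ of positive rank satisfies $$\mu(F)=\frac{\deg(F)}{\mathrm{rk}(F)}<-1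 .$$ -/

import Mathlib

open CategoryTheory TopologicalSpace AlgebraicGeometry

noncomputable section

namespace OrthogonalHecke

universe u

/-! ### Curves -/

/-- A smooth projective (equivalently, smooth and proper) irreducible curve over a field `K`. -/
structure SmoothProjectiveCurve (K : Type u) [Field K] where
  /-- the underlying scheme -/
  toScheme : Scheme.{u}
  /-- the structure morphism -/
  str : toScheme ⟶ Spec (.of K)
  [isIntegral : IsIntegral toScheme]
  [isProper : IsProper str]
  [smooth : SmoothOfRelativeDimension 1 str]

attribute [instance] SmoothProjectiveCurve.isIntegral SmoothProjectiveCurve.isProper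
  SmoothProjectiveCurve.smooth

instance {K : Type u} [Field K] (C : SmoothProjectiveCurve K) :
    IsLocallyNoetherian C.toScheme :=
  haveI : IsLocallyNoetherian (Spec (.of K)) := inferInstance
  LocallyOfFiniteType.isLocallyNoetherian C.str

/-! ### Sections, stalks and frames of sheaves of modules -/

section Modules

variable {X : Scheme.{u}}

/-- Restriction of a section of an `𝒪_X`-module to a smaller open set. -/
def res (M : X.Modules) {U V : X.Opens} (h : V ≤ U) (s : Γ(M, U)) : Γ(M, V) :=
  M.presheaf.map (homOfLE h).op s

/-- Restriction of functions to a smaller open set. -/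
def resFun {U V : X.Opens} (h : V ≤ U) (a : Γ(X, U)) : Γ(X, V) :=
  X.presheaf.map (homOfLE h).op a

/-- The stalk `M_x` of an `𝒪_X`-module. -/
abbrev Stalk (M : X.Modules) (x : X) : Type u := M.presheaf.stalk x

/-- The germ at `x` of a section of an `𝒪_X`-module. -/
def germ (M : X.Modules) {U : X.Opens} {x : X} (hx : x ∈ U) (s : Γ(M, U)) : Stalk M x :=
  M.presheaf.germ U x hx s

/-- The germ at `x` of a function. -/
def germFun {U : X.Opens} {x : X} (hx : x ∈ U) (a : Γ(X, U)) : X.presheaf.stalk x :=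
  X.presheaf.germ U x hx a

lemma germ_res (M : X.Modules) {U V : X.Opens} {x : X} (h : V ≤ U) (hx : x ∈ V)
    (s : Γ(M, U)) : germ M hx (res M h s) = germ M (h hx) s :=
  M.presheaf.germ_res_apply (homOfLE h) x hx s

lemma germFun_res {U V : X.Opens} {x : X} (h : V ≤ U) (hx : x ∈ V)
    (a : Γ(X, U)) : germFun hx (resFun h a) = germFun (h hx) a :=
  X.presheaf.germ_res_apply (homOfLE h) x hx a

lemma res_smul (M : X.Modules) {U V : X.Opens} (h : V ≤ U) (a : Γ(X, U)) (s : Γ(M, U)) :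
    res M h (a • s) = resFun h a • res M h s :=
  Scheme.Modules.map_smul M (homOfLE h) a s

lemma res_add (M : X.Modules) {U V : X.Opens} (h : V ≤ U) (s t : Γ(M, U)) :
    res M h (s + t) = res M h s + res M h t :=
  map_add _ _ _

lemma germ_add (M : X.Modules) {U : X.Opens} {x : X} (hx : x ∈ U) (s t : Γ(M, U)) :
    germ M hx (s + t) = germ M hx s + germ M hx t :=
  map_add _ _ _

lemma exists_germ (M : X.Modules) {x : X} (m : Stalk M x) :
    ∃ (U : X.Opens) (hx : x ∈ U) (s : Γ(M, U)), germ M hx s = m :=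
  M.presheaf.exists_germ_eq m

lemma exists_germFun {x : X} (r : X.presheaf.stalk x) :
    ∃ (U : X.Opens) (hx : x ∈ U) (a : Γ(X, U)), germFun hx a = r :=
  X.presheaf.exists_germ_eq r

lemma exists_germ₂ (M : X.Modules) {x : X} (r : X.presheaf.stalk x) (m : Stalk M x) :
    ∃ (U : X.Opens) (hx : x ∈ U) (a : Γ(X, U)) (s : Γ(M, U)),
      germFun hx a = r ∧ germ M hx s = m := by
  obtain ⟨U, hU, a, rfl⟩ := exists_germFun r
  obtain ⟨V, hV, s, rfl⟩ := exists_germ M m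
  exact ⟨U ⊓ V, ⟨hU, hV⟩, resFun inf_le_left a, res M inf_le_right s,
    germFun_res _ _ _, germ_res _ _ _ _⟩

lemma germ_smul_congr (M : X.Modules) {x : X} {U V : X.Opens} (hU : x ∈ U) (hV : x ∈ V)
    (a : Γ(X, U)) (s : Γ(M, U)) (a' : Γ(X, V)) (s' : Γ(M, V))
    (ha : germFun hU a = germFun hV a') (hs : germ M hU s = germ M hV s') :
    germ M hU (a • s) = germ M hV (a' • s') := by
  obtain ⟨W₁, h₁, i₁, j₁, e₁⟩ := X.presheaf.germ_eq x hU hV a a' ha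
  obtain ⟨W₂, h₂, i₂, j₂, e₂⟩ := M.presheaf.germ_eq x hU hV s s' hs
  have hUW : W₁ ⊓ W₂ ≤ U := inf_le_left.trans i₁.le
  have hVW : W₁ ⊓ W₂ ≤ V := inf_le_left.trans j₁.le
  have ea : resFun hUW a = resFun hVW a' := by
    have := congrArg (X.presheaf.map (homOfLE (inf_le_left : W₁ ⊓ W₂ ≤ W₁)).op) e₁
    rw [← ConcreteCategory.comp_apply, ← ConcreteCategory.comp_apply, ← Functor.map_comp,
      ← Functor.map_comp] at this
    exact this
  have es : res M hUW s = res M hVW s' := by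
    have := congrArg (M.presheaf.map (homOfLE (inf_le_right : W₁ ⊓ W₂ ≤ W₂)).op) e₂
    rw [← ConcreteCategory.comp_apply, ← ConcreteCategory.comp_apply, ← Functor.map_comp,
      ← Functor.map_comp] at this
    exact this
  rw [← germ_res M hUW ⟨h₁, h₂⟩, ← germ_res M hVW ⟨h₁, h₂⟩, res_smul, res_smul, ea, es]

/-- Scalar multiplication `𝒪_{X,x} × M_x → M_x`, induced by that of sections. -/
instance stalkSMul (M : X.Modules) (x : X) : SMul (X.presheaf.stalk x) (Stalk M x) where
  smul r m :=
    let h := exists_germ₂ M r m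
    germ M h.choose_spec.choose
      (h.choose_spec.choose_spec.choose • h.choose_spec.choose_spec.choose_spec.choose)

lemma germFun_smul_germ (M : X.Modules) {x : X} {U : X.Opens} (hx : x ∈ U)
    (a : Γ(X, U)) (s : Γ(M, U)) : germFun hx a • germ M hx s = germ M hx (a • s) := by
  have h := exists_germ₂ M (germFun hx a) (germ M hx s)
  have hs := h.choose_spec.choose_spec.choose_spec.choose_spec
  exact germ_smul_congr M _ _ _ _ _ _ hs.1 hs.2

/-- The stalk `M_x` is a module over the local ring `𝒪_{X,x}`. -/
instance stalkModule (M : X.Modules) (x : X) : Module (X.presheaf.stalk x) (Stalk M x) where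
  one_smul m := by
    obtain ⟨U, hU, s, rfl⟩ := exists_germ M m
    have : (1 : X.presheaf.stalk x) = germFun hU 1 := (map_one _).symm
    rw [this, germFun_smul_germ, one_smul]
  mul_smul r r' m := by
    obtain ⟨U, hU, a, s, rfl, rfl⟩ := exists_germ₂ M r' m
    obtain ⟨V, hV, b, rfl⟩ := exists_germFun r
    have hx : x ∈ U ⊓ V := ⟨hU, hV⟩
    rw [← germFun_res inf_le_left hx a, ← germFun_res inf_le_right hx b,
      ← germ_res M inf_le_left hx s, germFun_smul_germ, germFun_smul_germ, ← mul_smul]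
    rw [← germFun_smul_germ]
    congr 1
    exact (map_mul _ _ _).symm
  smul_zero r := by
    obtain ⟨U, hU, a, rfl⟩ := exists_germFun r
    have : (0 : Stalk M x) = germ M hU 0 := (map_zero _).symm
    rw [this, germFun_smul_germ, smul_zero]
  zero_smul m := by
    obtain ⟨U, hU, s, rfl⟩ := exists_germ M m
    have : (0 : X.presheaf.stalk x) = germFun hU 0 := (map_zero _).symm
    rw [this, germFun_smul_germ, zero_smul]
    exact map_zero _
  smul_add r m m' := by
    obtain ⟨U, hU, a, s, rfl, rfl⟩ := exists_germ₂ M r m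
    obtain ⟨V, hV, t, rfl⟩ := exists_germ M m'
    have hx : x ∈ U ⊓ V := ⟨hU, hV⟩
    rw [← germFun_res inf_le_left hx a, ← germ_res M inf_le_left hx s,
      ← germ_res M inf_le_right hx t, ← germ_add, germFun_smul_germ, germFun_smul_germ,
      germFun_smul_germ, ← germ_add, smul_add]
  add_smul r r' m := by
    obtain ⟨U, hU, a, s, rfl, rfl⟩ := exists_germ₂ M r' m
    obtain ⟨V, hV, b, rfl⟩ := exists_germFun r
    have hx : x ∈ U ⊓ V := ⟨hU, hV⟩
    rw [← germFun_res inf_le_left hx a, ← germFun_res inf_le_right hx b,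
      ← germ_res M inf_le_left hx s, germFun_smul_germ, germFun_smul_germ, ← germ_add,
      ← add_smul, ← germFun_smul_germ]
    congr 1
    exact (map_add _ _ _).symm

/-- The fibre `M_{2x} = M_x ⊗ 𝒪_{X,x}/𝔪_x²` of an `𝒪_X`-module over the first-order thickening
of `x`. Its `𝒪_{X,x}`-submodules are the same as its `𝒪_{X,x}/𝔪_x²`-submodules. -/
abbrev FirstOrderFibre (M : X.Modules) (x : X) : Type u :=
  Stalk M x ⧸ ((IsLocalRing.maximalIdeal (X.presheaf.stalk x)) ^ 2 •
    (⊤ : Submodule (X.presheaf.stalk x) (Stalk M x)))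

/-- The value in `M_{2x}` of a section of `M` defined near `x`. -/
def jet (M : X.Modules) {U : X.Opens} {x : X} (hx : x ∈ U) (s : Γ(M, U)) :
    FirstOrderFibre M x :=
  Submodule.Quotient.mk (germ M hx s)

/-- A family of sections over `U` is a frame of `M` over `U` if it induces an isomorphism
`𝒪_U^ι ≅ M|_U`, that is, if it restricts to a basis of `M(V)` for every open `V ⊆ U`. -/
structure IsFrame (M : X.Modules) {ι : Type} (U : X.Opens) (e : ι → Γ(M, U)) : Prop where
  linearIndependent : ∀ (V : X.Opens) (h : V ≤ U),
    LinearIndependent Γ(X, V) (fun i => res M h (e i))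
  span_eq_top : ∀ (V : X.Opens) (h : V ≤ U),
    Submodule.span Γ(X, V) (Set.range fun i => res M h (e i)) = ⊤

/-- `M` is a vector bundle (a locally free sheaf) of rank `r`. -/
def IsVectorBundle (M : X.Modules) (r : ℕ) : Prop :=
  ∀ x : X, ∃ (U : X.Opens) (_ : x ∈ U) (e : Fin r → Γ(M, U)), IsFrame M U e

/-- A morphism `i : F ⟶ E` exhibits `F` as a subbundle of rank `k` of the vector bundle `E`: it is
injective with locally free quotient. Equivalently, near each point some frame of `F` of length `k`
is mapped to the first `k` members of a frame of `E`. -/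
def IsSubbundle {F E : X.Modules} (i : F ⟶ E) (k : ℕ) : Prop :=
  ∀ x : X, ∃ (U : X.Opens) (_ : x ∈ U) (l : ℕ) (f : Fin k → Γ(F, U)) (e : Fin k ⊕ Fin l → Γ(E, U)),
    IsFrame F U f ∧ IsFrame E U e ∧ ∀ j, i.app U (f j) = e (Sum.inl j)

end Modules

/-! ### Degree of a vector bundle -/

section Degree

variable {X : Scheme.{u}} [IsIntegral X] [IsLocallyNoetherian X]

/-- Let `s` be a frame of `F` over the nonempty open set `U₀`, so that `s₁ ∧ ⋯ ∧ s_k` is a nonzero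
rational section of the line bundle `det F`. This says that this rational section has order `n`
at the point `x`: in terms of a frame `e` of `F` near `x`, one has
`s₁ ∧ ⋯ ∧ s_k = det (a) • (e₁ ∧ ⋯ ∧ e_k)` where `s_j = ∑ i, a_ij e_i`, and the rational
function `det (a)` has order `n` at `x`. -/
def HasDetOrder (F : X.Modules) {k : ℕ} {U₀ : X.Opens} (s : Fin k → Γ(F, U₀)) (x : X) (n : ℤ) :
    Prop :=
  ∃ (U : X.Opens) (_ : x ∈ U) (e : Fin k → Γ(F, U)) (a : Matrix (Fin k) (Fin k) Γ(X, U₀ ⊓ U))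
    (hη : genericPoint X ∈ U₀ ⊓ U),
    IsFrame F U e ∧
    (∀ j, res F inf_le_left (s j) = ∑ i, a i j • res F inf_le_right (e i)) ∧
    Scheme.ord (germFun hη a.det : X.functionField) x = n

/-- The vector bundle `F` of rank `k` on a curve has degree `d`: the divisor `D` of some nonzero
rational section of `det F` has degree `d`. (On a smooth projective curve over an algebraically
closed field every vector bundle has exactly one degree in this sense.) -/
def HasDegree (F : X.Modules) (k : ℕ) (d : ℤ) : Prop :=
  ∃ (U₀ : X.Opens) (s : Fin k → Γ(F, U₀)) (D : X →₀ ℤ),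
    (U₀ : Set X).Nonempty ∧ IsFrame F U₀ s ∧ (∀ x, HasDetOrder F s x (D x)) ∧
    D.sum (fun _ n => n) = d

end Degree

/-! ### Orthogonal bundles -/

/-- An orthogonal bundle on `X`: a vector bundle `E` with a non-degenerate symmetric
`𝒪_X`-bilinear form `b : E × E ⟶ 𝒪_X`. Non-degeneracy, i.e. that `b` induces an isomorphism
`E ≅ E^*`, is expressed by the invertibility of the Gram matrices of local frames. -/
structure OrthogonalBundle (X : Scheme.{u}) where
  /-- the underlying sheaf of modules -/
  sheaf : X.Modules
  /-- the rank -/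
  rank : ℕ
  isVectorBundle : IsVectorBundle sheaf rank
  /-- the bilinear form on sections -/
  form : ∀ U : X.Opens, Γ(sheaf, U) →ₗ[Γ(X, U)] Γ(sheaf, U) →ₗ[Γ(X, U)] Γ(X, U)
  form_res : ∀ {U V : X.Opens} (h : V ≤ U) (s t : Γ(sheaf, U)),
    form V (res sheaf h s) (res sheaf h t) = resFun h (form U s t)
  form_symm : ∀ (U : X.Opens) (s t : Γ(sheaf, U)), form U s t = form U t s
  form_nondegenerate : ∀ (U : X.Opens) (e : Fin rank → Γ(sheaf, U)), IsFrame sheaf U e →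
    IsUnit (Matrix.of fun i j => form U (e i) (e j)).det

namespace OrthogonalBundle

variable {X : Scheme.{u}}

/-- The subsheaf `i : F ⟶ E` is isotropic: the form of `E` vanishes on it. -/
def IsIsotropic (E : OrthogonalBundle X) {F : X.Modules} (i : F ⟶ E.sheaf) : Prop :=
  ∀ (U : X.Opens) (s t : Γ(F, U)), E.form U (i.app U s) (i.app U t) = 0

/-- An orthogonal bundle is stable if every isotropic subbundle of positive rank has
negative degree. -/
def IsStable [IsIntegral X] [IsLocallyNoetherian X] (E : OrthogonalBundle X) : Prop :=
  ∀ (F : X.Modules) (i : F ⟶ E.sheaf) (k : ℕ) (d : ℤ), 0 < k → IsSubbundle i k →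
    E.IsIsotropic i → HasDegree F k d → d < 0

/-- A submodule `L` of `E_{2x}` is Lagrangian if it is isotropic for the
`𝒪_{X,x}/𝔪_x²`-valued form induced by that of `E`, and has dimension `rk E` over the base field.
For a closed point `x` of a curve over an algebraically closed field this dimension is the length
over `𝒪_{X,x}`, as the residue field is the base field. -/
structure IsLagrangian (E : OrthogonalBundle X) (x : X)
    (L : Submodule (X.presheaf.stalk x) (FirstOrderFibre E.sheaf x)) : Prop where
  isotropic : ∀ (U : X.Opens) (hx : x ∈ U) (s t : Γ(E.sheaf, U)),
    jet E.sheaf hx s ∈ L → jet E.sheaf hx t ∈ L →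
      germFun hx (E.form U s t) ∈ (IsLocalRing.maximalIdeal (X.presheaf.stalk x)) ^ 2
  length_eq : Module.length (X.presheaf.stalk x) L = E.rank

/-- `H` is the orthogonal Hecke transform of `E` with respect to `L ⊆ E_{2x}`, i.e. `H ≅ E'(x)`
with `E' = ker (E → E_{2x}/L)`. Here `E' ≅ N` is exhibited by `incl : N ⟶ E`, and `H ≅ N(x)` is
expressed by `twist : N ⟶ H`, which identifies `N` with `H(-x)`, the subsheaf of sections of `H`
vanishing at `x`. The form of `H` extends the restriction to `E'` of the form of `E`. -/
structure IsHeckeTransform (E : OrthogonalBundle X) (x : X)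
    (L : Submodule (X.presheaf.stalk x) (FirstOrderFibre E.sheaf x)) (H : OrthogonalBundle X)
    {N : X.Modules} (incl : N ⟶ E.sheaf) (twist : N ⟶ H.sheaf) : Prop where
  incl_injective : ∀ U : X.Opens, Function.Injective (incl.app U)
  mem_range_incl : ∀ (U : X.Opens) (s : Γ(E.sheaf, U)),
    s ∈ Set.range (incl.app U) ↔ ∀ hx : x ∈ U, jet E.sheaf hx s ∈ L
  twist_injective : ∀ U : X.Opens, Function.Injective (twist.app U)
  mem_range_twist : ∀ (U : X.Opens) (t : Γ(H.sheaf, U)),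
    t ∈ Set.range (twist.app U) ↔ ∀ hx : x ∈ U, germ H.sheaf hx t ∈
      IsLocalRing.maximalIdeal (X.presheaf.stalk x) •
        (⊤ : Submodule (X.presheaf.stalk x) (Stalk H.sheaf x))
  form_eq : ∀ (U : X.Opens) (s t : Γ(N, U)),
    H.form U (twist.app U s) (twist.app U t) = E.form U (incl.app U s) (incl.app U t)

/-- An orthogonal bundle is superstable if its orthogonal Hecke transforms with respect to all
Lagrangian submodules at all (closed) points are stable. -/
def IsSuperstable [IsIntegral X] [IsLocallyNoetherian X] (E : OrthogonalBundle X) : Prop :=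
  ∀ (x : X), IsClosed ({x} : Set X) →
    ∀ L : Submodule (X.presheaf.stalk x) (FirstOrderFibre E.sheaf x), E.IsLagrangian x L →
      ∀ (H : OrthogonalBundle X) (N : X.Modules) (incl : N ⟶ E.sheaf) (twist : N ⟶ H.sheaf),
        E.IsHeckeTransform x L H incl twist → H.IsStable

end OrthogonalBundle

end OrthogonalHecke

end

/-! Put `E' = ker (E → E_{2x}/L)` and `H = E'(x)`. Both `E` and `H` contain `E' = H(-x)` and agree
with it off `x`. Subbundles of `E` and of `H` therefore correspond through their generic fibres:
restrict off `x`, pass to the generic stalk, and saturate in the other bundle. Isotropy is a generic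
condition and survives. Only the contribution of `x` to the degree can change, and it is estimated
by determinants: if `ϖ ^ p • G` lies in `ϖ ^ q • B` near `x`, for a uniformizer `ϖ`, then the
saturation of `G` in `B` has degree at least `deg G + k (q - p)`, where `k` is the rank. This is
`exists_subbundle_transfer`, and `exists_isotropic_transfer` adds isotropy.

Suppose that the slopes in `E` are below `-1`, and let `G` be an isotropic subbundle of `H`. Then
`G(-x)` lies in `H(-x) = E'`, hence in `E`, and its saturation has degree at least `deg G - k`. So
`deg G - k < -k`, and `H` is stable (`IsHeckeTransform.isStable`).

Conversely, let `F` be an isotropic subbundle of a superstable `E`, and let `x` be any closed point.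
Near `x` take a frame of `E` made of a frame of `F`, a completion of it to a frame of the orthogonal
of `F`, and `k` further sections. Multiply the three groups by `1`, `ϖ`, `ϖ ^ 2`. They generate an
`E'` that comes from a Lagrangian `L`, and `H` is generated by the same sections divided by `ϖ`.
Thus `F(x)` lies in `H`, stability gives `deg F + k < 0`, and the slope is below `-1`
(`IsSuperstable.degree_lt`). Most of the work is the construction of `H` as an orthogonal bundle
from such a `HeckeFrame`.

The geometry of the curve enters through the existence of a closed point and through the local rings
at closed points, which are discrete valuation rings by smoothness. -/

noncomputable section

namespace OrthogonalHecke

universe u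

open Opposite

variable {X : Scheme.{u}}

/-! ### Elementary properties of sections -/

section Sections

@[simp]
lemma res_res (M : X.Modules) {U V W : X.Opens} (h : V ≤ U) (h' : W ≤ V) (s : Γ(M, U)) :
    res M h' (res M h s) = res M (h'.trans h) s := by
  change (M.presheaf.map (homOfLE h').op) (M.presheaf.map (homOfLE h).op s) = _
  rw [← ConcreteCategory.comp_apply, ← Functor.map_comp]
  rfl

@[simp]
lemma resFun_resFun {U V W : X.Opens} (h : V ≤ U) (h' : W ≤ V) (a : Γ(X, U)) :
    resFun h' (resFun h a) = resFun (h'.trans h) a := by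
  change (X.presheaf.map (homOfLE h').op) (X.presheaf.map (homOfLE h).op a) = _
  rw [← ConcreteCategory.comp_apply, ← Functor.map_comp]
  rfl

@[simp]
lemma res_self (M : X.Modules) {U : X.Opens} (h : U ≤ U) (s : Γ(M, U)) : res M h s = s := by
  change M.presheaf.map (𝟙 (op U)) s = s
  rw [CategoryTheory.Functor.map_id]; rfl

@[simp]
lemma resFun_self {U : X.Opens} (h : U ≤ U) (a : Γ(X, U)) : resFun h a = a := by
  change X.presheaf.map (𝟙 (op U)) a = a
  rw [CategoryTheory.Functor.map_id]; rfl

/-- Restriction of functions as a ring homomorphism. -/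
def resFunHom {U V : X.Opens} (h : V ≤ U) : Γ(X, U) →+* Γ(X, V) :=
  (X.presheaf.map (homOfLE h).op).hom

@[simp]
lemma resFunHom_apply {U V : X.Opens} (h : V ≤ U) (a : Γ(X, U)) :
    resFunHom h a = resFun h a := rfl

/-- The germ of functions as a ring homomorphism. -/
def germFunHom {U : X.Opens} {x : X} (hx : x ∈ U) : Γ(X, U) →+* X.presheaf.stalk x :=
  (X.presheaf.germ U x hx).hom

@[simp]
lemma germFunHom_apply {U : X.Opens} {x : X} (hx : x ∈ U) (a : Γ(X, U)) :
    germFunHom hx a = germFun hx a := rfl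

/-- Restriction of sections as an additive homomorphism. -/
def resHom (M : X.Modules) {U V : X.Opens} (h : V ≤ U) : Γ(M, U) →+ Γ(M, V) :=
  (M.presheaf.map (homOfLE h).op).hom

/-- The germ of sections as an additive homomorphism. -/
def germHom (M : X.Modules) {U : X.Opens} {x : X} (hx : x ∈ U) : Γ(M, U) →+ Stalk M x :=
  (M.presheaf.germ U x hx).hom

@[simp] lemma resFun_zero {U V : X.Opens} (h : V ≤ U) : resFun h (0 : Γ(X, U)) = 0 :=
  map_zero (resFunHom h)
@[simp] lemma resFun_one {U V : X.Opens} (h : V ≤ U) : resFun h (1 : Γ(X, U)) = 1 :=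
  map_one (resFunHom h)
@[simp] lemma resFun_add {U V : X.Opens} (h : V ≤ U) (a b : Γ(X, U)) :
    resFun h (a + b) = resFun h a + resFun h b := map_add (resFunHom h) a b
@[simp] lemma resFun_mul {U V : X.Opens} (h : V ≤ U) (a b : Γ(X, U)) :
    resFun h (a * b) = resFun h a * resFun h b := map_mul (resFunHom h) a b
@[simp] lemma resFun_sum {U V : X.Opens} (h : V ≤ U) {ι : Type*} (s : Finset ι)
    (a : ι → Γ(X, U)) : resFun h (∑ i ∈ s, a i) = ∑ i ∈ s, resFun h (a i) :=
  map_sum (resFunHom h) a s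
@[simp] lemma res_zero (M : X.Modules) {U V : X.Opens} (h : V ≤ U) :
    res M h (0 : Γ(M, U)) = 0 := map_zero (resHom M h)
@[simp] lemma res_sum (M : X.Modules) {U V : X.Opens} (h : V ≤ U) {ι : Type*} (s : Finset ι)
    (a : ι → Γ(M, U)) : res M h (∑ i ∈ s, a i) = ∑ i ∈ s, res M h (a i) :=
  map_sum (resHom M h) a s
@[simp] lemma germ_zero (M : X.Modules) {U : X.Opens} {x : X} (hx : x ∈ U) :
    germ M hx (0 : Γ(M, U)) = 0 := map_zero (germHom M hx)
@[simp] lemma germ_sub (M : X.Modules) {U : X.Opens} {x : X} (hx : x ∈ U) (s t : Γ(M, U)) :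
    germ M hx (s - t) = germ M hx s - germ M hx t := map_sub (germHom M hx) s t
lemma germ_smul (M : X.Modules) {U : X.Opens} {x : X} (hx : x ∈ U) (a : Γ(X, U))
    (s : Γ(M, U)) : germ M hx (a • s) = germFun hx a • germ M hx s :=
  (germFun_smul_germ M hx a s).symm
@[simp] lemma germ_sum (M : X.Modules) {U : X.Opens} {x : X} (hx : x ∈ U) {ι : Type*}
    (s : Finset ι) (a : ι → Γ(M, U)) : germ M hx (∑ i ∈ s, a i) = ∑ i ∈ s, germ M hx (a i) :=
  map_sum (germHom M hx) a s
@[simp] lemma germFun_zero {U : X.Opens} {x : X} (hx : x ∈ U) :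
    germFun hx (0 : Γ(X, U)) = 0 := map_zero (germFunHom hx)
@[simp] lemma germFun_mul {U : X.Opens} {x : X} (hx : x ∈ U) (a b : Γ(X, U)) :
    germFun hx (a * b) = germFun hx a * germFun hx b := map_mul (germFunHom hx) a b

lemma app_res {M N : X.Modules} (φ : M ⟶ N) {U V : X.Opens} (h : V ≤ U) (s : Γ(M, U)) :
    φ.app V (res M h s) = res N h (φ.app U s) :=
  CategoryTheory.congr_fun (φ.mapPresheaf.naturality (homOfLE h).op) s

/-- The action of a morphism on sections as a linear map. -/
def appLinear {M N : X.Modules} (φ : M ⟶ N) (U : X.Opens) : Γ(M, U) →ₗ[Γ(X, U)] Γ(N, U) where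
  toFun := φ.app U
  map_add' _ _ := map_add _ _ _
  map_smul' _ _ := φ.app_smul _ _

lemma exists_res_eq_of_germ_eq (M : X.Modules) {U V : X.Opens} {x : X} (hU : x ∈ U) (hV : x ∈ V)
    (s : Γ(M, U)) (t : Γ(M, V)) (h : germ M hU s = germ M hV t) :
    ∃ (W : X.Opens) (_ : x ∈ W) (h₁ : W ≤ U) (h₂ : W ≤ V), res M h₁ s = res M h₂ t := by
  obtain ⟨W, hW, i, j, e⟩ := M.presheaf.germ_eq x hU hV s t h
  exact ⟨W, hW, i.le, j.le, e⟩

lemma exists_resFun_eq_of_germFun_eq {U V : X.Opens} {x : X} (hU : x ∈ U) (hV : x ∈ V)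
    (s : Γ(X, U)) (t : Γ(X, V)) (h : germFun hU s = germFun hV t) :
    ∃ (W : X.Opens) (_ : x ∈ W) (h₁ : W ≤ U) (h₂ : W ≤ V), resFun h₁ s = resFun h₂ t := by
  obtain ⟨W, hW, i, j, e⟩ := X.presheaf.germ_eq x hU hV s t h
  exact ⟨W, hW, i.le, j.le, e⟩

/-- Sections which agree locally are equal. -/
lemma section_ext (M : X.Modules) {U : X.Opens} (s t : Γ(M, U))
    (h : ∀ x ∈ U, ∃ (V : X.Opens) (_ : x ∈ V) (hV : V ≤ U), res M hV s = res M hV t) :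
    s = t := by
  refine TopCat.Presheaf.section_ext ⟨M.presheaf, M.isSheaf⟩ U s t fun x hx => ?_
  obtain ⟨V, hxV, hV, e⟩ := h x hx
  have := congrArg (germ M hxV) e
  rwa [germ_res, germ_res] at this

lemma fun_ext {U : X.Opens} (s t : Γ(X, U))
    (h : ∀ x ∈ U, ∃ (V : X.Opens) (_ : x ∈ V) (hV : V ≤ U), resFun hV s = resFun hV t) :
    s = t := by
  refine TopCat.Presheaf.section_ext X.sheaf U s t fun x hx => ?_
  obtain ⟨V, hxV, hV, e⟩ := h x hx
  have := congrArg (germFun hxV) e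
  rwa [germFun_res, germFun_res] at this

/-- Compatible sections on an open cover can be glued. -/
lemma exists_glue (M : X.Modules) {U : X.Opens} {ι : Type*} (V : ι → X.Opens)
    (hV : ∀ i, V i ≤ U) (hc : ∀ x ∈ U, ∃ i, x ∈ V i) (s : ∀ i, Γ(M, V i))
    (hs : ∀ i j, res M (inf_le_left : V i ⊓ V j ≤ V i) (s i) = res M inf_le_right (s j)) :
    ∃ t : Γ(M, U), ∀ i, res M (hV i) t = s i := by
  obtain ⟨t, ht, -⟩ := TopCat.Sheaf.existsUnique_gluing' ⟨M.presheaf, M.isSheaf⟩ V U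
    (fun i => homOfLE (hV i)) (fun x hx => Opens.mem_iSup.2 (hc x hx)) s hs
  exact ⟨t, ht⟩

lemma exists_glue_fun {U : X.Opens} {ι : Type*} (V : ι → X.Opens)
    (hV : ∀ i, V i ≤ U) (hc : ∀ x ∈ U, ∃ i, x ∈ V i) (s : ∀ i, Γ(X, V i))
    (hs : ∀ i j, resFun (inf_le_left : V i ⊓ V j ≤ V i) (s i) = resFun inf_le_right (s j)) :
    ∃ t : Γ(X, U), ∀ i, resFun (hV i) t = s i := by
  obtain ⟨t, ht, -⟩ := TopCat.Sheaf.existsUnique_gluing' X.sheaf V U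
    (fun i => homOfLE (hV i)) (fun x hx => Opens.mem_iSup.2 (hc x hx)) s hs
  exact ⟨t, ht⟩

end Sections

/-! ### Subsheaves defined by local conditions -/

/-- A family of submodules of the sections of `M` which is stable under restriction and given by
a local condition. -/
structure LocalSubmodule (M : X.Modules) where
  /-- the submodule over an open set -/
  carrier : ∀ U : X.Opens, Submodule Γ(X, U) Γ(M, U)
  res_mem : ∀ {U V : X.Opens} (h : V ≤ U) (s : Γ(M, U)), s ∈ carrier U → res M h s ∈ carrier V
  mem_of_local : ∀ {U : X.Opens} (s : Γ(M, U)),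
    (∀ x ∈ U, ∃ (V : X.Opens) (_ : x ∈ V) (h : V ≤ U), res M h s ∈ carrier V) → s ∈ carrier U

namespace LocalSubmodule

variable {M : X.Modules} (S : LocalSubmodule M)

/-- The underlying abelian presheaf of the subsheaf. -/
def abPresheaf : TopCat.Presheaf Ab.{u} X where
  obj U := AddCommGrpCat.of (S.carrier U.unop)
  map {U V} f := AddCommGrpCat.ofHom
    { toFun := fun s => ⟨res M f.unop.le s.1, S.res_mem _ _ s.2⟩
      map_zero' := Subtype.ext (res_zero M f.unop.le)
      map_add' := fun s t => Subtype.ext (res_add M f.unop.le s.1 t.1) }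
  map_id U := by
    refine AddCommGrpCat.hom_ext (AddMonoidHom.ext fun (s : S.carrier U.unop) => ?_)
    exact Subtype.ext (res_self M le_rfl s.1)
  map_comp {U V W} f g := by
    refine AddCommGrpCat.hom_ext (AddMonoidHom.ext fun (s : S.carrier U.unop) => ?_)
    exact Subtype.ext (res_res M f.unop.le g.unop.le s.1).symm

lemma abPresheaf_isSheaf : S.abPresheaf.IsSheaf := by
  rw [TopCat.Presheaf.isSheaf_iff_isSheafUniqueGluing]
  intro ι V s hs
  obtain ⟨t, ht⟩ := exists_glue M V (fun i => le_iSup V i) (fun x hx => Opens.mem_iSup.1 hx)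
    (fun i => (s i).1) (fun i j => congrArg Subtype.val (hs i j))
  have htS : t ∈ S.carrier (iSup V) := S.mem_of_local t fun x hx => by
    obtain ⟨i, hi⟩ := Opens.mem_iSup.1 hx
    exact ⟨V i, hi, le_iSup V i, by rw [ht i]; exact (s i).2⟩
  refine ⟨⟨t, htS⟩, fun i => Subtype.ext (ht i), ?_⟩
  intro t' ht'
  refine Subtype.ext (section_ext M _ _ fun x hx => ?_)
  obtain ⟨i, hi⟩ := Opens.mem_iSup.1 hx
  exact ⟨V i, hi, le_iSup V i, (congrArg Subtype.val (ht' i)).trans (ht i).symm⟩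

instance (U : X.Opensᵒᵖ) : Module (X.ringCatSheaf.obj.obj U) (S.abPresheaf.obj U) :=
  inferInstanceAs (Module Γ(X, U.unop) (S.carrier U.unop))

/-- The subsheaf of modules given by a local condition. -/
def toModules : X.Modules :=
  { val := PresheafOfModules.ofPresheaf (R := X.ringCatSheaf.obj) S.abPresheaf
      (fun _ _ f r m => Subtype.ext (res_smul M f.unop.le r m.1))
    isSheaf := S.abPresheaf_isSheaf : SheafOfModules.{u} X.ringCatSheaf }

/-- The inclusion of the subsheaf. -/
def ι : S.toModules ⟶ M :=
  { val := PresheafOfModules.homMk (M₁ := S.toModules.val) (M₂ := M.val)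
      { app := fun U => AddCommGrpCat.ofHom (S.carrier U.unop).subtype.toAddMonoidHom
        naturality := fun U V f => by ext s; rfl }
      (fun U r m => rfl) : SheafOfModules.Hom S.toModules M }

/-- The section of the subsheaf given by a section satisfying the local condition. -/
def sec {U : X.Opens} (s : Γ(M, U)) (hs : s ∈ S.carrier U) : Γ(S.toModules, U) :=
  (⟨s, hs⟩ : S.carrier U)

@[simp]
lemma ι_sec {U : X.Opens} (s : Γ(M, U)) (hs : s ∈ S.carrier U) : S.ι.app U (S.sec s hs) = s := rfl

lemma ι_injective (U : X.Opens) : Function.Injective (S.ι.app U) :=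
  fun _ _ h => Subtype.ext h

lemma ι_mem {U : X.Opens} (s : Γ(S.toModules, U)) : S.ι.app U s ∈ S.carrier U :=
  Subtype.prop (p := (· ∈ S.carrier U)) s

lemma mem_range_ι {U : X.Opens} (s : Γ(M, U)) :
    s ∈ Set.range (S.ι.app U) ↔ s ∈ S.carrier U :=
  ⟨fun ⟨t, ht⟩ => ht ▸ S.ι_mem t, fun h => ⟨S.sec s h, rfl⟩⟩

variable {N : X.Modules} (φ : N ⟶ M) (hφ : ∀ (U : X.Opens) (s : Γ(N, U)), φ.app U s ∈ S.carrier U)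

/-- A morphism with values in the subsheaf. -/
def lift : N ⟶ S.toModules :=
  { val := PresheafOfModules.homMk (M₁ := N.val) (M₂ := S.toModules.val)
      { app := fun U => AddCommGrpCat.ofHom ((appLinear φ U.unop).codRestrict
          (S.carrier U.unop) (hφ U.unop)).toAddMonoidHom
        naturality := fun U V f => by
          ext s
          exact Subtype.ext (app_res φ f.unop.le s) }
      (fun U r m => Subtype.ext (φ.app_smul r m)) : SheafOfModules.Hom N S.toModules }

end LocalSubmodule

/-! ### Sections with arbitrary singularities outside an open set -/

section Away

/-- The sheaf `j_* j^* M` for the inclusion `j` of the open set `W`. -/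
def away (W : X.Opens) (M : X.Modules) : X.Modules :=
  (Scheme.Modules.pushforward W.ι).obj (M.restrict W.ι)

lemma image_preimage_eq (W U : X.Opens) : W.ι ''ᵁ (W.ι ⁻¹ᵁ U) = U ⊓ W := by
  rw [Scheme.Hom.image_preimage_eq_opensRange_inf, Scheme.Opens.opensRange_ι, inf_comm]

/-- The identification of the sections of `j_* j^* M` over `U` with sections of `M`. -/
def awayVal (W : X.Opens) (M : X.Modules) (U : X.Opens) :
    Γ(away W M, U) ≃+ Γ(M, W.ι ''ᵁ (W.ι ⁻¹ᵁ U)) :=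
  AddEquiv.refl Γ(M, W.ι ''ᵁ (W.ι ⁻¹ᵁ U))

lemma awayVal_res (W : X.Opens) (M : X.Modules) {U V : X.Opens} (h : V ≤ U)
    (s : Γ(away W M, U)) :
    awayVal W M V (res (away W M) h s) =
      res M (W.ι.image_mono (W.ι.preimage_mono h)) (awayVal W M U s) := rfl

lemma awayVal_smul (W : X.Opens) (M : X.Modules) {U : X.Opens} (a : Γ(X, U))
    (s : Γ(away W M, U)) :
    awayVal W M U (a • s) = resFun (W.ι.image_preimage_le U) a • awayVal W M U s :=
  congrArg (fun r : Γ(X, W.ι ''ᵁ (W.ι ⁻¹ᵁ U)) => r • awayVal W M U s)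
    (congr($(W.ι.app_appIso_inv U).hom a))

/-- A section of `j_* j^* M` over `U` is a section of `M` over `U ⊓ W`. -/
def awayEquiv (W : X.Opens) (M : X.Modules) (U : X.Opens) :
    Γ(away W M, U) ≃+ Γ(M, U ⊓ W) where
  toFun s := res M (image_preimage_eq W U).ge (awayVal W M U s)
  invFun s := (awayVal W M U).symm (res M (image_preimage_eq W U).le s)
  left_inv s := by simp
  right_inv s := by simp
  map_add' s t := by rw [map_add, res_add]

lemma awayEquiv_apply (W : X.Opens) (M : X.Modules) (U : X.Opens) (s : Γ(away W M, U)) :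
    awayEquiv W M U s = res M (image_preimage_eq W U).ge (awayVal W M U s) := rfl

lemma awayEquiv_res (W : X.Opens) (M : X.Modules) {U V : X.Opens} (h : V ≤ U)
    (s : Γ(away W M, U)) :
    awayEquiv W M V (res (away W M) h s) = res M (inf_le_inf_right W h) (awayEquiv W M U s) := by
  rw [awayEquiv_apply, awayEquiv_apply, awayVal_res, res_res, res_res]

lemma awayEquiv_smul (W : X.Opens) (M : X.Modules) {U : X.Opens} (a : Γ(X, U))
    (s : Γ(away W M, U)) :
    awayEquiv W M U (a • s) = resFun (inf_le_left : U ⊓ W ≤ U) a • awayEquiv W M U s := by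
  rw [awayEquiv_apply, awayEquiv_apply, awayVal_smul, res_smul, resFun_resFun]

/-- The restriction map `M ⟶ j_* j^* M`. -/
def toAway (W : X.Opens) (M : X.Modules) : M ⟶ away W M :=
  (Scheme.Modules.restrictAdjunction W.ι).unit.app M

@[simp]
lemma awayEquiv_toAway (W : X.Opens) (M : X.Modules) (U : X.Opens) (s : Γ(M, U)) :
    awayEquiv W M U ((toAway W M).app U s) = res M inf_le_left s := by
  have : awayVal W M U ((toAway W M).app U s) = res M (W.ι.image_preimage_le U) s := rfl
  rw [awayEquiv_apply, this, res_res]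

end Away

/-! ### Frames -/

section Frames

/-- Finitely many neighbourhoods have a common refinement; this lets all entries of a matrix of
germs be represented, or compared, over one open set. -/
lemma exists_common_nhd {ι : Type*} [Finite ι] {x : X} (P : ι → X.Opens → Prop)
    (mono : ∀ i (V W : X.Opens), W ≤ V → P i V → P i W) (h : ∀ i, ∃ V : X.Opens, x ∈ V ∧ P i V)
    {U : X.Opens} (hx : x ∈ U) : ∃ V : X.Opens, x ∈ V ∧ V ≤ U ∧ ∀ i, P i V := by
  choose V hV hP using h
  let W : X.Opens := ⟨⋂ i, (V i : Set X), isOpen_iInter_of_finite fun i => (V i).2⟩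
  exact ⟨U ⊓ W, ⟨hx, Set.mem_iInter.2 hV⟩, inf_le_left,
    fun i => mono i _ _ (inf_le_right.trans fun y hy => Set.mem_iInter.1 hy i) (hP i)⟩

lemma exists_common_germFun {ι : Type*} [Finite ι] {x : X} (r : ι → X.presheaf.stalk x)
    {U : X.Opens} (hx : x ∈ U) :
    ∃ (V : X.Opens) (hV : x ∈ V) (_ : V ≤ U) (a : ι → Γ(X, V)), ∀ i, germFun hV (a i) = r i := by
  obtain ⟨V, hV, hVU, h⟩ := exists_common_nhd (x := x)
    -- The outer existential carries no information. The predicate asks for a representative of the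
    -- germ over `V` as soon as `x ∈ V`, a condition inherited by smaller open sets.
    (fun i V => ∃ (hV : x ∈ V → True), ∀ hV : x ∈ V, ∃ a : Γ(X, V), germFun hV a = r i)
    (fun i V W hWV ⟨_, h⟩ => ⟨fun _ => trivial, fun hW => by
      obtain ⟨a, ha⟩ := h (hWV hW)
      exact ⟨resFun hWV a, by rw [germFun_res, ha]⟩⟩)
    (fun i => by
      obtain ⟨V, hV, a, ha⟩ := exists_germFun (r i)
      exact ⟨V, hV, fun _ => trivial, fun _ => ⟨a, ha⟩⟩) hx
  choose a ha using fun i => (h i).2 hV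
  exact ⟨V, hV, hVU, a, ha⟩

lemma exists_common_resFun_eq {ι : Type*} [Finite ι] {x : X} {U : X.Opens} (hx : x ∈ U)
    (a b : ι → Γ(X, U)) (h : ∀ i, germFun hx (a i) = germFun hx (b i)) :
    ∃ (V : X.Opens) (_ : x ∈ V) (hVU : V ≤ U), ∀ i, resFun hVU (a i) = resFun hVU (b i) := by
  obtain ⟨V, hV, hVU, h⟩ := exists_common_nhd (x := x)
    (fun i V => ∃ hV : V ≤ U, resFun hV (a i) = resFun hV (b i))
    (fun i V W hWV ⟨hVU, h⟩ => ⟨hWV.trans hVU, by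
      simpa only [resFun_resFun] using congrArg (resFun hWV) h⟩)
    (fun i => by
      obtain ⟨V, hV, h₁, h₂, e⟩ := exists_resFun_eq_of_germFun_eq hx hx _ _ (h i)
      exact ⟨V, hV, h₁, e⟩) hx
  exact ⟨V, hV, hVU, fun i => (h i).2⟩

variable {M : X.Modules} {ι κ : Type} {U V : X.Opens}

lemma IsFrame.restrict {e : ι → Γ(M, U)} (he : IsFrame M U e) (h : V ≤ U) :
    IsFrame M V (fun i => res M h (e i)) :=
  ⟨fun W hW => by simpa using he.1 W (hW.trans h), fun W hW => by simpa using he.2 W (hW.trans h)⟩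

lemma IsFrame.reindex {e : ι → Γ(M, U)} (he : IsFrame M U e) (σ : κ ≃ ι) :
    IsFrame M U (e ∘ σ) := by
  refine ⟨fun V h => (he.1 V h).comp σ σ.injective, fun V h => ?_⟩
  rw [← he.2 V h, ← σ.surjective.range_comp (fun i => res M h (e i))]
  rfl

variable [Fintype ι] [Fintype κ]

lemma isFrame_iff {e : ι → Γ(M, U)} : IsFrame M U e ↔
    ∀ (V : X.Opens) (h : V ≤ U),
      (∀ c : ι → Γ(X, V), ∑ i, c i • res M h (e i) = 0 → c = 0) ∧
      ∀ s : Γ(M, V), ∃ c : ι → Γ(X, V), ∑ i, c i • res M h (e i) = s := by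
  constructor
  · intro H V h
    refine ⟨fun c hc => funext (Fintype.linearIndependent_iff.1 (H.1 V h) c hc), fun s => ?_⟩
    have : s ∈ Submodule.span Γ(X, V) (Set.range fun i => res M h (e i)) :=
      H.2 V h ▸ Submodule.mem_top
    exact (Submodule.mem_span_range_iff_exists_fun _).1 this
  · intro H
    refine ⟨fun V h => Fintype.linearIndependent_iff.2 fun c hc => congrFun ((H V h).1 c hc),
      fun V h => ?_⟩
    rw [eq_top_iff]
    exact fun s _ => (Submodule.mem_span_range_iff_exists_fun _).2 ((H V h).2 s)

lemma IsFrame.exists_coord {e : ι → Γ(M, U)} (he : IsFrame M U e) (h : V ≤ U) (s : Γ(M, V)) :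
    ∃ c : ι → Γ(X, V), ∑ i, c i • res M h (e i) = s :=
  (isFrame_iff.1 he V h).2 s

lemma IsFrame.coord_eq_zero {e : ι → Γ(M, U)} (he : IsFrame M U e) (h : V ≤ U)
    {c : ι → Γ(X, V)} (hc : ∑ i, c i • res M h (e i) = 0) : c = 0 :=
  (isFrame_iff.1 he V h).1 c hc

lemma IsFrame.coord_unique {e : ι → Γ(M, U)} (he : IsFrame M U e) (h : V ≤ U)
    {c c' : ι → Γ(X, V)} (hc : ∑ i, c i • res M h (e i) = ∑ i, c' i • res M h (e i)) :
    c = c' := by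
  refine sub_eq_zero.1 (he.coord_eq_zero h ?_)
  simp [sub_smul, hc]

lemma sum_smul_sum_smul {R N : Type*} [CommRing R] [AddCommGroup N] [Module R N]
    (c : κ → R) (A : Matrix ι κ R) (e : ι → N) :
    ∑ j, c j • ∑ i, A i j • e i = ∑ i, (A.mulVec c) i • e i := by
  simp only [Finset.smul_sum, smul_smul, Matrix.mulVec, dotProduct, Finset.sum_smul]
  rw [Finset.sum_comm]
  simp only [mul_comm]

/-- A family obtained from a frame by an invertible matrix is a frame. -/
lemma IsFrame.change [DecidableEq ι] [DecidableEq κ] {e : ι → Γ(M, U)} (he : IsFrame M U e)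
    (A : Matrix ι κ Γ(X, U)) (B : Matrix κ ι Γ(X, U)) (hAB : A * B = 1) (hBA : B * A = 1)
    {t : κ → Γ(M, U)} (ht : ∀ j, t j = ∑ i, A i j • e i) : IsFrame M U t := by
  rw [isFrame_iff]
  intro V h
  have hAB' : A.map (resFunHom h) * B.map (resFunHom h) = 1 := by
    rw [← Matrix.map_mul, hAB, Matrix.map_one _ (map_zero _) (map_one _)]
  have hBA' : B.map (resFunHom h) * A.map (resFunHom h) = 1 := by
    rw [← Matrix.map_mul, hBA, Matrix.map_one _ (map_zero _) (map_one _)]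
  have key : ∀ c : κ → Γ(X, V), ∑ j, c j • res M h (t j) =
      ∑ i, ((A.map (resFunHom h)).mulVec c) i • res M h (e i) := by
    intro c
    rw [← sum_smul_sum_smul]
    simp [ht, res_smul]
  refine ⟨fun c hc => ?_, fun s => ?_⟩
  · rw [key] at hc
    have := congrArg ((B.map (resFunHom h)).mulVec) (he.coord_eq_zero h hc)
    rwa [Matrix.mulVec_mulVec, hBA', Matrix.one_mulVec, Matrix.mulVec_zero] at this
  · obtain ⟨c, rfl⟩ := he.exists_coord h s
    refine ⟨(B.map (resFunHom h)).mulVec c, ?_⟩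
    rw [key, Matrix.mulVec_mulVec, hAB', Matrix.one_mulVec]

/-- Morphisms which are bijective on small open sets carry frames to frames. -/
lemma IsFrame.map {N : X.Modules} (φ : M ⟶ N)
    (hφ : ∀ V : X.Opens, V ≤ U → Function.Bijective (φ.app V)) {e : ι → Γ(M, U)}
    (he : IsFrame M U e) : IsFrame N U (fun i => φ.app U (e i)) := by
  rw [isFrame_iff]
  intro V h
  have key : ∀ c : ι → Γ(X, V), ∑ i, c i • res N h (φ.app U (e i)) =
      φ.app V (∑ i, c i • res M h (e i)) := by
    intro c
    simp [← app_res]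
  refine ⟨fun c hc => ?_, fun s => ?_⟩
  · rw [key] at hc
    exact he.coord_eq_zero h ((hφ V h).1 (hc.trans (map_zero _).symm))
  · obtain ⟨t, rfl⟩ := (hφ V h).2 s
    obtain ⟨c, rfl⟩ := he.exists_coord h t
    exact ⟨c, key c⟩

lemma IsFrame.of_map {N : X.Modules} (φ : M ⟶ N)
    (hφ : ∀ V : X.Opens, V ≤ U → Function.Bijective (φ.app V)) {e : ι → Γ(M, U)}
    (he : IsFrame N U (fun i => φ.app U (e i))) : IsFrame M U e := by
  rw [isFrame_iff]
  intro V h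
  have key : ∀ c : ι → Γ(X, V), ∑ i, c i • res N h (φ.app U (e i)) =
      φ.app V (∑ i, c i • res M h (e i)) := by
    intro c
    simp [← app_res]
  refine ⟨fun c hc => he.coord_eq_zero h ?_, fun s => ?_⟩
  · rw [key, hc, map_zero]
  · obtain ⟨c, hc⟩ := he.exists_coord h (φ.app V s)
    exact ⟨c, (hφ V h).1 (by rw [← key, hc])⟩

/-- Two frames over the same open set are related by an invertible matrix. -/
lemma IsFrame.exists_matrix [DecidableEq ι] [DecidableEq κ] {e : ι → Γ(M, U)} {f : κ → Γ(M, U)}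
    (he : IsFrame M U e) (hf : IsFrame M U f) :
    ∃ (A : Matrix ι κ Γ(X, U)) (B : Matrix κ ι Γ(X, U)), A * B = 1 ∧ B * A = 1 ∧
      (∀ j, f j = ∑ i, A i j • e i) ∧ ∀ i, e i = ∑ j, B j i • f j := by
  choose A hA using fun j => he.exists_coord le_rfl (f j)
  choose B hB using fun i => hf.exists_coord le_rfl (e i)
  simp only [res_self] at hA hB
  let A' : Matrix ι κ Γ(X, U) := Matrix.of fun i j => A j i
  let B' : Matrix κ ι Γ(X, U) := Matrix.of fun j i => B i j
  have hA' : ∀ j, f j = ∑ i, A' i j • e i := fun j => (hA j).symm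
  have hB' : ∀ i, e i = ∑ j, B' j i • f j := fun i => (hB i).symm
  refine ⟨A', B', ?_, ?_, hA', hB'⟩
  -- Columns of the product are compared as coordinate vectors with respect to a frame, where
  -- coordinates are unique.
  · refine Matrix.ext_of_mulVec_single fun i => ?_
    refine he.coord_unique le_rfl ?_
    simp only [res_self]
    rw [← Matrix.mulVec_mulVec, ← sum_smul_sum_smul _ A' e, Matrix.one_mulVec]
    simp only [← hA']
    simp [← hB', Pi.single_apply]
  · refine Matrix.ext_of_mulVec_single fun i => ?_
    refine hf.coord_unique le_rfl ?_
    simp only [res_self]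
    rw [← Matrix.mulVec_mulVec, ← sum_smul_sum_smul _ B' f, Matrix.one_mulVec]
    simp only [← hB']
    simp [← hA', Pi.single_apply]

/-- The germs of a frame form a basis of the stalk. -/
def IsFrame.stalkBasis {e : ι → Γ(M, U)} (he : IsFrame M U e) {x : X} (hx : x ∈ U) :
    Module.Basis ι (X.presheaf.stalk x) (Stalk M x) :=
  Module.Basis.mk (v := fun i => germ M hx (e i))
    (by
      -- A linear relation between germs already holds between sections over a small neighbourhood,
      -- where the frame forces its coefficients to vanish.
      refine Fintype.linearIndependent_iff.2 fun r hr i => ?_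
      obtain ⟨V, hV, hVU, a, ha⟩ := exists_common_germFun r hx
      have h0 : germ M hV (∑ i, a i • res M hVU (e i)) = germ M hV 0 := by
        rw [germ_sum, germ_zero, ← hr]
        refine Finset.sum_congr rfl fun i _ => ?_
        rw [germ_smul, ha, germ_res]
      obtain ⟨W, hW, h₁, _, e₁⟩ := exists_res_eq_of_germ_eq M hV hV _ _ h0
      rw [res_zero, res_sum] at e₁
      simp only [res_smul, res_res] at e₁
      have := congrFun (he.coord_eq_zero _ e₁) i
      rw [← ha i, ← germFun_res h₁ hW, this]
      exact germFun_zero hW)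
    (by
      intro m _
      obtain ⟨V, hV, s, rfl⟩ := exists_germ M m
      obtain ⟨c, hc⟩ := he.exists_coord (V := U ⊓ V) inf_le_left (res M inf_le_right s)
      have hUV : x ∈ U ⊓ V := ⟨hx, hV⟩
      rw [← germ_res M (inf_le_right : U ⊓ V ≤ V) hUV, ← hc, germ_sum]
      refine Submodule.sum_mem _ fun i _ => ?_
      rw [germ_smul, germ_res]
      exact Submodule.smul_mem _ _ (Submodule.subset_span ⟨i, rfl⟩))

@[simp]
lemma IsFrame.stalkBasis_apply {e : ι → Γ(M, U)} (he : IsFrame M U e) {x : X} (hx : x ∈ U)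
    (i : ι) : he.stalkBasis hx i = germ M hx (e i) := by
  simp [IsFrame.stalkBasis]

/-- A basis of the stalk of a vector bundle extends to a frame on a neighbourhood. -/
lemma IsFrame.exists_spread {e : ι → Γ(M, U)} (he : IsFrame M U e) {x : X} (hx : x ∈ U)
    (b : Module.Basis κ (X.presheaf.stalk x) (Stalk M x)) :
    ∃ (V : X.Opens) (hV : x ∈ V) (_ : V ≤ U) (t : κ → Γ(M, V)),
      IsFrame M V t ∧ ∀ j, germ M hV (t j) = b j := by
  classical
  let b₀ := he.stalkBasis hx
  obtain ⟨V₁, hV₁, hVU₁, A, hA⟩ := exists_common_germFun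
    (fun p : ι × κ => b₀.toMatrix b p.1 p.2) hx
  obtain ⟨V₂, hV₂, hVU₂, B, hB⟩ := exists_common_germFun
    (fun p : κ × ι => b.toMatrix b₀ p.1 p.2) hV₁
  let A' : Matrix ι κ Γ(X, V₂) := Matrix.of fun i j => resFun hVU₂ (A (i, j))
  let B' : Matrix κ ι Γ(X, V₂) := Matrix.of fun j i => B (j, i)
  have hA' : A'.map (germFunHom hV₂) = b₀.toMatrix b := by
    ext i j
    exact (germFun_res _ _ _).trans (hA (i, j))
  have hB' : B'.map (germFunHom hV₂) = b.toMatrix b₀ := by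
    ext j i
    exact hB (j, i)
  -- The lifted transition matrices are mutually inverse only as germs at `x`. One shrinking gives
  -- `A' * B' = 1`, the next one `B' * A' = 1`.
  obtain ⟨V₃, hV₃, hVU₃, h₃⟩ := exists_common_resFun_eq hV₂
    (fun p : ι × ι => (A' * B') p.1 p.2) (fun p => (1 : Matrix ι ι Γ(X, V₂)) p.1 p.2) fun p => by
      have : (A' * B').map (germFunHom hV₂) = (1 : Matrix ι ι Γ(X, V₂)).map (germFunHom hV₂) := by
        rw [Matrix.map_mul, hA', hB', Module.Basis.toMatrix_mul_toMatrix_flip,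
          Matrix.map_one _ (map_zero _) (map_one _)]
      exact congrFun (congrFun this p.1) p.2
  obtain ⟨V₄, hV₄, hVU₄, h₄⟩ := exists_common_resFun_eq hV₃
    (fun p : κ × κ => resFun hVU₃ ((B' * A') p.1 p.2))
    (fun p => resFun hVU₃ ((1 : Matrix κ κ Γ(X, V₂)) p.1 p.2)) fun p => by
      have : (B' * A').map (germFunHom hV₂) = (1 : Matrix κ κ Γ(X, V₂)).map (germFunHom hV₂) := by
        rw [Matrix.map_mul, hA', hB', Module.Basis.toMatrix_mul_toMatrix_flip,
          Matrix.map_one _ (map_zero _) (map_one _)]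
      simp only [germFun_res]
      exact congrFun (congrFun this p.1) p.2
  have h42 : V₄ ≤ V₂ := hVU₄.trans hVU₃
  have h4U : V₄ ≤ U := h42.trans (hVU₂.trans hVU₁)
  have hAB : A'.map (resFunHom h42) * B'.map (resFunHom h42) = 1 := by
    rw [← Matrix.map_mul]
    ext i j
    have := congrArg (resFun hVU₄) (h₃ (i, j))
    simp only [resFun_resFun] at this
    rw [Matrix.map_apply, resFunHom_apply, this, Matrix.one_apply, Matrix.one_apply]
    split_ifs <;> simp
  have hBA : B'.map (resFunHom h42) * A'.map (resFunHom h42) = 1 := by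
    rw [← Matrix.map_mul]
    ext i j
    have := h₄ (i, j)
    simp only [resFun_resFun] at this
    rw [Matrix.map_apply, resFunHom_apply, this, Matrix.one_apply, Matrix.one_apply]
    split_ifs <;> simp
  refine ⟨V₄, hV₄, h4U, fun j => ∑ i, resFun h42 (A' i j) • res M h4U (e i),
    (he.restrict h4U).change _ _ hAB hBA fun j => rfl, fun j => ?_⟩
  rw [germ_sum, ← b₀.sum_toMatrix_smul_self b j]
  refine Finset.sum_congr rfl fun i _ => ?_
  rw [germ_smul, germFun_res, germ_res, ← hA']
  simp [b₀]

end Frames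

lemma IsFrame.span_germ_eq_top {M : X.Modules} {ι : Type} [Fintype ι] {U : X.Opens}
    {e : ι → Γ(M, U)} (he : IsFrame M U e) {x : X} (hx : x ∈ U) :
    Submodule.span (X.presheaf.stalk x) (Set.range fun i => germ M hx (e i)) = ⊤ := by
  rw [← (he.stalkBasis hx).span_eq]
  congr 2
  ext i
  simp

/-! ### Stalks of morphisms -/

section StalkMaps

/-- The linear map induced by a morphism on stalks. -/
def stalkLinear {M N : X.Modules} (φ : M ⟶ N) (x : X) :
    Stalk M x →ₗ[X.presheaf.stalk x] Stalk N x where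
  toFun := (TopCat.Presheaf.stalkFunctor Ab x).map φ.mapPresheaf
  map_add' _ _ := map_add _ _ _
  map_smul' r m := by
    obtain ⟨U, hU, a, s, rfl, rfl⟩ := exists_germ₂ M r m
    have key : ∀ t : Γ(M, U), (TopCat.Presheaf.stalkFunctor Ab x).map φ.mapPresheaf
        (germ M hU t) = (germ N hU (φ.app U t) : Stalk N x) :=
      fun t => TopCat.Presheaf.stalkFunctor_map_germ_apply U x hU φ.mapPresheaf t
    rw [germFun_smul_germ, key, φ.app_smul, germ_smul]
    exact congrArg (fun m : Stalk N x => germFun hU a • m) (key s).symm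

@[simp]
lemma stalkLinear_germ {M N : X.Modules} (φ : M ⟶ N) {x : X} {U : X.Opens} (hx : x ∈ U)
    (s : Γ(M, U)) : stalkLinear φ x (germ M hx s) = germ N hx (φ.app U s) :=
  TopCat.Presheaf.stalkFunctor_map_germ_apply U x hx φ.mapPresheaf s

lemma stalkLinear_injective {M N : X.Modules} (φ : M ⟶ N) {x : X} {U : X.Opens} (hx : x ∈ U)
    (hφ : ∀ V : X.Opens, V ≤ U → Function.Injective (φ.app V)) :
    Function.Injective (stalkLinear φ x) := by
  rw [injective_iff_map_eq_zero]
  intro m hm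
  obtain ⟨V, hV, s, rfl⟩ := exists_germ M m
  have hUV : x ∈ U ⊓ V := ⟨hx, hV⟩
  rw [← germ_res M (inf_le_right : U ⊓ V ≤ V) hUV] at hm ⊢
  rw [stalkLinear_germ, ← germ_zero N hUV] at hm
  obtain ⟨W, hW, h₁, h₂, e⟩ := exists_res_eq_of_germ_eq N _ _ _ _ hm
  rw [res_zero, ← app_res] at e
  have := hφ W (h₁.trans inf_le_left) (e.trans (map_zero _).symm)
  rw [← germ_res M h₁ hW, this, germ_zero]

/-- Injectivity on the stalk transports span conditions in both directions. Applied to `α` and `β`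
at the generic point, it moves them between two bundles through `N`. -/
lemma germ_mem_span_iff {M N : X.Modules} (φ : M ⟶ N) {x : X} {U : X.Opens} (hx : x ∈ U)
    (hφ : ∀ V : X.Opens, V ≤ U → Function.Injective (φ.app V)) {U₁ U₂ : X.Opens} (h₁ : x ∈ U₁)
    (h₂ : x ∈ U₂) {ι : Type*} (s : ι → Γ(M, U₁)) (t : Γ(M, U₂)) :
    germ N h₂ (φ.app U₂ t) ∈ Submodule.span (X.presheaf.stalk x)
        (Set.range fun i => germ N h₁ (φ.app U₁ (s i))) ↔
      germ M h₂ t ∈ Submodule.span (X.presheaf.stalk x) (Set.range fun i => germ M h₁ (s i)) := by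
  simp only [← stalkLinear_germ]
  rw [Set.range_comp' (stalkLinear φ x), ← Submodule.map_span]
  exact (stalkLinear_injective φ hx hφ).mem_set_image

end StalkMaps

/-! ### Sections over integral schemes -/

section Integral

variable [IsIntegral X]

lemma genericPoint_mem {U : X.Opens} {x : X} (hx : x ∈ U) : genericPoint X ∈ U :=
  (genericPoint_specializes x).mem_open U.2 hx

lemma germFun_injective {U : X.Opens} {x : X} (hx : x ∈ U) :
    Function.Injective (germFun hx : Γ(X, U) → X.presheaf.stalk x) :=
  germ_injective_of_isIntegral X x hx

lemma resFun_injective {U V : X.Opens} {x : X} (hx : x ∈ V) (h : V ≤ U) :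
    Function.Injective (resFun h : Γ(X, U) → Γ(X, V)) := by
  intro a b hab
  refine germFun_injective (h hx) ?_
  rw [← germFun_res h hx, ← germFun_res h hx, hab]

lemma algebraMap_germFun {U : X.Opens} {x : X} (hx : x ∈ U) (a : Γ(X, U)) :
    algebraMap (X.presheaf.stalk x) X.functionField (germFun hx a) =
      germFun (genericPoint_mem hx) a := by
  have : Nonempty U := ⟨⟨x, hx⟩⟩
  exact Scheme.algebraMap_germ_eq_germToFunctionField X hx a

/-- The map from the stalk at a point to the stalk at the generic point. -/
def toGeneric (M : X.Modules) (x : X) : Stalk M x →+ Stalk M (genericPoint X) :=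
  (M.presheaf.stalkSpecializes (genericPoint_specializes x)).hom

@[simp]
lemma toGeneric_germ (M : X.Modules) {x : X} {U : X.Opens} (hx : x ∈ U) (s : Γ(M, U)) :
    toGeneric M x (germ M hx s) = germ M (genericPoint_mem hx) s :=
  congr($(M.presheaf.germ_stalkSpecializes hx (genericPoint_specializes x)) s)

lemma toGeneric_smul (M : X.Modules) {x : X} (r : X.presheaf.stalk x) (m : Stalk M x) :
    toGeneric M x (r • m) = algebraMap _ X.functionField r • toGeneric M x m := by
  obtain ⟨U, hU, a, s, rfl, rfl⟩ := exists_germ₂ M r m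
  rw [germFun_smul_germ, toGeneric_germ, toGeneric_germ, algebraMap_germFun, germ_smul]

/-- Coordinates in a local frame are functions on an integral scheme, so their germs at the generic
point determine them. -/
lemma eq_zero_of_germ_eq_zero {M : X.Modules} {ι : X → Type} [∀ x, Fintype (ι x)] {U : X.Opens}
    (hM : ∀ x ∈ U, ∃ (V : X.Opens) (_ : x ∈ V) (e : ι x → Γ(M, V)), IsFrame M V e)
    (hη : genericPoint X ∈ U) {s : Γ(M, U)} (hs : germ M hη s = 0) : s = 0 := by
  refine section_ext M _ _ fun x hx => ?_
  obtain ⟨V, hV, e, he⟩ := hM x hx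
  have hUV : x ∈ U ⊓ V := ⟨hx, hV⟩
  refine ⟨U ⊓ V, hUV, inf_le_left, ?_⟩
  have hη' := genericPoint_mem hUV
  obtain ⟨c, hc⟩ := he.exists_coord (inf_le_right : U ⊓ V ≤ V) (res M inf_le_left s)
  have h0 : ∑ i, germFun hη' (c i) • he.stalkBasis hη'.2 i = 0 := by
    rw [← hs, ← germ_res M inf_le_left hη', ← hc, germ_sum]
    refine Finset.sum_congr rfl fun i _ => ?_
    rw [germ_smul, germ_res, IsFrame.stalkBasis_apply]
  have hc0 : c = 0 := funext fun i => germFun_injective hη' <| by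
    rw [Fintype.linearIndependent_iff.1 (he.stalkBasis hη'.2).linearIndependent _ h0 i]
    exact (germFun_zero hη').symm
  rw [← hc, hc0]
  simp

lemma IsVectorBundle.germ_injective {M : X.Modules} {r : ℕ} (hM : IsVectorBundle M r)
    {U : X.Opens} (hη : genericPoint X ∈ U) : Function.Injective (germ M hη) := by
  intro s t hst
  refine sub_eq_zero.1 (eq_zero_of_germ_eq_zero (ι := fun _ => Fin r) (fun x _ => hM x) hη ?_)
  rw [germ_sub, hst, sub_self]

lemma IsVectorBundle.res_injective {M : X.Modules} {r : ℕ} (hM : IsVectorBundle M r)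
    {U V : X.Opens} {x : X} (hx : x ∈ V) (h : V ≤ U) : Function.Injective (res M h) := by
  intro s t hst
  refine hM.germ_injective (genericPoint_mem (h hx)) ?_
  rw [← germ_res M h (genericPoint_mem hx), ← germ_res M h (genericPoint_mem hx), hst]

end Integral

/-! ### Subbundles -/

section Subbundles

variable {M N : X.Modules}

/-- Injectivity makes local preimages unique, hence compatible, and they glue. -/
lemma mem_range_app_of_local (φ : M ⟶ N) (hφ : ∀ U : X.Opens, Function.Injective (φ.app U))
    {U : X.Opens} (t : Γ(N, U))
    (ht : ∀ x ∈ U, ∃ (V : X.Opens) (_ : x ∈ V) (h : V ≤ U), res N h t ∈ Set.range (φ.app V)) :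
    t ∈ Set.range (φ.app U) := by
  choose V hxV hV s hs using fun x : U => ht x x.2
  obtain ⟨t', ht'⟩ := exists_glue M V hV (fun x hx => ⟨⟨x, hx⟩, hxV _⟩) s fun i j => hφ _ <| by
    rw [app_res, app_res, hs, hs, res_res, res_res]
  refine ⟨t', section_ext N _ _ fun x hx => ⟨V ⟨x, hx⟩, hxV _, hV _, ?_⟩⟩
  rw [← app_res, ht', hs]

variable {k : ℕ}

/-- A frame of `M` becomes part of a frame of `N`, so a section killed by `φ` has zero coordinates.
-/
lemma IsSubbundle.injective {φ : M ⟶ N} (h : IsSubbundle φ k) (U : X.Opens) :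
    Function.Injective (φ.app U) := by
  rw [injective_iff_map_eq_zero]
  intro s hs
  refine section_ext M _ _ fun x hx => ?_
  obtain ⟨V, hV, l, f, e, hf, he, hfe⟩ := h x
  have hUV : x ∈ U ⊓ V := ⟨hx, hV⟩
  refine ⟨U ⊓ V, hUV, inf_le_left, ?_⟩
  obtain ⟨c, hc⟩ := hf.exists_coord (inf_le_right : U ⊓ V ≤ V) (res M inf_le_left s)
  have h0 : ∑ i, (Sum.elim c 0 : Fin k ⊕ Fin l → Γ(X, U ⊓ V)) i •
      res N (inf_le_right : U ⊓ V ≤ V) (e i) = 0 := by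
    have := congrArg (φ.app (U ⊓ V)) hc
    rw [app_res, hs, res_zero] at this
    rw [← this]
    simp [Fintype.sum_sum_type, app_res, hfe]
  have := he.coord_eq_zero _ h0
  have hc0 : c = 0 := funext fun i => congrFun this (Sum.inl i)
  rw [← hc, hc0]
  simp

lemma sum_mem_span_inl_iff {R V : Type*} [CommRing R] [AddCommGroup V] [Module R V]
    {ι κ : Type*} [Fintype ι] [Fintype κ] (b : Module.Basis (ι ⊕ κ) R V) (c : ι ⊕ κ → R) :
    ∑ i, c i • b i ∈ Submodule.span R (Set.range fun i => b (Sum.inl i)) ↔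
      ∀ j, c (Sum.inr j) = 0 := by
  rw [Fintype.sum_sum_type]
  have h1 : ∑ i, c (Sum.inl i) • b (Sum.inl i) ∈
      Submodule.span R (Set.range fun i => b (Sum.inl i)) :=
    Submodule.sum_mem _ fun i _ => Submodule.smul_mem _ _ (Submodule.subset_span ⟨i, rfl⟩)
  rw [Submodule.add_mem_iff_right _ h1]
  constructor
  · intro h j
    obtain ⟨d, hd⟩ := (Submodule.mem_span_range_iff_exists_fun _).1 h
    have : ∑ i, (Sum.elim (-d) (fun j => c (Sum.inr j)) : ι ⊕ κ → R) i • b i = 0 := by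
      simp [Fintype.sum_sum_type, hd]
    exact Fintype.linearIndependent_iff.1 b.linearIndependent _ this (Sum.inr j)
  · intro h
    simp [h]

/-- A section of a vector bundle lies in a subbundle if it does so generically. -/
lemma IsSubbundle.mem_range_iff [IsIntegral X] {φ : M ⟶ N} (h : IsSubbundle φ k) {U₀ : X.Opens}
    (hη : genericPoint X ∈ U₀) {s : Fin k → Γ(M, U₀)} (hs : IsFrame M U₀ s) {U : X.Opens}
    (t : Γ(N, U)) :
    t ∈ Set.range (φ.app U) ↔ ∀ hU : genericPoint X ∈ U, germ N hU t ∈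
      Submodule.span X.functionField (Set.range fun j => germ N hη (φ.app U₀ (s j))) := by
  constructor
  · rintro ⟨m, rfl⟩ hU
    simp only [← stalkLinear_germ]
    rw [Set.range_comp' (stalkLinear φ _), ← Submodule.map_span]
    refine Submodule.mem_map_of_mem ?_
    rw [hs.span_germ_eq_top]
    exact Submodule.mem_top
  · intro ht
    refine mem_range_app_of_local φ h.injective t fun x hx => ?_
    obtain ⟨V, hV, l, f, e, hf, he, hfe⟩ := h x
    have hUV : x ∈ U ⊓ V := ⟨hx, hV⟩
    have hη' := genericPoint_mem hUV
    refine ⟨U ⊓ V, hUV, inf_le_left, ?_⟩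
    obtain ⟨c, hc⟩ := he.exists_coord (inf_le_right : U ⊓ V ≤ V) (res N inf_le_left t)
    -- At the generic point every frame of `M` spans the same subspace, so the given frame `s` may
    -- be exchanged for the local one. The remaining coordinates of `t` then vanish generically,
    -- hence everywhere.
    have hle : Submodule.span X.functionField (Set.range fun j => germ N hη (φ.app U₀ (s j))) ≤
        Submodule.span X.functionField
          (Set.range fun i => he.stalkBasis hη'.2 (Sum.inl i)) := by
      rw [Submodule.span_le]
      rintro _ ⟨j, rfl⟩
      simp only [IsFrame.stalkBasis_apply, ← hfe, ← stalkLinear_germ]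
      rw [Set.range_comp' (stalkLinear φ _), ← Submodule.map_span, hf.span_germ_eq_top]
      exact Submodule.mem_map_of_mem Submodule.mem_top
    have key := hle (ht (genericPoint_mem hx))
    have e1 : germ N (genericPoint_mem hx) t =
        ∑ i, germFun hη' (c i) • he.stalkBasis hη'.2 i := by
      rw [← germ_res N inf_le_left hη', ← hc, germ_sum]
      refine Finset.sum_congr rfl fun i _ => ?_
      rw [germ_smul, germ_res, IsFrame.stalkBasis_apply]
    rw [e1, sum_mem_span_inl_iff] at key
    have hc0 : ∀ j, c (Sum.inr j) = 0 := fun j => germFun_injective hη' <| by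
      rw [key j]
      exact (germFun_zero hη').symm
    refine ⟨∑ i, c (Sum.inl i) • res M inf_le_right (f i), ?_⟩
    rw [← hc, Fintype.sum_sum_type]
    simp [hc0, app_res, hfe]

end Subbundles

/-! ### Saturations -/

section Saturation

variable [IsIntegral X]

variable (B : X.Modules) (E : Submodule X.functionField (Stalk B (genericPoint X)))

/-- The sections of `B` whose germ at the generic point lies in a given subspace. -/
def saturation : LocalSubmodule B where
  carrier U :=
    { carrier := {s | ∀ hη : genericPoint X ∈ U, germ B hη s ∈ E}
      zero_mem' := fun hη => by rw [germ_zero]; exact E.zero_mem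
      add_mem' := fun hs ht hη => by rw [germ_add]; exact E.add_mem (hs hη) (ht hη)
      smul_mem' := fun a s hs hη => by rw [germ_smul]; exact E.smul_mem _ (hs hη) }
  res_mem h s hs hη := by
    rw [germ_res B h hη]
    exact hs (h hη)
  mem_of_local s h hη := by
    obtain ⟨V, hV, hVU, hs⟩ := h _ hη
    have := hs hV
    rwa [germ_res] at this

variable {B E}

lemma mem_saturation {U : X.Opens} {s : Γ(B, U)} :
    s ∈ (saturation B E).carrier U ↔ ∀ hη : genericPoint X ∈ U, germ B hη s ∈ E := Iff.rfl

/-- The condition at the generic point annihilates the last `l` coordinates there, and a function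
vanishing generically vanishes. -/
lemma isFrame_saturation {k l : ℕ} {U : X.Opens} {t : Fin k ⊕ Fin l → Γ(B, U)}
    (ht : IsFrame B U t)
    (hE : ∀ hη : genericPoint X ∈ U,
      E = Submodule.span X.functionField (Set.range fun j => germ B hη (t (Sum.inl j))))
    (hmem : ∀ j, t (Sum.inl j) ∈ (saturation B E).carrier U) :
    IsFrame (saturation B E).toModules U (fun j => (saturation B E).sec _ (hmem j)) := by
  rw [isFrame_iff]
  intro V h
  have key : ∀ c : Fin k → Γ(X, V), (saturation B E).ι.app V
      (∑ j, c j • res _ h ((saturation B E).sec _ (hmem j))) =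
        ∑ j, c j • res B h (t (Sum.inl j)) := by
    intro c
    simp [app_res]
  refine ⟨fun c hc => ?_, fun s => ?_⟩
  · have h0 : ∑ i, (Sum.elim c 0 : Fin k ⊕ Fin l → Γ(X, V)) i • res B h (t i) = 0 := by
      rw [Fintype.sum_sum_type]
      simp [← key, hc]
    exact funext fun j => congrFun (ht.coord_eq_zero h h0) (Sum.inl j)
  · obtain ⟨c, hc⟩ := ht.exists_coord h ((saturation B E).ι.app V s)
    have hc0 : ∀ j, c (Sum.inr j) = 0 := by
      intro j
      refine fun_ext _ _ fun x hx => ⟨V, hx, le_rfl, ?_⟩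
      have hη := genericPoint_mem hx
      have hs := (saturation B E).ι_mem s hη
      have e1 : germ B hη ((saturation B E).ι.app V s) =
          ∑ i, germFun hη (c i) • ht.stalkBasis (h hη) i := by
        rw [← hc, germ_sum]
        refine Finset.sum_congr rfl fun i _ => ?_
        rw [germ_smul, germ_res, IsFrame.stalkBasis_apply]
      rw [e1] at hs
      have hE' : E = Submodule.span X.functionField
          (Set.range fun j => ht.stalkBasis (h hη) (Sum.inl j)) := by
        simpa only [IsFrame.stalkBasis_apply] using hE (h hη)
      rw [hE', sum_mem_span_inl_iff] at hs
      rw [resFun_self, resFun_self]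
      refine germFun_injective hη ?_
      rw [hs j]
      exact (germFun_zero hη).symm
    refine ⟨fun j => c (Sum.inl j), (saturation B E).ι_injective V ?_⟩
    rw [key, ← hc, Fintype.sum_sum_type]
    simp [hc0]

/-- The hypothesis makes the quotient torsion-free, hence free over a principal ideal domain, so
bases of `S` and of `V ⧸ S` combine. -/
lemma exists_complemented_basis {R V : Type*} [CommRing R] [IsDomain R] [IsPrincipalIdealRing R]
    [AddCommGroup V] [Module R V] [Module.Finite R V] [Module.Free R V] (S : Submodule R V)
    (hS : ∀ (r : R) (v : V), r ≠ 0 → r • v ∈ S → v ∈ S) :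
    ∃ (k l : ℕ) (b : Module.Basis (Fin k ⊕ Fin l) R V),
      S = Submodule.span R (Set.range fun i => b (Sum.inl i)) := by
  have : Module.IsTorsionFree R (V ⧸ S) := by
    refine ⟨fun r hr => ?_⟩
    rw [isSMulRegular_iff_right_eq_zero_of_smul]
    intro q hq
    obtain ⟨v, rfl⟩ := Submodule.Quotient.mk_surjective S q
    rw [← Submodule.Quotient.mk_smul, Submodule.Quotient.mk_eq_zero] at hq
    exact (Submodule.Quotient.mk_eq_zero S).2 (hS r v hr.ne_zero hq)
  have : Module.Free R S := inferInstance
  let bS := Module.finBasis R S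
  refine ⟨_, _, bS.sumQuot (Module.finBasis R (V ⧸ S)), ?_⟩
  simp only [Module.Basis.sumQuot_inl]
  rw [Set.range_comp' Subtype.val bS, ← S.coe_subtype, ← Submodule.map_span, bS.span_eq,
    Submodule.map_subtype_top]

/-- A subspace of the generic stalk extends to a subbundle near a point with principal local
ring. -/
lemma exists_frame_saturation {x : X} [IsPrincipalIdealRing (X.presheaf.stalk x)] {r : ℕ}
    {U₀ : X.Opens} (hx : x ∈ U₀) {e : Fin r → Γ(B, U₀)} (he : IsFrame B U₀ e) {k : ℕ}
    (b : Module.Basis (Fin k) X.functionField E) :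
    ∃ (U : X.Opens) (_ : x ∈ U) (l : ℕ) (t : Fin k ⊕ Fin l → Γ(B, U)), IsFrame B U t ∧
      (∀ j, t (Sum.inl j) ∈ (saturation B E).carrier U) ∧
      (∀ hη : genericPoint X ∈ U,
        E = Submodule.span X.functionField (Set.range fun j => germ B hη (t (Sum.inl j)))) := by
  let R := X.presheaf.stalk x
  have := Module.Finite.of_basis (he.stalkBasis hx)
  have := Module.Free.of_basis (he.stalkBasis hx)
  -- The lattice cut out in the stalk by the generic subspace. It is saturated because nonzero
  -- scalars of `R` are invertible in the function field.
  let S : Submodule R (Stalk B x) :=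
    { carrier := {m | toGeneric B x m ∈ E}
      zero_mem' := by simp
      add_mem' := fun hs ht => by
        simp only [Set.mem_ofPred_eq, map_add] at hs ht ⊢
        exact E.add_mem hs ht
      smul_mem' := fun a s hs => by
        have := E.smul_mem (algebraMap R X.functionField a) hs
        rwa [← toGeneric_smul] at this }
  have memS : ∀ m, m ∈ S ↔ toGeneric B x m ∈ E := fun m => Iff.rfl
  obtain ⟨k', l, b', hb'⟩ := exists_complemented_basis S fun a m ha hm => by
    rw [memS, toGeneric_smul] at hm
    have ha' : algebraMap R X.functionField a ≠ 0 := by simpa using ha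
    rw [memS]
    have := E.smul_mem (algebraMap R X.functionField a)⁻¹ hm
    rwa [smul_smul, inv_mul_cancel₀ ha', one_smul] at this
  obtain ⟨U, hU, -, t, ht, htb⟩ := he.exists_spread hx b'
  have hmem : ∀ j, t (Sum.inl j) ∈ (saturation B E).carrier U := by
    intro j hη
    rw [← toGeneric_germ B hU, htb, ← memS, hb']
    exact Submodule.subset_span ⟨j, rfl⟩
  have hspan : ∀ hη : genericPoint X ∈ U,
        E = Submodule.span X.functionField (Set.range fun j => germ B hη (t (Sum.inl j))) := by
    intro hη
    refine le_antisymm (fun v hv => ?_) ?_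
    · let c := (ht.stalkBasis hη).repr v
      have hc : ∑ i, c i • ht.stalkBasis hη i = v := (ht.stalkBasis hη).sum_repr v
      -- Clearing denominators brings a multiple of `v` into the lattice `S`, where the last
      -- coordinates are zero.
      obtain ⟨d, hd⟩ := IsLocalization.exist_integer_multiples_of_finite (nonZeroDivisors R) c
      choose c' hc' using hd
      have hm : ∑ i, c' i • b' i ∈ S := by
        rw [memS, map_sum]
        have : (algebraMap R X.functionField d.1) • v ∈ E := E.smul_mem _ hv
        convert this using 1
        rw [← hc, Finset.smul_sum]
        refine Finset.sum_congr rfl fun i _ => ?_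
        rw [toGeneric_smul, hc', smul_smul, ← htb, toGeneric_germ, IsFrame.stalkBasis_apply,
          Algebra.smul_def]
      rw [hb', sum_mem_span_inl_iff] at hm
      have hc0 : ∀ j, c (Sum.inr j) = 0 := by
        intro j
        have := hc' (Sum.inr j)
        rw [hm j, map_zero, Algebra.smul_def, eq_comm, mul_eq_zero] at this
        exact this.resolve_left (by simp)
      have : v ∈ Submodule.span X.functionField
          (Set.range fun i => ht.stalkBasis hη (Sum.inl i)) := by
        rw [← hc, sum_mem_span_inl_iff]
        exact hc0
      simpa only [IsFrame.stalkBasis_apply] using this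
    · rw [Submodule.span_le]
      rintro _ ⟨j, rfl⟩
      exact hmem j hη
  have hη := genericPoint_mem hU
  have hli : LinearIndependent X.functionField (fun j => germ B hη (t (Sum.inl j))) := by
    have := (ht.stalkBasis hη).linearIndependent.comp Sum.inl Sum.inl_injective
    simpa only [Function.comp_def, IsFrame.stalkBasis_apply] using this
  let b₂ : Module.Basis (Fin k') X.functionField E :=
    (Module.Basis.span hli).map (LinearEquiv.ofEq _ _ (hspan hη).symm)
  -- The rank of the lattice is the dimension of the subspace that it spans.
  have hk : k' = k := by simpa using Fintype.card_congr (b₂.indexEquiv b)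
  subst hk
  exact ⟨U, hU, l, t, ht, hmem, hspan⟩

end Saturation

/-! ### Orders of determinants -/

section Orders

lemma IsFrame.isUnit_det {M : X.Modules} {ι : Type} [Fintype ι] [DecidableEq ι] {U : X.Opens}
    {e f : ι → Γ(M, U)} (he : IsFrame M U e) (hf : IsFrame M U f) {A : Matrix ι ι Γ(X, U)}
    (hA : ∀ j, f j = ∑ i, A i j • e i) : IsUnit A.det := by
  obtain ⟨A', B, hAB, hBA, hA', -⟩ := he.exists_matrix hf
  have : A = A' := by
    ext i j
    refine congrFun (he.coord_unique (c := fun i => A i j) (c' := fun i => A' i j) le_rfl ?_) i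
    simp only [res_self]
    rw [← hA, ← hA']
  rw [this]
  exact (Matrix.isUnit_iff_isUnit_det _).1 ⟨⟨A', B, hAB, hBA⟩, rfl⟩

variable [IsIntegral X]

/-- The comparison of `Scheme.ord` with the order function of the local ring is made at points of
codimension one; the dimension of a discrete valuation ring supplies this. -/
lemma coheight_eq_one (x : X) [IsDiscreteValuationRing (X.presheaf.stalk x)] :
    Order.coheight x = 1 := by
  have h := ringKrullDim_stalk_eq_coheight x
  rw [IsPrincipalIdealRing.ringKrullDim_eq_one _
    (IsDiscreteValuationRing.not_isField (X.presheaf.stalk x))] at h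
  exact_mod_cast h.symm

variable [IsLocallyNoetherian X]

lemma ord_nonneg {x : X} {U : X.Opens} (hx : x ∈ U) (hη : genericPoint X ∈ U) {a : Γ(X, U)}
    (ha : a ≠ 0) : 0 ≤ Scheme.ord (germFun hη a : X.functionField) x := by
  have : Nonempty U := ⟨⟨x, hx⟩⟩
  have h := Scheme.ord_le_smul hx ha (1 : X.functionField)
  have h1 : Scheme.ord (1 : X.functionField) x = 0 := by
    have := Scheme.ord_of_isUnit (X := X) (U := U) (f := 1) isUnit_one hx
    rwa [map_one] at this
  rw [h1, Algebra.smul_def, mul_one] at h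
  exact h

lemma ord_eq_one {x : X} [IsDiscreteValuationRing (X.presheaf.stalk x)] {U : X.Opens}
    (hx : x ∈ U) (hη : genericPoint X ∈ U) {a : Γ(X, U)} (ha : Irreducible (germFun hx a)) :
    Scheme.ord (germFun hη a : X.functionField) x = 1 := by
  have hc := coheight_eq_one x
  have : Ring.KrullDimLE 1 (X.presheaf.stalk x) := krullDimLE_of_coheight_le hc.le
  rw [← algebraMap_germFun hx]
  have hne : algebraMap (X.presheaf.stalk x) X.functionField (germFun hx a) ≠ 0 := by
    simpa using ha.ne_zero
  rw [Scheme.ord_eq_iff hc hne]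
  refine (Ring.ordFrac_eq_ord (R := X.presheaf.stalk x) (K := X.functionField) ha.ne_zero).trans ?_
  exact Ring.ordMonoidWithZeroHom_eq_coe _ (mem_nonZeroDivisors_of_ne_zero ha.ne_zero) (n := 1)
    (by rw [Ring.ord_of_irreducible ha]; rfl)

/-- Shrinking the domain restricts the transition matrix but leaves its determinant unchanged as a
rational function. -/
lemma HasDetOrder.restrict {F : X.Modules} {k : ℕ} {U₀ V : X.Opens} {s : Fin k → Γ(F, U₀)}
    {x : X} {n : ℤ} (h : HasDetOrder F s x n) (hV : V ≤ U₀) (hη : genericPoint X ∈ V) :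
    HasDetOrder F (fun j => res F hV (s j)) x n := by
  obtain ⟨U, hx, e, a, hη', he, hs, hord⟩ := h
  have hle : V ⊓ U ≤ U₀ ⊓ U := inf_le_inf_right U hV
  refine ⟨U, hx, e, a.map (resFunHom hle), ⟨hη, hη'.2⟩, he, fun j => ?_, ?_⟩
  · have := congrArg (res F hle) (hs j)
    simpa [res_smul] using this
  · rw [← hord]
    congr 1
    have : (a.map (resFunHom hle)).det = resFun hle a.det := (RingHom.map_det _ _).symm
    rw [this]
    exact germFun_res hle _ _

/-- The degree of a vector bundle can be computed with a frame over a small open set. -/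
lemma HasDegree.exists_frame {F : X.Modules} {k : ℕ} {d : ℤ} (h : HasDegree F k d) {W : X.Opens}
    (hW : genericPoint X ∈ W) :
    ∃ (U₀ : X.Opens) (s : Fin k → Γ(F, U₀)) (D : X →₀ ℤ), genericPoint X ∈ U₀ ∧ U₀ ≤ W ∧
      IsFrame F U₀ s ∧ (∀ x, HasDetOrder F s x (D x)) ∧ D.sum (fun _ n => n) = d := by
  obtain ⟨U₀, s, D, ⟨y, hy⟩, hs, hD, hd⟩ := h
  have hη : genericPoint X ∈ U₀ ⊓ W := ⟨genericPoint_mem hy, hW⟩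
  exact ⟨U₀ ⊓ W, fun j => res F inf_le_left (s j), D, hη, inf_le_right, hs.restrict _,
    fun x => (hD x).restrict _ hη, hd⟩

end Orders

/-! ### Transfer of subbundles along modifications at a point -/

section Transfer

lemma notMem_of_le {x : X} {U V : X.Opens} (hU : x ∉ U) (h : V ≤ U) : x ∉ V := fun hx => hU (h hx)

variable [IsIntegral X]

/-- A morphism of sheaves of modules which is an isomorphism away from the point `x`. -/
def IsIsoAway (x : X) {M N : X.Modules} (φ : M ⟶ N) : Prop :=
  ∀ U : X.Opens, x ∉ U → Function.Bijective (φ.app U)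

variable {x : X} {A B N G : X.Modules} {α : N ⟶ A} {β : N ⟶ B} {i : G ⟶ A} {k : ℕ}

/-- The subspace of the generic stalk of `B` spanned by the images of sections of `N`. -/
def genericSpan (β : N ⟶ B) {U₀ : X.Opens} (hη : genericPoint X ∈ U₀) (n : Fin k → Γ(N, U₀)) :
    Submodule X.functionField (Stalk B (genericPoint X)) :=
  Submodule.span X.functionField (Set.range fun j => germ B hη (β.app U₀ (n j)))

section

variable (hα : IsIsoAway x α) (hβ : IsIsoAway x β) (hi : IsSubbundle i k) {U₀ : X.Opens}
  (hx₀ : x ∉ U₀) (hη : genericPoint X ∈ U₀) {s : Fin k → Γ(G, U₀)} (hs : IsFrame G U₀ s)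
  {n : Fin k → Γ(N, U₀)} (hn : ∀ j, α.app U₀ (n j) = i.app U₀ (s j))

include hα hβ hi hx₀ hs hn

/-- Both sides are conditions at the generic point. As `α` and `β` are injective there, each says
that the germ of `m` lies in the span of the germs of the `n j`. -/
lemma mem_saturation_iff_mem_range {U : X.Opens} (m : Γ(N, U)) :
    β.app U m ∈ (saturation B (genericSpan β hη n)).carrier U ↔
      α.app U m ∈ Set.range (i.app U) := by
  rw [hi.mem_range_iff hη hs, mem_saturation]
  refine forall_congr' fun hU => ?_
  simp only [← hn]
  rw [germ_mem_span_iff α hη (fun V hV => (hα V (notMem_of_le hx₀ hV)).1)]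
  exact germ_mem_span_iff β hη (fun V hV => (hβ V (notMem_of_le hx₀ hV)).1) _ _ _ _

/-- Away from the point of modification, frames of a subbundle are frames of its transform. -/
lemma isFrame_transfer {U : X.Opens} (hx : x ∉ U) {g : Fin k → Γ(G, U)} (hg : IsFrame G U g)
    {m : Fin k → Γ(N, U)} (hm : ∀ j, α.app U (m j) = i.app U (g j)) :
    IsFrame (saturation B (genericSpan β hη n)).toModules U (fun j =>
      (saturation B (genericSpan β hη n)).sec (β.app U (m j))
        ((mem_saturation_iff_mem_range hα hβ hi hx₀ hη hs hn (m j)).2 ⟨g j, (hm j).symm⟩)) := by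
  rw [isFrame_iff]
  intro V hV
  have hxV := notMem_of_le hx hV
  let S := saturation B (genericSpan β hη n)
  have hmem := fun j => (mem_saturation_iff_mem_range hα hβ hi hx₀ hη hs hn (m j)).2
    ⟨g j, (hm j).symm⟩
  have key : ∀ c : Fin k → Γ(X, V), S.ι.app V (∑ j, c j • res _ hV (S.sec _ (hmem j))) =
      β.app V (∑ j, c j • res N hV (m j)) := by
    intro c
    simp [app_res]
  have key' : ∀ c : Fin k → Γ(X, V), i.app V (∑ j, c j • res G hV (g j)) =
      α.app V (∑ j, c j • res N hV (m j)) := by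
    intro c
    simp [app_res, hm]
  refine ⟨fun c hc => hg.coord_eq_zero hV (hi.injective V ?_), fun t => ?_⟩
  · have h0 : β.app V (∑ j, c j • res N hV (m j)) = 0 := by
      rw [← key]
      exact (congrArg (S.ι.app V) hc).trans (map_zero _)
    rw [key', (hβ V hxV).1 (h0.trans (map_zero _).symm), map_zero, map_zero]
  · obtain ⟨m', hm'⟩ := (hβ V hxV).2 (S.ι.app V t)
    have hr : β.app V m' ∈ S.carrier V := hm' ▸ S.ι_mem t
    obtain ⟨g', hg'⟩ := (mem_saturation_iff_mem_range hα hβ hi hx₀ hη hs hn m').1 hr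
    obtain ⟨c, rfl⟩ := hg.exists_coord hV g'
    rw [key'] at hg'
    refine ⟨c, S.ι_injective V ((key c).trans ?_)⟩
    rw [(hα V hxV).1 hg', hm']

end

end Transfer

/-! ### The degree of a transferred subbundle -/

section TransferTheorem

lemma resFun_det {U V : X.Opens} (h : V ≤ U) {ι : Type*} [Fintype ι]
    [DecidableEq ι] (a : Matrix ι ι Γ(X, U)) :
    resFun h a.det = (a.map (resFunHom h)).det :=
  RingHom.map_det (resFunHom h) a

variable [IsIntegral X]

variable [IsLocallyNoetherian X]

lemma ord_pow {x : X} {f : X.functionField} (hf : f ≠ 0) (m : ℕ) :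
    Scheme.ord (f ^ m) x = m * Scheme.ord f x := by
  induction m with
  | zero =>
    -- The order of `1` is zero because `1 * 1 = 1` makes it equal to its double.
    have := Scheme.ord_mul (x := x) (one_ne_zero (α := X.functionField)) one_ne_zero
    rw [mul_one] at this
    rw [pow_zero]
    push_cast
    linarith
  | succ m ih =>
    rw [pow_succ, Scheme.ord_mul (pow_ne_zero _ hf) hf, ih]
    push_cast
    ring

lemma exists_hasDetOrder {F : X.Modules} {k : ℕ} {U₀ U : X.Opens} {s : Fin k → Γ(F, U₀)}
    (hη : genericPoint X ∈ U₀) {x : X} (hx : x ∈ U) {e : Fin k → Γ(F, U)} (he : IsFrame F U e) :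
    ∃ a : Matrix (Fin k) (Fin k) Γ(X, U₀ ⊓ U),
      (∀ j, res F inf_le_left (s j) = ∑ i, a i j • res F inf_le_right (e i)) ∧
      HasDetOrder F s x
        (Scheme.ord (germFun (⟨hη, genericPoint_mem hx⟩ : genericPoint X ∈ U₀ ⊓ U) a.det :
          X.functionField) x) := by
  choose a ha using fun j => he.exists_coord (inf_le_right : U₀ ⊓ U ≤ U)
    (res F inf_le_left (s j))
  exact ⟨Matrix.of fun i j => a j i, fun j => (ha j).symm, U, hx, e, Matrix.of fun i j => a j i,
    ⟨hη, genericPoint_mem hx⟩, he, fun j => (ha j).symm, rfl⟩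

variable {x : X} {A B N G : X.Modules} {α : N ⟶ A} {β : N ⟶ B} {i : G ⟶ A} {k : ℕ}

/-- Let `A` and `B` be isomorphic away from `x`. A subbundle `G` of `A` gives rise to a subbundle
of `B`, namely the saturation of its generic fibre, whose degree is bounded below in terms of the
relative position of `G` and `B` at `x`. -/
theorem exists_subbundle_transfer [IsDiscreteValuationRing (X.presheaf.stalk x)]
    (hx : IsClosed ({x} : Set X)) (hα : IsIsoAway x α) (hβ : IsIsoAway x β) {r : ℕ}
    (hB : IsVectorBundle B r) (hi : IsSubbundle i k) {d : ℤ} (hd : HasDegree G k d) (p q : ℕ)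
    {U₁ : X.Opens} (hx₁ : x ∈ U₁) {ϖ : Γ(X, U₁)} (hϖ : Irreducible (germFun hx₁ ϖ))
    (hpq : ∀ (U : X.Opens) (hU : U ≤ U₁) (_ : x ∈ U) (g : Γ(G, U)), ∃ (n : Γ(N, U)) (b : Γ(B, U)),
      α.app U n = resFun hU ϖ ^ p • i.app U g ∧ β.app U n = resFun hU ϖ ^ q • b) :
    ∃ (F : X.Modules) (j : F ⟶ B) (d' : ℤ), IsSubbundle j k ∧ HasDegree F k d' ∧
      d + k * ((q : ℤ) - p) ≤ d' ∧ ∀ (U : X.Opens) (_ : x ∉ U) (f : Γ(F, U)),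
        ∃ n : Γ(N, U), β.app U n = j.app U f ∧ α.app U n ∈ Set.range (i.app U) := by
  have hηx : genericPoint X ≠ x := by
    rintro rfl
    exact IsDiscreteValuationRing.not_isField (X.presheaf.stalk (genericPoint X))
      (Field.toIsField X.functionField)
  let W : X.Opens := ⟨{x}ᶜ, hx.isOpen_compl⟩
  have hηW : genericPoint X ∈ W := hηx
  -- The rational section of the determinant is given by a frame whose domain avoids `x`, so that it
  -- can be carried through `N` into `B`.
  obtain ⟨U₀, s, D, hη, hU₀, hs, hD, hDd⟩ := hd.exists_frame hηW
  have hx₀ : x ∉ U₀ := fun h => hU₀ h rfl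
  choose n hn using fun j => (hα U₀ hx₀).2 (i.app U₀ (s j))
  let E := genericSpan β hη n
  let S := saturation B E
  have hmem : ∀ {U : X.Opens} (m : Γ(N, U)), β.app U m ∈ S.carrier U ↔
      α.app U m ∈ Set.range (i.app U) := fun m =>
    mem_saturation_iff_mem_range hα hβ hi hx₀ hη hs hn m
  have hframe := fun {U : X.Opens} (hxU : x ∉ U) {g : Fin k → Γ(G, U)} (hg : IsFrame G U g)
    {m : Fin k → Γ(N, U)} (hm : ∀ j, α.app U (m j) = i.app U (g j)) =>
    isFrame_transfer hα hβ hi hx₀ hη hs hn hxU hg hm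
  have hmem' : ∀ {U : X.Opens} {g : Fin k → Γ(G, U)} {m : Fin k → Γ(N, U)}
      (_ : ∀ j, α.app U (m j) = i.app U (g j)) (j : Fin k), β.app U (m j) ∈ S.carrier U :=
    fun {U g m} hm j => (hmem (m j)).2 ⟨g j, (hm j).symm⟩
  let σ : Fin k → Γ(S.toModules, U₀) := fun j => S.sec (β.app U₀ (n j)) (hmem' hn j)
  have hσ : IsFrame S.toModules U₀ σ := hframe hx₀ hs hn
  -- a basis of the generic fibre
  have hli : LinearIndependent X.functionField (fun j => germ B hη (β.app U₀ (n j))) := by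
    have h1 := (hσ.stalkBasis hη).linearIndependent.map' (stalkLinear S.ι (genericPoint X))
      (LinearMap.ker_eq_bot.2 (stalkLinear_injective S.ι hη fun V _ => S.ι_injective V))
    have h2 : (fun j => germ B hη (β.app U₀ (n j))) =
        stalkLinear S.ι (genericPoint X) ∘ hσ.stalkBasis hη := by
      ext j
      simp [σ]
    rw [h2]
    exact h1
  obtain ⟨Ux, hxU, e₀, he₀⟩ := hB x
  obtain ⟨V₁, hxV₁, l₁, t, ht, htS, htE⟩ := exists_frame_saturation (E := E) hxU he₀
    (Module.Basis.span hli)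
  have hsub : IsSubbundle S.ι k := by
    intro y
    by_cases hyx : y = x
    · subst hyx
      exact ⟨V₁, hxV₁, l₁, _, t, isFrame_saturation ht htE htS, ht, fun j => rfl⟩
    · obtain ⟨U, hyU, l, f, e, hf, he, hfe⟩ := hi y
      have hy : y ∈ U ⊓ W := ⟨hyU, hyx⟩
      have hxUW : x ∉ U ⊓ W := fun h => h.2 rfl
      have hle : U ⊓ W ≤ U := inf_le_left
      choose m hm using fun j => (hα _ hxUW).2 (res A hle (e j))
      have hN : IsFrame N (U ⊓ W) m := by
        refine IsFrame.of_map α (fun V hV => hα V (notMem_of_le hxUW hV)) ?_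
        simp only [hm]
        exact he.restrict hle
      have hBf := hN.map β (fun V hV => hβ V (notMem_of_le hxUW hV))
      have hm' : ∀ j, α.app (U ⊓ W) (m (Sum.inl j)) = i.app (U ⊓ W) (res G hle (f j)) := by
        intro j
        rw [hm, app_res, hfe]
      exact ⟨U ⊓ W, hy, l, _, _, hframe hxUW (hf.restrict hle) hm', hBf, fun j => rfl⟩
  -- orders away from `x`
  have hord : ∀ y, y ≠ x → HasDetOrder S.toModules σ y (D y) := by
    intro y hyx
    obtain ⟨U, hyU, e, a, hη', he, hsa, hord⟩ := hD y
    have hy : y ∈ U ⊓ W := ⟨hyU, hyx⟩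
    have hxUW : x ∉ U ⊓ W := fun h => h.2 rfl
    have hle : U ⊓ W ≤ U := inf_le_left
    choose m hm using fun j => (hα _ hxUW).2 (i.app _ (res G hle (e j)))
    have hle' : U₀ ⊓ (U ⊓ W) ≤ U₀ ⊓ U := inf_le_inf_left U₀ hle
    refine ⟨U ⊓ W, hy, _, a.map (resFunHom hle'), ⟨hη, genericPoint_mem hy⟩,
      hframe hxUW (he.restrict hle) hm, fun j => ?_, ?_⟩
    · refine S.ι_injective _ ?_
      have e1 : res N inf_le_left (n j) =
          ∑ i, (a.map (resFunHom hle')) i j • res N inf_le_right (m i) := by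
        refine (hα (U₀ ⊓ (U ⊓ W)) (fun h => hx₀ h.1)).1 ?_
        rw [app_res, hn, ← app_res]
        have := congrArg (i.app _) (congrArg (res G hle') (hsa j))
        simp only [res_res, res_sum, res_smul, map_sum, Scheme.Modules.Hom.app_smul] at this
        simp [this, app_res, hm]
      have e2 := congrArg (β.app _) e1
      simp only [map_sum, Scheme.Modules.Hom.app_smul, app_res] at e2 ⊢
      exact e2
    · rw [← hord, ← resFun_det]
      congr 1
      exact germFun_res hle' _ _
  -- the order at `x`
  obtain ⟨a, ha, hax⟩ := exists_hasDetOrder (s := σ) hη hxV₁ (isFrame_saturation ht htE htS)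
  set ox := Scheme.ord (germFun (⟨hη, genericPoint_mem hxV₁⟩ : genericPoint X ∈ U₀ ⊓ V₁) a.det :
          X.functionField) x with hox
  -- Let `a`, `b`, `c` be the matrices expressing `σ` in `t`, `s` in `g` and `w` in `t`. Then `ϖ ^ p
  -- a = ϖ ^ q c b`. Taking orders of determinants gives `p k + ord a = q k + ord c + ord b`, with
  -- `ord c ≥ 0` since `c` is regular at `x`.
  have hxD : D x + k * ((q : ℤ) - p) ≤ ox := by
    obtain ⟨Ug, hxUg, g, b, hη', hg, hsb, hDx⟩ := hD x
    let V : X.Opens := V₁ ⊓ Ug ⊓ U₁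
    have hxV : x ∈ V := ⟨⟨hxV₁, hxUg⟩, hx₁⟩
    have hV1 : V ≤ V₁ := inf_le_left.trans inf_le_left
    have hVg : V ≤ Ug := inf_le_left.trans inf_le_right
    have hVU1 : V ≤ U₁ := inf_le_right
    choose m w hm hw using fun j => hpq V hVU1 hxV (res G hVg (g j))
    have hxV₀ : x ∉ U₀ ⊓ V := fun h => hx₀ h.1
    have hηV : genericPoint X ∈ V := genericPoint_mem hxV
    have hηV₀ : genericPoint X ∈ U₀ ⊓ V := ⟨hη, hηV⟩
    have h0V : U₀ ⊓ V ≤ V := inf_le_right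
    let ϖ₀ : Γ(X, U₀ ⊓ V) := resFun (h0V.trans hVU1) ϖ
    let P : X.functionField := germFun hηV₀ ϖ₀
    have hP : P = germFun (genericPoint_mem hx₁) ϖ := germFun_res _ _ _
    have hP0 : P ≠ 0 := by
      rw [hP, ← algebraMap_germFun hx₁]
      simpa using hϖ.ne_zero
    have hordP : Scheme.ord P x = 1 := by
      rw [hP]
      exact ord_eq_one hx₁ _ hϖ
    have hresm : ∀ j, α.app _ (res N h0V (m j)) = ϖ₀ ^ p • i.app _ (res G (h0V.trans hVg) (g j)) := by
      intro j
      rw [app_res, hm, res_smul, ← resFunHom_apply, map_pow, resFunHom_apply, resFun_resFun,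
        ← app_res, res_res]
    have hresw : ∀ j, β.app _ (res N h0V (m j)) = ϖ₀ ^ q • res B h0V (w j) := by
      intro j
      rw [app_res, hw, res_smul, ← resFunHom_apply, map_pow, resFunHom_apply, resFun_resFun]
    -- The section `ϖ ^ q • w j` lies generically in `E`, and `ϖ` is invertible in the function
    -- field.
    have hwS : ∀ j, w j ∈ S.carrier V := by
      intro j hη₁
      have h1 : β.app _ (res N h0V (m j)) ∈ S.carrier (U₀ ⊓ V) := by
        rw [hmem, hresm]
        exact ⟨ϖ₀ ^ p • res G (h0V.trans hVg) (g j), by rw [Scheme.Modules.Hom.app_smul]⟩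
      have h2 := h1 hηV₀
      rw [hresw, germ_smul, germ_res, ← germFunHom_apply, map_pow] at h2
      have h3 := E.smul_mem (P ^ q)⁻¹ h2
      rwa [smul_smul, germFunHom_apply, inv_mul_cancel₀ (pow_ne_zero q hP0), one_smul] at h3
    choose c hc using fun j => (isFrame_saturation ht htE htS).exists_coord hV1
      (S.sec (w j) (hwS j))
    let c₀ : Matrix (Fin k) (Fin k) Γ(X, V) := Matrix.of fun i j => c j i
    have hc₀ : ∀ j, ∑ i, c₀ i j • res S.toModules hV1 (S.sec _ (htS i)) = S.sec (w j) (hwS j) := hc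
    have hle_a : U₀ ⊓ V ≤ U₀ ⊓ V₁ := inf_le_inf_left U₀ hV1
    have hle_b : U₀ ⊓ V ≤ U₀ ⊓ Ug := inf_le_inf_left U₀ hVg
    let a' := a.map (resFunHom hle_a)
    let b' := b.map (resFunHom hle_b)
    let c' := c₀.map (resFunHom h0V)
    have ha' : ∀ j, res S.toModules (inf_le_left : U₀ ⊓ V ≤ U₀) (σ j) =
        ∑ i, a' i j • res S.toModules (hle_a.trans inf_le_right) (S.sec _ (htS i)) := by
      intro j
      have := congrArg (res S.toModules hle_a) (ha j)
      simpa [res_smul, a'] using this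
    have hb' : ∀ j, res G (inf_le_left : U₀ ⊓ V ≤ U₀) (s j) =
        ∑ i, b' i j • res G (h0V.trans hVg) (g i) := by
      intro j
      have := congrArg (res G hle_b) (hsb j)
      simpa [res_smul, b'] using this
    have hc' : ∀ j, ∑ i, c' i j • res S.toModules (hle_a.trans inf_le_right) (S.sec _ (htS i)) =
        res S.toModules h0V (S.sec (w j) (hwS j)) := by
      intro j
      have := congrArg (res S.toModules h0V) (hc₀ j)
      simpa [res_smul, c'] using this
    have eN : ∀ j, ϖ₀ ^ p • res N (inf_le_left : U₀ ⊓ V ≤ U₀) (n j) =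
        ∑ l, b' l j • res N h0V (m l) := by
      intro j
      refine (hα _ hxV₀).1 ?_
      rw [Scheme.Modules.Hom.app_smul, app_res, hn, ← app_res, hb', map_sum, map_sum,
        Finset.smul_sum]
      refine Finset.sum_congr rfl fun l _ => ?_
      rw [Scheme.Modules.Hom.app_smul, Scheme.Modules.Hom.app_smul, hresm, smul_comm]
    have eS : ∀ j, ϖ₀ ^ p • res S.toModules (inf_le_left : U₀ ⊓ V ≤ U₀) (σ j) =
        ∑ l, b' l j • ϖ₀ ^ q • res S.toModules h0V (S.sec (w l) (hwS l)) := by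
      intro j
      refine S.ι_injective _ ?_
      have := congrArg (β.app _) (eN j)
      simp only [map_sum, Scheme.Modules.Hom.app_smul, hresw] at this
      simp only [map_sum, Scheme.Modules.Hom.app_smul, app_res, LocalSubmodule.ι_sec, σ]
      rw [app_res] at this
      exact this
    have emat : ϖ₀ ^ p • a' = ϖ₀ ^ q • (c' * b') := by
      ext l j
      refine congrFun ((isFrame_saturation ht htE htS).coord_unique
        (c := fun l => (ϖ₀ ^ p • a') l j) (c' := fun l => (ϖ₀ ^ q • (c' * b')) l j)
        (hle_a.trans inf_le_right) ?_) l
      have h1 := eS j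
      rw [ha'] at h1
      simp only [← hc'] at h1
      rw [Finset.smul_sum] at h1
      simp only [Matrix.smul_apply, smul_eq_mul, ← smul_smul]
      rw [h1]
      simp only [smul_comm (_ : Γ(X, U₀ ⊓ V)) (ϖ₀ ^ q)]
      rw [← Finset.smul_sum, ← Finset.smul_sum]
      exact congrArg (ϖ₀ ^ q • ·) (sum_smul_sum_smul (fun l => b' l j) c' _)
    have edet := congrArg Matrix.det emat
    rw [Matrix.det_smul, Matrix.det_smul, Matrix.det_mul, Fintype.card_fin] at edet
    have efield := congrArg (germFunHom hηV₀) edet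
    simp only [map_mul, map_pow] at efield
    have eA : germFunHom hηV₀ a'.det = germFun (⟨hη, genericPoint_mem hxV₁⟩ : genericPoint X ∈ U₀ ⊓ V₁) a.det := by
      rw [← resFun_det, germFunHom_apply, germFun_res]
    have eB : germFunHom hηV₀ b'.det = germFun hη' b.det := by
      rw [← resFun_det, germFunHom_apply, germFun_res]
    have eC : germFunHom hηV₀ c'.det = germFun hηV c₀.det := by
      rw [← resFun_det, germFunHom_apply, germFun_res]
    rw [eA, eB, eC, germFunHom_apply] at efield
    change (P ^ p) ^ k * _ = (P ^ q) ^ k * _ at efield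
    have da0 : (germFun (⟨hη, genericPoint_mem hxV₁⟩ : genericPoint X ∈ U₀ ⊓ V₁) a.det :
        X.functionField) ≠ 0 := by
      have hu := ((isFrame_saturation ht htE htS).restrict
        (inf_le_right : U₀ ⊓ V₁ ≤ V₁)).isUnit_det (hσ.restrict inf_le_left) ha
      exact (hu.map (germFunHom _)).ne_zero
    have db0 : (germFun hη' b.det : X.functionField) ≠ 0 := by
      have hu := (hg.restrict (inf_le_right : U₀ ⊓ Ug ≤ Ug)).isUnit_det
        (hs.restrict inf_le_left) hsb
      exact (hu.map (germFunHom _)).ne_zero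
    -- A zero determinant here would force the nonzero left side of `efield` to vanish.
    have dc0 : (germFun hηV c₀.det : X.functionField) ≠ 0 := by
      intro h0
      rw [h0, zero_mul, mul_zero] at efield
      exact mul_ne_zero (pow_ne_zero _ (pow_ne_zero _ hP0)) da0 efield
    have hc0 : c₀.det ≠ 0 := by
      rintro h0
      exact dc0 (by rw [h0]; exact germFun_zero hηV)
    have hcn := ord_nonneg hxV hηV hc0
    have := congrArg (fun f : X.functionField => Scheme.ord f x) efield
    rw [Scheme.ord_mul (pow_ne_zero _ (pow_ne_zero _ hP0)) da0,
      Scheme.ord_mul (pow_ne_zero _ (pow_ne_zero _ hP0)) (mul_ne_zero dc0 db0),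
      Scheme.ord_mul dc0 db0, ord_pow (pow_ne_zero _ hP0), ord_pow (pow_ne_zero _ hP0),
      ord_pow hP0, ord_pow hP0, hordP, hDx] at this
    linarith
  -- The new divisor is `D` with its coefficient at `x` replaced by `ox`.
  refine ⟨S.toModules, S.ι, d + (ox - D x), hsub,
    ⟨U₀, σ, D + Finsupp.single x (ox - D x), ⟨_, hη⟩, hσ, fun y => ?_, ?_⟩, by linarith, ?_⟩
  · by_cases hyx : y = x
    · subst hyx
      simpa using hax
    · rw [Finsupp.add_apply, Finsupp.single_eq_of_ne hyx, add_zero]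
      exact hord y hyx
  · rw [Finsupp.sum_add_index' (fun _ => rfl) (fun _ _ _ => rfl), hDd, Finsupp.sum_single_index rfl]
  · intro U hxU f
    obtain ⟨m, hm⟩ := (hβ U hxU).2 (S.ι.app U f)
    exact ⟨m, hm, (hmem m).1 (hm ▸ S.ι_mem f)⟩

end TransferTheorem

/-! ### Local rings of smooth curves -/

section LocalRings

open scoped TensorProduct in
/-- The localization of a standard smooth algebra of relative dimension `1` at a rational point is
a discrete valuation ring. -/
theorem isDiscreteValuationRing_of_isStandardSmooth {k A B : Type*} [CommRing k] [CommRing A]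
    [CommRing B] [Algebra k A] [Algebra A B] [Algebra k B] [IsScalarTower k A B]
    [Algebra.IsStandardSmoothOfRelativeDimension 1 k A] (S : Submonoid A) [IsLocalization S B]
    [IsLocalRing B] [IsDomain B] [IsNoetherianRing B]
    (hb : Function.Bijective (algebraMap k (IsLocalRing.ResidueField B))) :
    IsDiscreteValuationRing B := by
  have : Nontrivial A := (algebraMap A B).domain_nontrivial
  have : Algebra.IsStandardSmooth k A :=
    Algebra.IsStandardSmoothOfRelativeDimension.isStandardSmooth 1
  have : Algebra.FormallyEtale A B := .of_isLocalization S
  have : Algebra.FormallySmooth k B := .comp k A B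
  let κ := IsLocalRing.ResidueField B
  have hsurj : Function.Surjective (algebraMap B κ) := IsLocalRing.residue_surjective
  have : Algebra.FormallySmooth k κ :=
    .of_equiv (AlgEquiv.ofBijective (Algebra.ofId k κ) hb)
  -- In the conormal sequence of `k → B → κ`, formal smoothness of `κ ≅ k` gives injectivity on the
  -- left, and the vanishing of `Ω[κ⁄k]` gives surjectivity. Hence the cotangent space is `κ ⊗
  -- Ω[B⁄k]`.
  have hinj : Function.Injective (KaehlerDifferential.kerCotangentToTensor k B κ) :=
    (Algebra.FormallySmooth.kerCotangentToTensor_injective_iff hsurj).mpr inferInstance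
  have : Subsingleton Ω[κ⁄k] := KaehlerDifferential.subsingleton_of_surjective k κ hb.2
  have hs : Function.Surjective (KaehlerDifferential.kerCotangentToTensor k B κ) := fun y =>
    (KaehlerDifferential.exact_kerCotangentToTensor_mapBaseChange k B κ hsurj y).mp
      (Subsingleton.elim _ _)
  have hker : IsLocalRing.maximalIdeal B = RingHom.ker (algebraMap B κ) :=
    IsLocalRing.ker_residue.symm
  let e₁ : (IsLocalRing.maximalIdeal B).Cotangent ≃ₗ[B] κ ⊗[B] Ω[B⁄k] :=
    (Ideal.Cotangent.equivOfEq _ _ hker).trans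
      (LinearEquiv.ofBijective _ ⟨hinj, hs⟩)
  let e : IsLocalRing.CotangentSpace B ≃ₗ[κ] κ ⊗[B] Ω[B⁄k] :=
    e₁.extendScalarsOfSurjective hsurj
  have : Module.Free B Ω[B⁄k] :=
    .of_equiv (KaehlerDifferential.tensorKaehlerEquivOfFormallyEtale k A B)
  -- Differentials commute with localization, so `Ω[B⁄k]` is free of rank one and the cotangent
  -- space is a line.
  rw [← IsLocalRing.finrank_CotangentSpace_eq_one_iff, e.finrank_eq, Module.finrank_baseChange,
    ← (KaehlerDifferential.tensorKaehlerEquivOfFormallyEtale k A B).finrank_eq,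
    Module.finrank_baseChange, Module.finrank,
    Algebra.IsStandardSmoothOfRelativeDimension.rank_kaehlerDifferential 1]
  simp

variable {K : Type u} [Field K] [IsAlgClosed K]

/-- This is the Nullstellensatz: a closed point of a scheme locally of finite type over an
algebraically closed field is rational. It is stated on charts so as to fit a standard smooth
presentation. -/
theorem algebraMap_residueField_bijective (f : X ⟶ Spec (.of K))
    [LocallyOfFiniteType f] (x : X) (hx : IsClosed {x}) {U : (Spec (.of K)).Opens}
    {V : X.Opens} (e : V ≤ f ⁻¹ᵁ U) (hxV : x ∈ V) :
    Function.Bijective (f.appLE U V e ≫ X.presheaf.germ V x hxV ≫ X.residue x) := by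
  have hU : U = ⊤ := by
    rw [eq_top_iff]
    intro y _
    have : y = f x := Subsingleton.elim _ _
    rw [this]; exact e hxV
  subst hU
  have h := SpecMap_residueFieldIsoBase_inv f x hx
  have hi : IsIso (X.fromSpecResidueField x ≫ f) := by rw [← h]; infer_instance
  have key : f.appLE ⊤ V e ≫ X.presheaf.germ V x hxV ≫ X.residue x =
      (X.fromSpecResidueField x ≫ f).appTop ≫ (Scheme.ΓSpecIso _).hom := by
    rw [Scheme.fromSpecResidueField, Scheme.Hom.comp_appTop, Scheme.Hom.comp_appTop,
      Category.assoc, Category.assoc, Scheme.ΓSpecIso_naturality, Scheme.fromSpecStalk_appTop]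
    simp only [Scheme.Hom.appLE, Category.assoc, homOfLE_refl, op_id, CategoryTheory.Functor.map_id,
      Category.id_comp, Iso.inv_hom_id_assoc]
    rw [TopCat.Presheaf.germ_res_assoc]
    rfl
  have h₁ : IsIso ((X.fromSpecResidueField x ≫ f).appTop) :=
    inferInstanceAs (IsIso ((X.fromSpecResidueField x ≫ f).app ⊤))
  have h' : IsIso ((X.fromSpecResidueField x ≫ f).appTop ≫ (Scheme.ΓSpecIso _).hom) :=
    IsIso.comp_isIso
  rw [key, ← ConcreteCategory.isIso_iff_bijective]
  infer_instance

theorem SmoothProjectiveCurve.isDiscreteValuationRing_stalk (C : SmoothProjectiveCurve K)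
    {x : C.toScheme} (hx : IsClosed {x}) :
    IsDiscreteValuationRing (C.toScheme.presheaf.stalk x) := by
  obtain ⟨U, hU, V, hV, hxV, e, he⟩ :=
    SmoothOfRelativeDimension.exists_isStandardSmoothOfRelativeDimension (n := 1) (f := C.str) x
  have hb := algebraMap_residueField_bijective C.str x hx e hxV
  let := (C.str.appLE U V e).hom.toAlgebra
  let := C.toScheme.presheaf.algebra_section_stalk ⟨x, hxV⟩
  let : Algebra Γ(Spec (.of K), U) (C.toScheme.presheaf.stalk x) :=
    (C.str.appLE U V e ≫ C.toScheme.presheaf.germ V x hxV).hom.toAlgebra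
  have : IsScalarTower Γ(Spec (.of K), U) Γ(C.toScheme, V) (C.toScheme.presheaf.stalk x) :=
    .of_algebraMap_eq fun _ => rfl
  have := hV.isLocalization_stalk ⟨x, hxV⟩
  have : Algebra.IsStandardSmoothOfRelativeDimension 1 Γ(Spec (.of K), U) Γ(C.toScheme, V) := he
  exact isDiscreteValuationRing_of_isStandardSmooth (k := Γ(Spec (.of K), U))
    (A := Γ(C.toScheme, V)) (hV.primeIdealOf ⟨x, hxV⟩).asIdeal.primeCompl hb

/-- Properness gives quasi-compactness, and a nonempty quasi-compact scheme has a closed point. -/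
theorem SmoothProjectiveCurve.exists_isClosed {K : Type u} [Field K]
    (C : SmoothProjectiveCurve K) :
    ∃ x : C.toScheme, IsClosed {x} := by
  have : CompactSpace C.toScheme := QuasiCompact.compactSpace_of_compactSpace C.str
  obtain ⟨x, -, hx⟩ := IsClosed.exists_closed_singleton (S := (Set.univ : Set C.toScheme))
    isClosed_univ ⟨genericPoint C.toScheme, trivial⟩
  exact ⟨x, hx⟩

end LocalRings

/-! ### Transfer of isotropic subbundles -/

section IsotropicTransfer

variable [IsIntegral X] {x : X}

lemma genericPoint_ne [IsDiscreteValuationRing (X.presheaf.stalk x)] : genericPoint X ≠ x := by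
  rintro rfl
  exact IsDiscreteValuationRing.not_isField (X.presheaf.stalk (genericPoint X))
    (Field.toIsField X.functionField)

/-- Values of the form are functions on an integral scheme, so they vanish if they vanish off `x`.
-/
lemma OrthogonalBundle.isIsotropic_of_forall_notMem (E : OrthogonalBundle X)
    [IsDiscreteValuationRing (X.presheaf.stalk x)] (hx : IsClosed ({x} : Set X))
    {F : X.Modules} (j : F ⟶ E.sheaf)
    (h : ∀ (U : X.Opens) (_ : x ∉ U) (s t : Γ(F, U)), E.form U (j.app U s) (j.app U t) = 0) :
    E.IsIsotropic j := by
  intro U s t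
  refine fun_ext _ _ fun y hy => ⟨U, hy, le_rfl, ?_⟩
  let W : X.Opens := ⟨{x}ᶜ, hx.isOpen_compl⟩
  have hη : genericPoint X ∈ U ⊓ W := ⟨genericPoint_mem hy, genericPoint_ne⟩
  have h0 := h (U ⊓ W) (fun h => h.2 rfl) (res F inf_le_left s) (res F inf_le_left t)
  rw [app_res, app_res, E.form_res] at h0
  have := resFun_injective hη inf_le_left (h0.trans (resFun_zero _).symm)
  rw [this]

variable [IsLocallyNoetherian X]

/-- Off `x`, sections of the new subbundle lift to `N` and have images in `G`; the forms of `A` and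
`B` agree on `N`, so the vanishing carries over. -/
theorem exists_isotropic_transfer [IsDiscreteValuationRing (X.presheaf.stalk x)]
    (hx : IsClosed ({x} : Set X)) {A B : OrthogonalBundle X} {N G : X.Modules}
    {α : N ⟶ A.sheaf} {β : N ⟶ B.sheaf} {i : G ⟶ A.sheaf} {k : ℕ}
    (hα : IsIsoAway x α) (hβ : IsIsoAway x β)
    (hform : ∀ (U : X.Opens) (s t : Γ(N, U)),
      A.form U (α.app U s) (α.app U t) = B.form U (β.app U s) (β.app U t))
    (hi : IsSubbundle i k) (hiso : A.IsIsotropic i) {d : ℤ} (hd : HasDegree G k d) (p q : ℕ)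
    {U₁ : X.Opens} (hx₁ : x ∈ U₁) {ϖ : Γ(X, U₁)} (hϖ : Irreducible (germFun hx₁ ϖ))
    (hpq : ∀ (U : X.Opens) (hU : U ≤ U₁) (_ : x ∈ U) (g : Γ(G, U)),
      ∃ (n : Γ(N, U)) (b : Γ(B.sheaf, U)),
        α.app U n = resFun hU ϖ ^ p • i.app U g ∧ β.app U n = resFun hU ϖ ^ q • b) :
    ∃ (F : X.Modules) (j : F ⟶ B.sheaf) (d' : ℤ), IsSubbundle j k ∧ B.IsIsotropic j ∧
      HasDegree F k d' ∧ d + k * ((q : ℤ) - p) ≤ d' := by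
  obtain ⟨F, j, d', hj, hd', hle, haway⟩ :=
    exists_subbundle_transfer hx hα hβ B.isVectorBundle hi hd p q hx₁ hϖ hpq
  refine ⟨F, j, d', hj, B.isIsotropic_of_forall_notMem hx j fun U hU s t => ?_, hd', hle⟩
  obtain ⟨n, hn, g, hg⟩ := haway U hU s
  obtain ⟨n', hn', g', hg'⟩ := haway U hU t
  rw [← hn, ← hn', ← hform, ← hg, ← hg', hiso]

end IsotropicTransfer

/-! ### Stability of Hecke transforms from the slope bound -/

namespace OrthogonalBundle

variable {E H : OrthogonalBundle X} {x : X}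
  {L : Submodule (X.presheaf.stalk x) (FirstOrderFibre E.sheaf x)} {N : X.Modules}
  {incl : N ⟶ E.sheaf} {twist : N ⟶ H.sheaf}

lemma IsHeckeTransform.isIsoAway_incl (h : E.IsHeckeTransform x L H incl twist) :
    IsIsoAway x incl := fun U hU =>
  ⟨h.incl_injective U, fun s => (h.mem_range_incl U s).2 fun hx => (hU hx).elim⟩

lemma IsHeckeTransform.isIsoAway_twist (h : E.IsHeckeTransform x L H incl twist) :
    IsIsoAway x twist := fun U hU =>
  ⟨h.twist_injective U, fun s => (h.mem_range_twist U s).2 fun hx => (hU hx).elim⟩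

variable [IsIntegral X] [IsLocallyNoetherian X]

/-- If all isotropic subbundles of `E` have slope less than `-1`, then the orthogonal Hecke
transforms of `E` are stable. -/
theorem IsHeckeTransform.isStable [IsDiscreteValuationRing (X.presheaf.stalk x)]
    (hx : IsClosed ({x} : Set X)) (h : E.IsHeckeTransform x L H incl twist)
    (hE : ∀ (F : X.Modules) (i : F ⟶ E.sheaf) (k : ℕ) (d : ℤ), 0 < k → IsSubbundle i k →
      E.IsIsotropic i → HasDegree F k d → d < -k) : H.IsStable := by
  intro G i k d hk hi hiso hd
  obtain ⟨p, hp⟩ := IsDiscreteValuationRing.exists_irreducible (X.presheaf.stalk x)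
  obtain ⟨U₁, hx₁, ϖ, rfl⟩ := exists_germFun p
  -- Here `p = 1` and `q = 0`: one factor `ϖ` moves `G` into `H(-x) = E'`, which is contained in
  -- `E`, at a cost of at most `k` in degree.
  obtain ⟨F, j, d', hj, hjiso, hd', hle⟩ := exists_isotropic_transfer hx h.isIsoAway_twist
    h.isIsoAway_incl h.form_eq hi hiso hd 1 0 hx₁ hp fun U hU hxU g => by
      have : resFun hU ϖ ^ 1 • i.app U g ∈ Set.range (twist.app U) := by
        refine (h.mem_range_twist U _).2 fun hx' => ?_
        rw [pow_one, ← germFun_smul_germ, germFun_res]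
        refine Submodule.smul_mem_smul ?_ trivial
        exact (IsLocalRing.mem_maximalIdeal _).2 hp.not_isUnit
      obtain ⟨n, hn⟩ := this
      exact ⟨n, incl.app U n, hn, by rw [pow_zero, one_smul]⟩
  have := hE F j k d' hk hj hjiso hd'
  push_cast at hle
  linarith

end OrthogonalBundle

/-! ### Subsheaves defined by a condition at one point -/

section StalkSub

/-- The sections of `M` whose germ at `x` lies in a given submodule of the stalk. -/
def stalkSub (M : X.Modules) (x : X) (P : Submodule (X.presheaf.stalk x) (Stalk M x)) :
    LocalSubmodule M where
  carrier U :=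
    { carrier := {s | ∀ hx : x ∈ U, germ M hx s ∈ P}
      zero_mem' := fun hx => by rw [germ_zero]; exact P.zero_mem
      add_mem' := fun hs ht hx => by rw [germ_add]; exact P.add_mem (hs hx) (ht hx)
      smul_mem' := fun a s hs hx => by rw [germ_smul]; exact P.smul_mem _ (hs hx) }
  res_mem h s hs hx := by
    rw [germ_res M h hx]
    exact hs (h hx)
  mem_of_local s h hx := by
    obtain ⟨V, hV, hVU, hs⟩ := h _ hx
    have := hs hV
    rwa [germ_res] at this

variable {M : X.Modules} {x : X} {P : Submodule (X.presheaf.stalk x) (Stalk M x)}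

lemma mem_stalkSub {U : X.Opens} {s : Γ(M, U)} :
    s ∈ (stalkSub M x P).carrier U ↔ ∀ hx : x ∈ U, germ M hx s ∈ P := Iff.rfl

lemma stalkSub_ι_bijective {U : X.Opens} (hU : x ∉ U) :
    Function.Bijective ((stalkSub M x P).ι.app U) :=
  ⟨(stalkSub M x P).ι_injective U, fun s => ⟨(stalkSub M x P).sec s fun h => (hU h).elim, rfl⟩⟩

lemma range_stalkLinear_stalkSub :
    LinearMap.range (stalkLinear (stalkSub M x P).ι x) = P := by
  refine le_antisymm ?_ fun m hm => ?_
  · rintro _ ⟨m, rfl⟩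
    obtain ⟨U, hU, s, rfl⟩ := exists_germ _ m
    rw [stalkLinear_germ]
    exact (stalkSub M x P).ι_mem s hU
  · obtain ⟨U, hU, s, rfl⟩ := exists_germ M m
    exact ⟨germ _ hU ((stalkSub M x P).sec s fun _ => hm), by rw [stalkLinear_germ]; rfl⟩

/-- A relation between germs holds on a neighbourhood. -/
lemma exists_coord_of_germ_mem_span {ι : Type*} [Fintype ι] {U U₁ : X.Opens} (hx : x ∈ U)
    (hx₁ : x ∈ U₁) (t : ι → Γ(M, U₁)) (s : Γ(M, U))
    (hs : germ M hx s ∈ Submodule.span (X.presheaf.stalk x) (Set.range fun i => germ M hx₁ (t i))) :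
    ∃ (V : X.Opens) (_ : x ∈ V) (hVU : V ≤ U) (hV₁ : V ≤ U₁) (c : ι → Γ(X, V)),
      ∑ i, c i • res M hV₁ (t i) = res M hVU s := by
  obtain ⟨r, hr⟩ := (Submodule.mem_span_range_iff_exists_fun _).1 hs
  have hUU : x ∈ U ⊓ U₁ := ⟨hx, hx₁⟩
  obtain ⟨V, hV, hVU, c, hc⟩ := exists_common_germFun r hUU
  have key : germ M hV (∑ i, c i • res M (hVU.trans inf_le_right) (t i)) = germ M hx s := by
    rw [← hr, germ_sum]
    refine Finset.sum_congr rfl fun i _ => ?_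
    rw [germ_smul, germ_res, hc]
  obtain ⟨V', hV', h₁, h₂, e⟩ := exists_res_eq_of_germ_eq M _ _ _ _ key
  refine ⟨V', hV', h₂, h₁.trans (hVU.trans inf_le_right), fun i => resFun h₁ (c i), ?_⟩
  rw [← e, res_sum]
  simp [res_smul]

end StalkSub

/-! ### The complement of a closed point -/

section Punctured

variable {x : X}

/-- The complement of a closed point. -/
def punctured (hx : IsClosed ({x} : Set X)) : X.Opens := ⟨{x}ᶜ, hx.isOpen_compl⟩

variable (hx : IsClosed ({x} : Set X))

lemma notMem_inf_punctured (U : X.Opens) : x ∉ U ⊓ punctured hx := fun h => h.2 rfl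

lemma le_punctured {U : X.Opens} (h : x ∉ U) : U ≤ punctured hx := fun y hy hyx => by
  obtain rfl : y = x := hyx
  exact h hy

variable [IsIntegral X] [IsDiscreteValuationRing (X.presheaf.stalk x)]

lemma genericPoint_mem_inf_punctured {U : X.Opens} {y : X} (hy : y ∈ U) :
    genericPoint X ∈ U ⊓ punctured hx :=
  ⟨genericPoint_mem hy, genericPoint_ne⟩

lemma resFun_punctured_injective (U : X.Opens) :
    Function.Injective (resFun (inf_le_left : U ⊓ punctured hx ≤ U)) := by
  intro a b hab
  refine fun_ext _ _ fun y hy => ⟨U, hy, le_rfl, ?_⟩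
  rw [resFun_injective (genericPoint_mem_inf_punctured hx hy) _ hab]

lemma IsVectorBundle.res_punctured_injective {M : X.Modules} {r : ℕ} (hM : IsVectorBundle M r)
    (U : X.Opens) : Function.Injective (res M (inf_le_left : U ⊓ punctured hx ≤ U)) := by
  intro s t hst
  refine section_ext M _ _ fun y hy => ⟨U, hy, le_rfl, ?_⟩
  rw [hM.res_injective (genericPoint_mem_inf_punctured hx hy) _ hst]

/-- A function on `U` minus `x` that extends near `x` extends to `U`: extensions are unique, hence
they glue. -/
lemma exists_extend {U : X.Opens} (a : Γ(X, U ⊓ punctured hx))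
    (h : x ∈ U → ∃ (V : X.Opens) (_ : x ∈ V) (hV : V ≤ U) (b : Γ(X, V)),
      resFun (inf_le_left : V ⊓ punctured hx ≤ V) b = resFun (inf_le_inf_right _ hV) a) :
    ∃ b : Γ(X, U), resFun inf_le_left b = a := by
  -- All local extensions of `a` form the gluing family. It contains `a` itself, as `p₀`, so that
  -- the result restricts to `a`.
  let T := {p : (V : X.Opens) × Γ(X, V) // ∃ hV : p.1 ≤ U,
    resFun (inf_le_left : p.1 ⊓ punctured hx ≤ p.1) p.2 = resFun (inf_le_inf_right _ hV) a}
  let p₀ : T := ⟨⟨U ⊓ punctured hx, a⟩, inf_le_left, rfl⟩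
  obtain ⟨b, hb⟩ := exists_glue_fun (ι := T) (fun p => p.1.1) (fun p => p.2.choose)
    (fun y hy => by
      by_cases hyx : y = x
      · subst hyx
        obtain ⟨V, hyV, hV, b, hb⟩ := h hy
        exact ⟨⟨⟨V, b⟩, hV, hb⟩, hyV⟩
      · exact ⟨p₀, hy, hyx⟩)
    (fun p => p.1.2) (fun p q => by
      refine resFun_punctured_injective hx _ ?_
      have hp := congrArg (resFun (inf_le_inf_right (punctured hx)
        (inf_le_left : p.1.1 ⊓ q.1.1 ≤ p.1.1))) p.2.choose_spec
      have hq := congrArg (resFun (inf_le_inf_right (punctured hx)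
        (inf_le_right : p.1.1 ⊓ q.1.1 ≤ q.1.1))) q.2.choose_spec
      simp only [resFun_resFun] at hp hq ⊢
      rw [hp, hq])
  exact ⟨b, hb p₀⟩

/-- Sections of `M` which form a frame outside `x` form a frame of the subsheaf of `M` that they
generate at `x`. -/
lemma isFrame_stalkSub {M : X.Modules} {ι : Type} [Fintype ι] {U : X.Opens} (hxU : x ∈ U)
    (t : ι → Γ(M, U)) (ht : IsFrame M (U ⊓ punctured hx) (fun i => res M inf_le_left (t i)))
    {P : Submodule (X.presheaf.stalk x) (Stalk M x)}
    (hP : P = Submodule.span (X.presheaf.stalk x) (Set.range fun i => germ M hxU (t i)))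
    (hmem : ∀ i, t i ∈ (stalkSub M x P).carrier U) :
    IsFrame (stalkSub M x P).toModules U (fun i => (stalkSub M x P).sec _ (hmem i)) := by
  rw [isFrame_iff]
  intro V h
  have key : ∀ {V : X.Opens} (h : V ≤ U) (c : ι → Γ(X, V)), (stalkSub M x P).ι.app V
      (∑ j, c j • res _ h ((stalkSub M x P).sec _ (hmem j))) =
        ∑ j, c j • res M h (t j) := by
    intro V h c
    simp [app_res]
  have keyres : ∀ {V V' : X.Opens} (h : V ≤ U) (h' : V' ≤ V) (c : ι → Γ(X, V)),
      ∑ j, resFun h' (c j) • res M (h'.trans h) (t j) = res M h' (∑ j, c j • res M h (t j)) := by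
    intro V V' h h' c
    simp [res_smul]
  have hVW : V ⊓ punctured hx ≤ U ⊓ punctured hx := inf_le_inf_right _ h
  constructor
  · intro c hc
    have h0 : ∑ j, c j • res M h (t j) = 0 := by rw [← key, hc, map_zero]
    have h1 := keyres h (inf_le_left : V ⊓ punctured hx ≤ V) c
    rw [h0, res_zero] at h1
    funext j
    refine resFun_punctured_injective hx _ ?_
    have := congrFun (ht.coord_eq_zero hVW (by simpa using h1)) j
    simpa using this
  · intro s
    obtain ⟨a, ha⟩ := ht.exists_coord hVW (res M inf_le_left ((stalkSub M x P).ι.app V s))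
    simp only [res_res] at ha
    have hloc : x ∈ V → ∃ (V' : X.Opens) (_ : x ∈ V') (hV' : V' ≤ V) (c : ι → Γ(X, V')),
        ∑ j, c j • res M (hV'.trans h) (t j) = res M hV' ((stalkSub M x P).ι.app V s) ∧
        ∀ j, resFun (inf_le_left : V' ⊓ punctured hx ≤ V') (c j) =
          resFun (inf_le_inf_right _ hV') (a j) := by
      intro hxV
      obtain ⟨V', hxV', hV'V, hV'U, c, hc⟩ := exists_coord_of_germ_mem_span hxV hxU t
        ((stalkSub M x P).ι.app V s) (hP ▸ (stalkSub M x P).ι_mem s hxV)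
      refine ⟨V', hxV', hV'V, c, hc, fun j => ?_⟩
      have h1 := keyres hV'U (inf_le_left : V' ⊓ punctured hx ≤ V') c
      have h2 := keyres (hVW.trans inf_le_left) (inf_le_inf_right (punctured hx) hV'V) a
      rw [ha, res_res] at h2
      rw [hc, res_res, ← h2] at h1
      exact congrFun (ht.coord_unique (inf_le_inf_right (punctured hx) hV'U)
        (c := fun j => resFun (inf_le_left : V' ⊓ punctured hx ≤ V') (c j))
        (c' := fun j => resFun (inf_le_inf_right (punctured hx) hV'V) (a j))
        (by simpa using h1)) j
    -- The coordinates off `x` extend across `x` because, near `x`, membership in `P` provides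
    -- regular coordinates agreeing with them.
    have hext : ∀ j, ∃ b : Γ(X, V), resFun inf_le_left b = a j := fun j =>
      exists_extend hx (a j) fun hxV => by
        obtain ⟨V', hxV', hV'V, c, -, hc⟩ := hloc hxV
        exact ⟨V', hxV', hV'V, c j, hc j⟩
    choose c hc using hext
    refine ⟨c, (stalkSub M x P).ι_injective V ?_⟩
    rw [key]
    refine section_ext M _ _ fun y hy => ?_
    by_cases hyx : y = x
    · obtain ⟨V', hxV', hV'V, c', hc', hca⟩ := hloc (hyx ▸ hy)
      refine ⟨V', hyx ▸ hxV', hV'V, ?_⟩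
      rw [← hc', ← keyres h hV'V c]
      refine Finset.sum_congr rfl fun j _ => ?_
      congr 1
      refine resFun_punctured_injective hx _ ?_
      rw [hca, ← hc j]
      simp
    · refine ⟨V ⊓ punctured hx, ⟨hy, hyx⟩, inf_le_left, ?_⟩
      rw [← ha, ← keyres h inf_le_left c]
      simp [hc]

end Punctured

/-! ### Sections with arbitrary poles at one point -/

section AwayPunctured

variable {x : X} (hx : IsClosed ({x} : Set X)) (M : X.Modules)

lemma toAway_awayEquiv (U : X.Opens) (t : Γ(away (punctured hx) M, U)) :
    (toAway (punctured hx) M).app (U ⊓ punctured hx) (awayEquiv (punctured hx) M U t) =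
      res _ inf_le_left t := by
  apply (awayEquiv (punctured hx) M _).injective
  rw [awayEquiv_toAway, awayEquiv_res]

lemma toAway_bijective {U : X.Opens} (hU : x ∉ U) :
    Function.Bijective ((toAway (punctured hx) M).app U) := by
  have hle : U ≤ U ⊓ punctured hx := le_inf le_rfl (le_punctured hx hU)
  constructor
  · intro s t hst
    have := congrArg (fun t => res M hle (awayEquiv (punctured hx) M U t)) hst
    simpa using this
  · intro t
    refine ⟨res M hle (awayEquiv (punctured hx) M U t), ?_⟩
    rw [app_res, toAway_awayEquiv, res_res, res_self]

lemma toAway_injective [IsIntegral X] [IsDiscreteValuationRing (X.presheaf.stalk x)]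
    {M : X.Modules} {r : ℕ} (hM : IsVectorBundle M r) (U : X.Opens) :
    Function.Injective ((toAway (punctured hx) M).app U) := by
  intro s t hst
  have := congrArg (awayEquiv (punctured hx) M U) hst
  rw [awayEquiv_toAway, awayEquiv_toAway] at this
  exact hM.res_punctured_injective hx U this

end AwayPunctured

/-! ### Gram matrices under a change of frame -/

section GramDeterminants

/-- The Gram matrix changes by congruence. As the index types may differ, `A` has no determinant,
and an explicit inverse is written down instead. -/
lemma isUnit_det_gram_of_change {R V ι κ : Type*} [CommRing R] [AddCommGroup V] [Module R V]
    [Fintype ι] [Fintype κ] [DecidableEq ι] [DecidableEq κ] (B : V →ₗ[R] V →ₗ[R] R) (e : ι → V)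
    (f : κ → V) (A : Matrix ι κ R) (A' : Matrix κ ι R) (h : A * A' = 1) (h' : A' * A = 1)
    (hf : ∀ j, f j = ∑ i, A i j • e i)
    (he : IsUnit (Matrix.of fun i j => B (e i) (e j)).det) :
    IsUnit (Matrix.of fun i j => B (f i) (f j)).det := by
  have key : (Matrix.of fun i j => B (f i) (f j)) =
      A.transpose * (Matrix.of fun i j => B (e i) (e j)) * A := by
    ext i j
    simp only [Matrix.of_apply, hf, map_sum, LinearMap.sum_apply, map_smul, LinearMap.smul_apply,
      Matrix.mul_apply, Matrix.transpose_apply, Finset.sum_mul, smul_eq_mul, Finset.mul_sum]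
    refine Finset.sum_congr rfl fun a _ => Finset.sum_congr rfl fun b _ => by ring
  rw [key]
  generalize (Matrix.of fun i j => B (e i) (e j)) = G at he
  rw [← Matrix.isUnit_iff_isUnit_det] at he ⊢
  obtain ⟨⟨G, G', hG, hG'⟩, rfl⟩ := he
  dsimp only
  have hA : A'.transpose * A.transpose = 1 := by
    rw [← Matrix.transpose_mul, h, Matrix.transpose_one]
  have hA' : A.transpose * A'.transpose = 1 := by
    rw [← Matrix.transpose_mul, h', Matrix.transpose_one]
  refine ⟨⟨_, A' * G' * A'.transpose, ?_, ?_⟩, rfl⟩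
  · calc A.transpose * G * A * (A' * G' * A'.transpose)
        = A.transpose * (G * (A * A') * G') * A'.transpose := by simp only [Matrix.mul_assoc]
      _ = 1 := by rw [h, Matrix.mul_one, hG, Matrix.mul_one, hA']
  · calc A' * G' * A'.transpose * (A.transpose * G * A)
        = A' * (G' * (A'.transpose * A.transpose) * G) * A := by simp only [Matrix.mul_assoc]
      _ = 1 := by rw [hA, Matrix.mul_one, hG', Matrix.mul_one, h']

lemma isUnit_of_local {X : Scheme.{u}} {U : X.Opens} (a : Γ(X, U))
    (h : ∀ y ∈ U, ∃ (V : X.Opens) (_ : y ∈ V) (hV : V ≤ U), IsUnit (resFun hV a)) : IsUnit a := by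
  refine X.toRingedSpace.isUnit_of_isUnit_germ U a fun y hy => ?_
  obtain ⟨V, hyV, hV, hu⟩ := h y hy
  have := hu.map (germFunHom hyV)
  rw [germFunHom_apply, germFun_res] at this
  exact this

end GramDeterminants

/-- A frame `e` of `E` near `x`, a uniformizer `ϖ` and weights `wt i` such that the sections
`ϖ ^ (wt i - 1) • e i` have a regular and invertible Gram matrix `γ`. -/
structure HeckeFrame {X : Scheme.{u}} (E : OrthogonalBundle X) (x : X) (ι : Type) [Fintype ι] where
  /-- the domain of the frame -/
  U : X.Opens
  mem : x ∈ U
  /-- the uniformizer -/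
  ϖ : Γ(X, U)
  irreducible : Irreducible (germFun mem ϖ)
  isUnit : ∀ {V : X.Opens} (h : V ≤ U), x ∉ V → IsUnit (resFun h ϖ)
  /-- the frame -/
  e : ι → Γ(E.sheaf, U)
  isFrame : IsFrame E.sheaf U e
  /-- the weights -/
  wt : ι → ℕ
  wt_le : ∀ i, wt i ≤ 2
  sum_wt : ∑ i, wt i = Fintype.card ι
  /-- the modified Gram matrix -/
  γ : Matrix ι ι Γ(X, U)
  γ_eq : ∀ i j, ϖ ^ 2 * γ i j = ϖ ^ (wt i + wt j) * E.form U (e i) (e j)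

/-! ### The sheaf of the Hecke transform and its Gram matrix -/

namespace HeckeFrame

variable {E : OrthogonalBundle X} {x : X} {ι : Type} [Fintype ι]
  (D : HeckeFrame E x ι) (hx : IsClosed ({x} : Set X))

lemma isUnit_punctured : IsUnit (resFun (inf_le_left : D.U ⊓ punctured hx ≤ D.U) D.ϖ) :=
  D.isUnit _ (notMem_inf_punctured hx _)

/-- The section `ϖ ^ (wt i - 1) • e i` outside `x`. -/
def θ (i : ι) : Γ(away (punctured hx) E.sheaf, D.U) :=
  (awayEquiv (punctured hx) E.sheaf D.U).symm
    ((((D.isUnit_punctured hx).unit⁻¹ : Units _) : Γ(X, D.U ⊓ punctured hx)) •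
      resFun (inf_le_left : D.U ⊓ punctured hx ≤ D.U) (D.ϖ ^ D.wt i) •
        res E.sheaf (inf_le_left : D.U ⊓ punctured hx ≤ D.U) (D.e i))

/-- Multiplied by `ϖ`, the defining relation of `θ` holds over all of `D.U` and involves no negative
exponent, even for weight zero. -/
lemma smul_θ (i : ι) :
    D.ϖ • D.θ hx i = (toAway (punctured hx) E.sheaf).app D.U (D.ϖ ^ D.wt i • D.e i) := by
  apply (awayEquiv (punctured hx) E.sheaf _).injective
  rw [awayEquiv_toAway, awayEquiv_smul, θ, AddEquiv.apply_symm_apply, res_smul, smul_smul,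
    IsUnit.mul_val_inv, one_smul]

lemma isFrame_θ : IsFrame (away (punctured hx) E.sheaf) (D.U ⊓ punctured hx)
    (fun i => res _ inf_le_left (D.θ hx i)) := by
  classical
  have h1 := (D.isFrame.restrict (inf_le_left : D.U ⊓ punctured hx ≤ D.U)).map
    (toAway (punctured hx) E.sheaf) (fun V hV => toAway_bijective hx E.sheaf
      fun h => notMem_inf_punctured hx _ (hV h))
  set u := (D.isUnit_punctured hx).unit with hu
  have hu' : (u : Γ(X, D.U ⊓ punctured hx)) = resFun inf_le_left D.ϖ := rfl
  refine h1.change (Matrix.diagonal fun i => ((u⁻¹ * u ^ D.wt i : Units _) : Γ(X, _)))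
    (Matrix.diagonal fun i => (((u⁻¹ * u ^ D.wt i)⁻¹ : Units _) : Γ(X, _))) ?_ ?_ fun j => ?_
  · rw [Matrix.diagonal_mul_diagonal]
    simp only [Units.mul_inv, Matrix.diagonal_one]
  · rw [Matrix.diagonal_mul_diagonal]
    simp only [Units.inv_mul, Matrix.diagonal_one]
  · rw [Finset.sum_eq_single j (fun i _ hij => by rw [Matrix.diagonal_apply_ne _ hij, zero_smul])
      (fun h => (h (Finset.mem_univ j)).elim), Matrix.diagonal_apply_eq]
    have := congrArg (res _ (inf_le_left : D.U ⊓ punctured hx ≤ D.U)) (D.smul_θ hx j)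
    rw [res_smul, ← hu', ← app_res, res_smul, (toAway _ _).app_smul] at this
    have h2 := congrArg (((u⁻¹ : Units _) : Γ(X, D.U ⊓ punctured hx)) • ·) this
    simp only [smul_smul, Units.inv_mul, one_smul] at h2
    rw [h2, Units.val_mul, Units.val_pow_eq_pow_val, hu']
    congr 2
    exact map_pow (resFunHom _) _ _

/-- The stalk at `x` of the Hecke transform. -/
def stalk : Submodule (X.presheaf.stalk x) (Stalk (away (punctured hx) E.sheaf) x) :=
  Submodule.span _ (Set.range fun i => germ _ D.mem (D.θ hx i))

/-- The Hecke transform as a sheaf of modules: the sections of `E` outside `x` which near `x` are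
regular combinations of the `θ i`. -/
abbrev heckeSub : LocalSubmodule (away (punctured hx) E.sheaf) :=
  stalkSub (away (punctured hx) E.sheaf) x (D.stalk hx)

lemma θ_mem (i : ι) : D.θ hx i ∈ (D.heckeSub hx).carrier D.U :=
  fun _ => Submodule.subset_span ⟨i, rfl⟩

/-- The frame of the Hecke transform near `x`. -/
def heckeFrame (i : ι) : Γ((D.heckeSub hx).toModules, D.U) :=
  (D.heckeSub hx).sec (D.θ hx i) (D.θ_mem hx i)

lemma ι_heckeFrame (i : ι) : (D.heckeSub hx).ι.app D.U (D.heckeFrame hx i) = D.θ hx i := rfl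

/-- The section of `E` outside `x` given by a section of the Hecke transform. -/
def val (U : X.Opens) : Γ((D.heckeSub hx).toModules, U) →+ Γ(E.sheaf, U ⊓ punctured hx) :=
  (awayEquiv (punctured hx) E.sheaf U).toAddMonoidHom.comp
    (appLinear (D.heckeSub hx).ι U).toAddMonoidHom

lemma val_apply {U : X.Opens} (s : Γ((D.heckeSub hx).toModules, U)) :
    D.val hx U s = awayEquiv (punctured hx) E.sheaf U ((D.heckeSub hx).ι.app U s) := rfl

lemma val_smul {U : X.Opens} (a : Γ(X, U)) (s : Γ((D.heckeSub hx).toModules, U)) :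
    D.val hx U (a • s) = resFun (inf_le_left : U ⊓ punctured hx ≤ U) a • D.val hx U s := by
  rw [val_apply, (D.heckeSub hx).ι.app_smul, awayEquiv_smul, val_apply]

lemma val_res {U V : X.Opens} (h : V ≤ U) (s : Γ((D.heckeSub hx).toModules, U)) :
    D.val hx V (res _ h s) = res _ (inf_le_inf_right _ h) (D.val hx U s) := by
  rw [val_apply, app_res, awayEquiv_res, val_apply]

lemma card_eq [IsIntegral X] (D : HeckeFrame E x ι) : Fintype.card ι = E.rank := by
  obtain ⟨U, hU, e, he⟩ := E.isVectorBundle x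
  have := Fintype.card_congr ((D.isFrame.stalkBasis D.mem).indexEquiv (he.stalkBasis hU))
  simpa using this

lemma isFrame_heckeFrame [IsIntegral X] [IsDiscreteValuationRing (X.presheaf.stalk x)] :
    IsFrame (D.heckeSub hx).toModules D.U (D.heckeFrame hx) :=
  isFrame_stalkSub hx D.mem (D.θ hx) (D.isFrame_θ hx) rfl (D.θ_mem hx)

lemma resFun_γ (i j : ι) : resFun inf_le_left (D.γ i j) =
    E.form _ (D.val hx D.U (D.heckeFrame hx i)) (D.val hx D.U (D.heckeFrame hx j)) := by
  have hval : ∀ i, resFun (inf_le_left : D.U ⊓ punctured hx ≤ D.U) D.ϖ •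
      D.val hx D.U (D.heckeFrame hx i) =
        resFun (inf_le_left : D.U ⊓ punctured hx ≤ D.U) (D.ϖ ^ D.wt i) •
          res E.sheaf (inf_le_left : D.U ⊓ punctured hx ≤ D.U) (D.e i) := by
    intro i
    rw [← val_smul, val_apply, (D.heckeSub hx).ι.app_smul, ι_heckeFrame, smul_θ, awayEquiv_toAway,
      res_smul]
  have hu := D.isUnit_punctured hx
  -- The defining relation of `γ` is the claim multiplied by `ϖ ^ 2`, which is a unit off `x`.
  refine (hu.mul hu).mul_left_cancel ?_
  have h1 := congrArg₂ (fun s t => E.form _ s t) (hval i) (hval j)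
  simp only [map_smul, LinearMap.smul_apply, smul_eq_mul, E.form_res] at h1
  have h2 := congrArg (resFun (inf_le_left : D.U ⊓ punctured hx ≤ D.U)) (D.γ_eq i j)
  simp only [pow_add, pow_two, resFun_mul] at h2
  linear_combination h2 - h1

/-- With `r` the rank and `G` the Gram matrix of `e`, determinants give `ϖ ^ (2 r) det γ = ϖ ^ (2 ∑
wt) det G`. The weights sum to `r`, so `det γ = det G`. -/
lemma isUnit_det_γ [IsIntegral X] [DecidableEq ι] : IsUnit D.γ.det := by
  let G : Matrix ι ι Γ(X, D.U) := Matrix.of fun i j => E.form D.U (D.e i) (D.e j)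
  have hG : IsUnit G.det := by
    let σ : Fin E.rank ≃ ι := (Fintype.equivFinOfCardEq D.card_eq).symm
    have := E.form_nondegenerate D.U _ (D.isFrame.reindex σ)
    rwa [← Matrix.det_submatrix_equiv_self σ]
  have : Nonempty D.U := ⟨⟨x, D.mem⟩⟩
  have hmat : D.ϖ ^ 2 • D.γ = Matrix.diagonal (fun i => D.ϖ ^ D.wt i) * G *
      Matrix.diagonal (fun i => D.ϖ ^ D.wt i) := by
    ext i j
    rw [Matrix.mul_diagonal, Matrix.diagonal_mul, Matrix.smul_apply, smul_eq_mul, D.γ_eq, pow_add]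
    simp only [G, Matrix.of_apply]
    ring
  have hdet := congrArg Matrix.det hmat
  rw [Matrix.det_smul, Matrix.det_mul, Matrix.det_mul, Matrix.det_diagonal,
    Finset.prod_pow_eq_pow_sum, D.sum_wt, mul_right_comm, ← pow_add, ← pow_mul, ← two_mul] at hdet
  have hϖ : D.ϖ ≠ 0 := by
    intro h
    apply D.irreducible.ne_zero
    rw [h, germFun_zero]
  rwa [mul_left_cancel₀ (pow_ne_zero _ hϖ) hdet]

end HeckeFrame

/-! ### The orthogonal form on the Hecke transform -/

namespace HeckeFrame

variable {E : OrthogonalBundle X} {x : X} {ι : Type} [Fintype ι]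
  (D : HeckeFrame E x ι) (hx : IsClosed ({x} : Set X))

lemma isFrame_val {r : ℕ} {U : X.Opens} {h : Fin r → Γ((D.heckeSub hx).toModules, U)}
    (hh : IsFrame (D.heckeSub hx).toModules U h) :
    IsFrame E.sheaf (U ⊓ punctured hx) (fun i => D.val hx U (h i)) := by
  have hn := notMem_inf_punctured hx U
  refine IsFrame.of_map (toAway (punctured hx) E.sheaf)
    (fun V hV => toAway_bijective hx E.sheaf fun h => hn (hV h)) ?_
  have h1 := (hh.restrict (inf_le_left : U ⊓ punctured hx ≤ U)).map (D.heckeSub hx).ι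
    fun V hV => stalkSub_ι_bijective fun h => hn (hV h)
  simpa only [val_apply, toAway_awayEquiv, app_res] using h1

variable [IsIntegral X] [IsDiscreteValuationRing (X.presheaf.stalk x)]

/-- Near `x` sections are regular combinations of the `θ i`, whose pairings are the regular
functions `γ i j`; hence the form of `E` acquires no pole at `x`. -/
lemma exists_form (U : X.Opens) (s t : Γ((D.heckeSub hx).toModules, U)) :
    ∃ a : Γ(X, U), resFun inf_le_left a =
      E.form (U ⊓ punctured hx) (D.val hx U s) (D.val hx U t) := by
  refine exists_extend hx _ fun hxU => ?_
  have hUU : x ∈ U ⊓ D.U := ⟨hxU, D.mem⟩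
  obtain ⟨c, hc⟩ := (D.isFrame_heckeFrame hx).exists_coord inf_le_right
    (res _ (inf_le_left : U ⊓ D.U ≤ U) s)
  obtain ⟨d, hd⟩ := (D.isFrame_heckeFrame hx).exists_coord inf_le_right
    (res _ (inf_le_left : U ⊓ D.U ≤ U) t)
  refine ⟨U ⊓ D.U, hUU, inf_le_left, ∑ j, d j * ∑ i, c i * resFun inf_le_right (D.γ i j), ?_⟩
  rw [← E.form_res, ← D.val_res hx (inf_le_left : U ⊓ D.U ≤ U),
    ← D.val_res hx (inf_le_left : U ⊓ D.U ≤ U), ← hc, ← hd]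
  simp only [map_sum, LinearMap.sum_apply, val_smul, map_smul, LinearMap.smul_apply, smul_eq_mul,
    resFun_sum, resFun_mul, val_res, E.form_res, ← resFun_γ, resFun_resFun, Finset.mul_sum]

/-- The form of the Hecke transform. -/
def formFun (U : X.Opens) (s t : Γ((D.heckeSub hx).toModules, U)) : Γ(X, U) :=
  (D.exists_form hx U s t).choose

lemma resFun_formFun (U : X.Opens) (s t : Γ((D.heckeSub hx).toModules, U)) :
    resFun inf_le_left (D.formFun hx U s t) =
      E.form (U ⊓ punctured hx) (D.val hx U s) (D.val hx U t) :=
  (D.exists_form hx U s t).choose_spec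

/-- The form of the Hecke transform as a bilinear map. -/
def form (U : X.Opens) : Γ((D.heckeSub hx).toModules, U) →ₗ[Γ(X, U)]
    Γ((D.heckeSub hx).toModules, U) →ₗ[Γ(X, U)] Γ(X, U) :=
  LinearMap.mk₂ _ (D.formFun hx U)
    (fun s s' t => resFun_punctured_injective hx U <| by
      simp only [resFun_formFun, resFun_add, map_add, LinearMap.add_apply])
    (fun a s t => resFun_punctured_injective hx U <| by
      simp only [resFun_formFun, smul_eq_mul, resFun_mul, val_smul, map_smul,
        LinearMap.smul_apply])
    (fun s t t' => resFun_punctured_injective hx U <| by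
      simp only [resFun_formFun, resFun_add, map_add])
    (fun a s t => resFun_punctured_injective hx U <| by
      simp only [resFun_formFun, smul_eq_mul, resFun_mul, val_smul, map_smul])

lemma resFun_form (U : X.Opens) (s t : Γ((D.heckeSub hx).toModules, U)) :
    resFun (inf_le_left : U ⊓ punctured hx ≤ U) (D.form hx U s t) =
      E.form (U ⊓ punctured hx) (D.val hx U s) (D.val hx U t) :=
  D.resFun_formFun hx U s t

lemma form_res {U V : X.Opens} (h : V ≤ U) (s t : Γ((D.heckeSub hx).toModules, U)) :
    D.form hx V (res _ h s) (res _ h t) = resFun h (D.form hx U s t) := by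
  refine resFun_punctured_injective hx V ?_
  have := congrArg (resFun (inf_le_inf_right (punctured hx) h)) (D.resFun_form hx U s t)
  rw [resFun_form, val_res, val_res, E.form_res, ← this, resFun_resFun, resFun_resFun]

lemma form_heckeFrame (i j : ι) :
    D.form hx D.U (D.heckeFrame hx i) (D.heckeFrame hx j) = D.γ i j :=
  resFun_punctured_injective hx _ (by rw [resFun_form, resFun_γ])

lemma isVectorBundle : IsVectorBundle (D.heckeSub hx).toModules E.rank := by
  intro y
  by_cases hyx : y = x
  · subst hyx
    let σ : Fin E.rank ≃ ι := (Fintype.equivFinOfCardEq D.card_eq).symm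
    exact ⟨D.U, D.mem, _, (D.isFrame_heckeFrame hx).reindex σ⟩
  · obtain ⟨U, hyU, e, he⟩ := E.isVectorBundle y
    have hn := notMem_inf_punctured hx U
    have h1 := (he.restrict (inf_le_left : U ⊓ punctured hx ≤ U)).map
      (toAway (punctured hx) E.sheaf) fun V hV => toAway_bijective hx E.sheaf fun h => hn (hV h)
    choose f hf using fun i => (stalkSub_ι_bijective (P := D.stalk hx) hn).2
      ((toAway (punctured hx) E.sheaf).app _ (res _ inf_le_left (e i)))
    refine ⟨U ⊓ punctured hx, ⟨hyU, hyx⟩, f, ?_⟩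
    refine IsFrame.of_map (D.heckeSub hx).ι
      (fun V hV => stalkSub_ι_bijective fun h => hn (hV h)) ?_
    simpa only [hf] using h1

/-- Invertibility is local. At `x` the given frame is compared with the `θ i`, whose Gram matrix is
`γ`; elsewhere it is a frame of `E`. -/
lemma form_nondegenerate (U : X.Opens) (h : Fin E.rank → Γ((D.heckeSub hx).toModules, U))
    (hh : IsFrame (D.heckeSub hx).toModules U h) :
    IsUnit (Matrix.of fun i j => D.form hx U (h i) (h j)).det := by
  classical
  have hres : ∀ {V : X.Opens} (hV : V ≤ U),
      resFun hV (Matrix.of fun i j => D.form hx U (h i) (h j)).det =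
        (Matrix.of fun i j => D.form hx V (res _ hV (h i)) (res _ hV (h j))).det := by
    intro V hV
    rw [resFun_det]
    congr 1
    ext i j
    simp [form_res]
  refine isUnit_of_local _ fun y hy => ?_
  by_cases hyx : y = x
  · subst hyx
    refine ⟨U ⊓ D.U, ⟨hy, D.mem⟩, inf_le_left, ?_⟩
    rw [hres]
    have h1 := (D.isFrame_heckeFrame hx).restrict (inf_le_right : U ⊓ D.U ≤ D.U)
    obtain ⟨A, B, hAB, hBA, hA, -⟩ := h1.exists_matrix (hh.restrict inf_le_left)
    refine isUnit_det_gram_of_change (D.form hx _) _ _ A B hAB hBA hA ?_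
    have := D.isUnit_det_γ.map (resFunHom (inf_le_right : U ⊓ D.U ≤ D.U))
    rw [resFunHom_apply, resFun_det] at this
    convert this using 2
    ext i j
    simp [form_res, form_heckeFrame]
  · refine ⟨U ⊓ punctured hx, ⟨hy, hyx⟩, inf_le_left, ?_⟩
    have := E.form_nondegenerate _ _ (D.isFrame_val hx hh)
    rw [resFun_det]
    convert this using 2
    ext i j
    simp [resFun_form]

/-- The Hecke transform defined by a Hecke frame. -/
def heckeTransform : OrthogonalBundle X where
  sheaf := (D.heckeSub hx).toModules
  rank := E.rank
  isVectorBundle := D.isVectorBundle hx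
  form := D.form hx
  form_res h s t := D.form_res hx h s t
  form_symm U s t := resFun_punctured_injective hx U <| by
    rw [resFun_form, resFun_form, E.form_symm]
  form_nondegenerate := D.form_nondegenerate hx

end HeckeFrame

/-! ### The Lagrangian submodule and the Hecke transform property -/

namespace HeckeFrame

variable {E : OrthogonalBundle X} {x : X} {ι : Type} [Fintype ι]
  (D : HeckeFrame E x ι) (hx : IsClosed ({x} : Set X))

/-- The stalk at `x` of the kernel of `E ⟶ E_{2x} / L`. -/
def kerStalk : Submodule (X.presheaf.stalk x) (Stalk E.sheaf x) :=
  Submodule.span _ (Set.range fun i => germ _ D.mem (D.ϖ ^ D.wt i • D.e i))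

/-- The kernel of `E ⟶ E_{2x} / L`. -/
abbrev kerSub : LocalSubmodule E.sheaf := stalkSub E.sheaf x D.kerStalk

/-- The Lagrangian submodule of `E_{2x}` defined by a Hecke frame. -/
def lagrangian : Submodule (X.presheaf.stalk x) (FirstOrderFibre E.sheaf x) :=
  D.kerStalk.map (Submodule.mkQ _)

/-- Since the weights are at most `2`, each `ϖ ^ 2 • e i` is a multiple of the generator `ϖ ^ wt i •
e i`. -/
lemma smul_mem_kerStalk {a : X.presheaf.stalk x} {m : Stalk E.sheaf x}
    (ha : germFun D.mem D.ϖ ^ 2 ∣ a) : a • m ∈ D.kerStalk := by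
  obtain ⟨b, rfl⟩ := ha
  have hm : m ∈ Submodule.span (X.presheaf.stalk x) (Set.range fun i => germ _ D.mem (D.e i)) := by
    rw [D.isFrame.span_germ_eq_top D.mem]; trivial
  rw [mul_comm, mul_smul]
  refine Submodule.smul_mem _ _ ?_
  induction hm using Submodule.span_induction with
  | mem m hm =>
    obtain ⟨i, rfl⟩ := hm
    obtain ⟨n, hn⟩ := Nat.exists_eq_add_of_le (D.wt_le i)
    have : germFun D.mem D.ϖ ^ 2 • germ _ D.mem (D.e i) =
        germFun D.mem D.ϖ ^ n • germ _ D.mem (D.ϖ ^ D.wt i • D.e i) := by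
      rw [germ_smul, smul_smul]
      congr 1
      rw [hn, add_comm, pow_add]
      congr 1
      exact (map_pow (germFunHom D.mem) _ _).symm
    rw [this]
    exact Submodule.smul_mem _ _ (Submodule.subset_span ⟨i, rfl⟩)
  | zero => rw [smul_zero]; exact Submodule.zero_mem _
  | add m m' _ _ h h' => rw [smul_add]; exact Submodule.add_mem _ h h'
  | smul b m _ h => rw [smul_comm]; exact Submodule.smul_mem _ _ h

variable [IsIntegral X] [IsDiscreteValuationRing (X.presheaf.stalk x)]

lemma maximalIdeal_eq :
    IsLocalRing.maximalIdeal (X.presheaf.stalk x) = Ideal.span {germFun D.mem D.ϖ} :=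
  D.irreducible.maximalIdeal_eq

lemma sq_smul_top_le_kerStalk :
    IsLocalRing.maximalIdeal (X.presheaf.stalk x) ^ 2 • ⊤ ≤ D.kerStalk := by
  rw [D.maximalIdeal_eq, Ideal.span_singleton_pow, Submodule.smul_le]
  intro a ha m _
  exact D.smul_mem_kerStalk (Ideal.mem_span_singleton.1 ha)

/-- The kernel of reduction is contained in `kerStalk`, so `kerStalk` is the full preimage of its
image. -/
lemma mem_lagrangian {U : X.Opens} (hxU : x ∈ U) (s : Γ(E.sheaf, U)) :
    jet E.sheaf hxU s ∈ D.lagrangian ↔ germ E.sheaf hxU s ∈ D.kerStalk := by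
  have : Submodule.comap (Submodule.mkQ _) D.lagrangian = D.kerStalk := by
    rw [lagrangian, Submodule.comap_map_mkQ]
    exact sup_eq_right.2 D.sq_smul_top_le_kerStalk
  rw [← this]
  rfl

/-- This is the equality `E' = H(-x)` on stalks: the generators of `E'` are `ϖ` times those of `H`.
-/
lemma map_toAway_kerStalk :
    D.kerStalk.map (stalkLinear (toAway (punctured hx) E.sheaf) x) =
      IsLocalRing.maximalIdeal (X.presheaf.stalk x) • D.stalk hx := by
  rw [kerStalk, stalk, Submodule.map_span, D.maximalIdeal_eq, Submodule.ideal_span_singleton_smul,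
    ← Submodule.span_smul, ← Set.range_comp, ← Set.image_smul, ← Set.range_comp]
  congr 2
  ext i
  simp only [Function.comp_apply, stalkLinear_germ, ← smul_θ]
  exact germ_smul _ _ _ _

lemma toAway_mem_heckeSub (U : X.Opens) (s : Γ(D.kerSub.toModules, U)) :
    (D.kerSub.ι ≫ toAway (punctured hx) E.sheaf).app U s ∈ (D.heckeSub hx).carrier U := by
  intro hxU
  have h1 := Submodule.mem_map_of_mem (f := stalkLinear (toAway (punctured hx) E.sheaf) x)
    (D.kerSub.ι_mem s hxU)
  rw [stalkLinear_germ, map_toAway_kerStalk] at h1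
  exact Submodule.smul_le_right h1

/-- The morphism identifying the kernel of `E ⟶ E_{2x} / L` with the sections of the Hecke
transform vanishing at `x`. -/
def twist : D.kerSub.toModules ⟶ (D.heckeSub hx).toModules :=
  (D.heckeSub hx).lift (D.kerSub.ι ≫ toAway (punctured hx) E.sheaf) (D.toAway_mem_heckeSub hx)

lemma ι_twist (U : X.Opens) (s : Γ(D.kerSub.toModules, U)) :
    (D.heckeSub hx).ι.app U ((D.twist hx).app U s) =
      (toAway (punctured hx) E.sheaf).app U (D.kerSub.ι.app U s) := rfl

lemma val_twist (U : X.Opens) (s : Γ(D.kerSub.toModules, U)) :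
    D.val hx U ((D.twist hx).app U s) = res E.sheaf inf_le_left (D.kerSub.ι.app U s) := by
  rw [val_apply, ι_twist, awayEquiv_toAway]

lemma twist_injective (U : X.Opens) : Function.Injective ((D.twist hx).app U) := by
  intro s t hst
  refine D.kerSub.ι_injective U (toAway_injective hx E.isVectorBundle U ?_)
  rw [← ι_twist, ← ι_twist, hst]

lemma mem_range_twist (U : X.Opens) (t : Γ((D.heckeSub hx).toModules, U)) :
    t ∈ Set.range ((D.twist hx).app U) ↔ ∀ hx' : x ∈ U, germ (D.heckeSub hx).toModules hx' t ∈
      IsLocalRing.maximalIdeal (X.presheaf.stalk x) •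
        (⊤ : Submodule (X.presheaf.stalk x) (Stalk (D.heckeSub hx).toModules x)) := by
  have hmap : (IsLocalRing.maximalIdeal (X.presheaf.stalk x) •
      (⊤ : Submodule (X.presheaf.stalk x) (Stalk (D.heckeSub hx).toModules x))).map
        (stalkLinear (D.heckeSub hx).ι x) =
      D.kerStalk.map (stalkLinear (toAway (punctured hx) E.sheaf) x) := by
    rw [map_toAway_kerStalk, Submodule.map_smul'', Submodule.map_top, range_stalkLinear_stalkSub]
  have hinj := stalkLinear_injective (D.heckeSub hx).ι D.mem
    fun V _ => (D.heckeSub hx).ι_injective V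
  have hinj' := stalkLinear_injective (toAway (punctured hx) E.sheaf) D.mem
    fun V _ => toAway_injective hx E.isVectorBundle V
  have hmem : ∀ hx' : x ∈ U, germ (D.heckeSub hx).toModules hx' t ∈
      IsLocalRing.maximalIdeal (X.presheaf.stalk x) •
        (⊤ : Submodule (X.presheaf.stalk x) (Stalk (D.heckeSub hx).toModules x)) ↔
      germ _ hx' ((D.heckeSub hx).ι.app U t) ∈
        D.kerStalk.map (stalkLinear (toAway (punctured hx) E.sheaf) x) := by
    intro hx'
    rw [← hmap, ← stalkLinear_germ]
    exact (hinj.mem_set_image).symm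
  simp only [hmem]
  constructor
  · rintro ⟨s, rfl⟩ hx'
    rw [ι_twist, ← stalkLinear_germ]
    exact Submodule.mem_map_of_mem (D.kerSub.ι_mem s hx')
  · intro h
    -- The hypothesis on the germ yields a section of `E` near `x`, and off `x` nothing is required;
    -- the local lifts glue.
    have hr : (D.heckeSub hx).ι.app U t ∈
        Set.range ((toAway (punctured hx) E.sheaf).app U) := by
      refine mem_range_app_of_local _ (toAway_injective hx E.isVectorBundle) _ fun y hy => ?_
      by_cases hyx : y = x
      · subst hyx
        obtain ⟨m, -, hm⟩ := h hy
        obtain ⟨V, hV, s, rfl⟩ := exists_germ _ m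
        rw [stalkLinear_germ] at hm
        obtain ⟨W, hyW, h₁, h₂, e⟩ := exists_res_eq_of_germ_eq _ _ _ _ _ hm
        exact ⟨W, hyW, h₂, res _ h₁ s, by rw [app_res, e]⟩
      · exact ⟨U ⊓ punctured hx, ⟨hy, hyx⟩, inf_le_left,
          (toAway_bijective hx E.sheaf (notMem_inf_punctured hx U)).2 _⟩
    obtain ⟨s, hs⟩ := hr
    refine ⟨D.kerSub.sec s fun hx' => ?_, (D.heckeSub hx).ι_injective U hs⟩
    have := h hx'
    rw [← hs, ← stalkLinear_germ] at this
    exact hinj'.mem_set_image.1 this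

lemma form_twist (U : X.Opens) (s t : Γ(D.kerSub.toModules, U)) :
    D.form hx U ((D.twist hx).app U s) ((D.twist hx).app U t) =
      E.form U (D.kerSub.ι.app U s) (D.kerSub.ι.app U t) :=
  resFun_punctured_injective hx U <| by
    rw [resFun_form, val_twist, val_twist, E.form_res]

theorem isHeckeTransform :
    E.IsHeckeTransform x D.lagrangian (D.heckeTransform hx) D.kerSub.ι (D.twist hx) where
  incl_injective := D.kerSub.ι_injective
  mem_range_incl U s := by
    rw [LocalSubmodule.mem_range_ι, mem_stalkSub]
    simp only [mem_lagrangian]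
  twist_injective := D.twist_injective hx
  mem_range_twist := D.mem_range_twist hx
  form_eq := D.form_twist hx

/-- Lifts of elements of `L` are combinations of the `ϖ ^ wt i • e i`, whose pairings are `ϖ ^ 2 * γ
i j`. -/
lemma isotropic_lagrangian (U : X.Opens) (hxU : x ∈ U) (s t : Γ(E.sheaf, U))
    (hs : jet E.sheaf hxU s ∈ D.lagrangian) (ht : jet E.sheaf hxU t ∈ D.lagrangian) :
    germFun hxU (E.form U s t) ∈ IsLocalRing.maximalIdeal (X.presheaf.stalk x) ^ 2 := by
  rw [mem_lagrangian] at hs ht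
  obtain ⟨V, hV, hVU, hV₁, c, hc⟩ := exists_coord_of_germ_mem_span hxU D.mem _ s hs
  obtain ⟨V', hV', hVU', hV₁', d, hd⟩ := exists_coord_of_germ_mem_span hxU D.mem _ t ht
  have hVV : x ∈ V ⊓ V' := ⟨hV, hV'⟩
  have hle : V ⊓ V' ≤ U := inf_le_left.trans hVU
  have hle₁ : V ⊓ V' ≤ D.U := inf_le_left.trans hV₁
  have key : ∃ a, E.form _ (res _ hle s) (res _ hle t) = resFun hle₁ (D.ϖ ^ 2) * a := by
    refine ⟨∑ j, resFun inf_le_right (d j) * ∑ i, resFun inf_le_left (c i) *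
      resFun hle₁ (D.γ i j), ?_⟩
    have e1 : res _ hle s = ∑ i, resFun (inf_le_left : V ⊓ V' ≤ V) (c i) •
        res _ hle₁ (D.ϖ ^ D.wt i • D.e i) := by
      rw [← res_res _ hVU inf_le_left, ← hc]
      simp [res_smul]
    have e2 : res _ hle t = ∑ i, resFun (inf_le_right : V ⊓ V' ≤ V') (d i) •
        res _ hle₁ (D.ϖ ^ D.wt i • D.e i) := by
      rw [← res_res _ hVU' inf_le_right, ← hd]
      simp [res_smul]
    rw [e1, e2]
    simp only [map_sum, LinearMap.sum_apply, map_smul, LinearMap.smul_apply, smul_eq_mul,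
      E.form_res, Finset.mul_sum]
    refine Finset.sum_congr rfl fun j _ => Finset.sum_congr rfl fun i _ => ?_
    have := congrArg (resFun hle₁) (D.γ_eq i j)
    simp only [pow_add, resFun_mul] at this ⊢
    linear_combination (-resFun inf_le_right (d j) * resFun inf_le_left (c i)) * this
  obtain ⟨a, ha⟩ := key
  rw [E.form_res] at ha
  have h2 := congrArg (germFun hVV) ha
  rw [germFun_res, germFun_mul, germFun_res] at h2
  rw [h2, D.maximalIdeal_eq, Ideal.span_singleton_pow, Ideal.mem_span_singleton]
  exact Dvd.intro _ (congrArg (· * _) (map_pow (germFunHom D.mem) _ _).symm)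

end HeckeFrame

/-- The coordinate map from `ι → R` onto this image has kernel the product of the ideals `𝔪 ^ (n -
wt i)`, because `wt i ≤ n`. The image is thus a sum of cyclic modules whose lengths add up. -/
lemma length_map_mkQ_span {R M ι : Type*} [CommRing R] [IsDomain R] [IsDiscreteValuationRing R]
    [AddCommGroup M] [Module R M] [Fintype ι] (b : Module.Basis ι R M) {ϖ : R}
    (hϖ : Irreducible ϖ) (n : ℕ) (wt : ι → ℕ) (hwt : ∀ i, wt i ≤ n) :
    Module.length R ((Submodule.span R (Set.range fun i => ϖ ^ wt i • b i)).map
      (Submodule.mkQ (IsLocalRing.maximalIdeal R ^ n • ⊤ : Submodule R M))) =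
      ∑ i, ((n - wt i : ℕ) : ℕ∞) := by
  classical
  set Q := (IsLocalRing.maximalIdeal R ^ n • ⊤ : Submodule R M) with hQ
  have memQ : ∀ c : ι → R, ∑ i, c i • b i ∈ Q ↔ ∀ i, ϖ ^ n ∣ c i := by
    intro c
    rw [hQ, hϖ.maximalIdeal_eq, Ideal.span_singleton_pow, Submodule.ideal_span_singleton_smul,
      Submodule.mem_smul_pointwise_iff_exists]
    constructor
    · rintro ⟨v, -, hv⟩ i
      have := congrArg (fun v => b.repr v i) hv
      simp only [map_smul, Finsupp.smul_apply, smul_eq_mul, b.repr_sum_self] at this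
      exact ⟨_, this.symm⟩
    · intro h
      choose d hd using h
      exact ⟨∑ i, d i • b i, trivial, by
        simp only [Finset.smul_sum, smul_smul, ← hd]⟩
  let f : (ι → R) →ₗ[R] M ⧸ Q :=
    (Submodule.mkQ Q).comp (Fintype.linearCombination R fun i => ϖ ^ wt i • b i)
  have hrange : LinearMap.range f =
      (Submodule.span R (Set.range fun i => ϖ ^ wt i • b i)).map (Submodule.mkQ Q) := by
    rw [LinearMap.range_comp, Fintype.range_linearCombination]
  have hker : LinearMap.ker f =
      Submodule.pi Set.univ fun i => IsLocalRing.maximalIdeal R ^ (n - wt i) := by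
    ext c
    have : f c = Submodule.mkQ Q (∑ i, (c i * ϖ ^ wt i) • b i) := by
      simp only [f, LinearMap.comp_apply, Fintype.linearCombination_apply, smul_smul]
    rw [LinearMap.mem_ker, this, Submodule.mkQ_apply, Submodule.Quotient.mk_eq_zero, memQ]
    simp only [Submodule.mem_pi, Set.mem_univ, forall_const, hϖ.maximalIdeal_eq,
      Ideal.span_singleton_pow, Ideal.mem_span_singleton]
    refine forall_congr' fun i => ?_
    conv_lhs => rw [← Nat.sub_add_cancel (hwt i), pow_add]
    exact mul_dvd_mul_iff_right (pow_ne_zero _ hϖ.ne_zero)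
  rw [← hrange, ← f.quotKerEquivRange.length_eq, hker, (Submodule.quotientPi _).length_eq,
    Module.length_pi_of_fintype]
  simp only [IsDiscreteValuationRing.length_quotient_pow_maximalIdeal]

namespace HeckeFrame

variable {E : OrthogonalBundle X} {x : X} {ι : Type} [Fintype ι]
  (D : HeckeFrame E x ι) [IsIntegral X] [IsDiscreteValuationRing (X.presheaf.stalk x)]

lemma length_lagrangian : Module.length (X.presheaf.stalk x) D.lagrangian = E.rank := by
  have h := length_map_mkQ_span (D.isFrame.stalkBasis D.mem) D.irreducible 2 D.wt D.wt_le
  have h1 : (fun i => germFun D.mem D.ϖ ^ D.wt i • D.isFrame.stalkBasis D.mem i) =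
      fun i => germ _ D.mem (D.ϖ ^ D.wt i • D.e i) := by
    ext i
    rw [germ_smul, IsFrame.stalkBasis_apply]
    congr 1
    exact (map_pow (germFunHom D.mem) _ _).symm
  rw [h1] at h
  refine h.trans ?_
  rw [← Nat.cast_sum, ← D.card_eq]
  congr 1
  -- As the weights are at most `2`, the subtraction is not truncated, and the length is `2 r - r =
  -- r`.
  have h2 : ∑ i, (2 - D.wt i) + ∑ i, D.wt i = 2 * Fintype.card ι := by
    rw [← Finset.sum_add_distrib, Finset.sum_congr rfl fun i _ => Nat.sub_add_cancel (D.wt_le i)]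
    simp [mul_comm]
  have := D.sum_wt
  omega

theorem isLagrangian : E.IsLagrangian x D.lagrangian :=
  ⟨D.isotropic_lagrangian, D.length_lagrangian⟩

end HeckeFrame

/-! ### Uniformizers -/

section Uniformizer

variable [IsLocallyNoetherian X] {x : X}

/-- A uniformizer at `x` is invertible on a punctured neighbourhood of `x`. -/
lemma exists_uniformizer (hx : IsClosed ({x} : Set X)) [IsDomain (X.presheaf.stalk x)]
    [IsDiscreteValuationRing (X.presheaf.stalk x)] {U₀ : X.Opens} (hx₀ : x ∈ U₀) :
    ∃ (U : X.Opens) (hxU : x ∈ U) (_ : U ≤ U₀) (ϖ : Γ(X, U)), Irreducible (germFun hxU ϖ) ∧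
      ∀ (V : X.Opens) (h : V ≤ U), x ∉ V → IsUnit (resFun h ϖ) := by
  obtain ⟨p, hp⟩ := IsDiscreteValuationRing.exists_irreducible (X.presheaf.stalk x)
  obtain ⟨U₁, hx₁, ϖ, rfl⟩ := exists_germFun p
  have hx₂ : x ∈ U₀ ⊓ U₁ := ⟨hx₀, hx₁⟩
  obtain ⟨_, ⟨U, hU, rfl⟩, hxU, hUU⟩ :=
    X.isBasis_affineOpens.exists_subset_of_mem_open hx₂ (U₀ ⊓ U₁).2
  change x ∈ U at hxU
  change U ≤ U₀ ⊓ U₁ at hUU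
  -- The punctured affine set is covered by basic open sets. Points outside it receive the function
  -- `0`, whose basic open set is empty.
  have hcov : ∀ y : X, ∃ f : Γ(X, U), X.basicOpen f ≤ U ⊓ punctured hx ∧
      (y ∈ U ⊓ punctured hx → y ∈ X.basicOpen f) := by
    intro y
    by_cases hy : y ∈ U ⊓ punctured hx
    · obtain ⟨f, hf, hyf⟩ := hU.exists_basicOpen_le ⟨y, hy⟩ hy.1
      exact ⟨f, hf, fun _ => hyf⟩
    · exact ⟨0, by simp, fun h => (hy h).elim⟩
  choose f hf hyf using hcov
  have hcpt : IsCompact ((U ⊓ punctured hx : X.Opens) : Set X) := by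
    have := IsLocallyNoetherian.component_noetherian (X := X) ⟨U, hU⟩
    have := noetherianSpace_of_isAffineOpen U hU
    have h1 := (NoetherianSpace.isCompact (Subtype.val ⁻¹' ((punctured hx : X.Opens) : Set X) :
      Set U)).image continuous_subtype_val
    have h2 : ((U ⊓ punctured hx : X.Opens) : Set X) = _ :=
      (Subtype.image_preimage_coe (U : Set X) (punctured hx : Set X)).symm
    rw [h2]
    exact h1
  obtain ⟨s, hs⟩ := hcpt.elim_finite_subcover (fun y => (X.basicOpen (f y) : Set X))
    (fun y => (X.basicOpen (f y)).2) fun y hy => Set.mem_iUnion.2 ⟨y, hyf y hy⟩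
  -- Each `f y` vanishes at `x`, hence is divisible by `ϖ` there. By finiteness these divisibilities
  -- hold on a common neighbourhood, where `ϖ` is a unit wherever some `f y` is.
  have hdvd : ∀ y : s, ∃ a, a * germFun hx₁ ϖ = germFun hxU (f y) := by
    intro y
    have h1 : germFun hxU (f y) ∈ IsLocalRing.maximalIdeal (X.presheaf.stalk x) := by
      rw [IsLocalRing.mem_maximalIdeal, mem_nonunits_iff]
      intro h
      exact notMem_inf_punctured hx U (hf y ((X.mem_basicOpen (f y.1) x hxU).2 h))
    rw [hp.maximalIdeal_eq, Ideal.mem_span_singleton'] at h1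
    exact h1
  choose a ha using hdvd
  obtain ⟨V, hV, hVU, b, hb⟩ := exists_common_germFun a hxU
  obtain ⟨W, hW, hWV, heq⟩ := exists_common_resFun_eq hV
    (fun y => b y * resFun ((hVU.trans hUU).trans inf_le_right) ϖ)
    (fun y : s => resFun hVU (f y)) fun y => by
      rw [germFun_mul, hb, germFun_res, germFun_res, ha]
  have hWU := hWV.trans hVU
  refine ⟨W, hW, (hWU.trans hUU).trans inf_le_left, resFun ((hWU.trans hUU).trans inf_le_right) ϖ,
    by rwa [germFun_res], fun V' hV' hxV' => ?_⟩
  refine X.toRingedSpace.isUnit_of_isUnit_germ V' _ fun y hy => ?_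
  have hyU : y ∈ U ⊓ punctured hx := ⟨hWU (hV' hy), le_punctured hx hxV' hy⟩
  obtain ⟨y', hy'⟩ := Set.mem_iUnion.1 (hs hyU)
  obtain ⟨hy's, hyy'⟩ := Set.mem_iUnion.1 hy'
  have h1 := (X.mem_basicOpen (f y') y hyU.1).1 hyy'
  have h2 := congrArg (germFun (hV' hy)) (heq ⟨y', hy's⟩)
  simp only [resFun_mul, resFun_resFun, germFun_mul, germFun_res] at h2
  have h3 : IsUnit (germFun hyU.1 (f y')) := h1
  rw [← h2] at h3
  change IsUnit (germFun hy _)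
  rw [germFun_res, germFun_res]
  exact isUnit_of_mul_isUnit_right h3

end Uniformizer

/-! ### Frames adapted to an isotropic subbundle -/

section LinearAlgebra

variable {R : Type*} [CommRing R] [IsDomain R] [IsPrincipalIdealRing R]

/-- The right inverse makes `N` surjective. A basis of its kernel, free over a principal ideal
domain, is completed by lifts of the standard basis of the target. -/
lemma exists_basis_mulVec_eq_zero {k l : ℕ} (N : Matrix (Fin k) (Fin l) R)
    (M : Matrix (Fin l) (Fin k) R) (h : N * M = 1) :
    ∃ (m : ℕ) (c : Module.Basis (Fin m ⊕ Fin k) R (Fin l → R)),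
      ∀ a, N.mulVec (c (Sum.inl a)) = 0 := by
  have hs : Function.Surjective N.mulVecLin := fun v => ⟨M.mulVec v, by simp [h]⟩
  let b := (Module.finBasis R (LinearMap.ker N.mulVecLin)).sumQuot
    ((Pi.basisFun R (Fin k)).map (N.mulVecLin.quotKerEquivOfSurjective hs).symm)
  refine ⟨_, b, fun a => ?_⟩
  simp only [b, Module.Basis.sumQuot_inl]
  exact (Module.finBasis R (LinearMap.ker N.mulVecLin) a).2

/-- An isotropic part of a basis of a quadratic space extends to a basis adapted to its
orthogonal complement. -/
lemma exists_adapted_basis {V : Type*} [AddCommGroup V] [Module R V] {k l : ℕ}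
    (e : Module.Basis (Fin k ⊕ Fin l) R V) (G : Matrix (Fin k ⊕ Fin l) (Fin k ⊕ Fin l) R)
    (hG : IsUnit G.det) (h0 : ∀ i j, G (Sum.inl i) (Sum.inl j) = 0) :
    ∃ (m : ℕ) (b : Module.Basis (Fin k ⊕ Fin m ⊕ Fin k) R V),
      (∀ j, b (Sum.inl j) = e (Sum.inl j)) ∧
      ∀ a i, ∑ j, G (Sum.inl i) j * e.repr (b (Sum.inr (Sum.inl a))) j = 0 := by
  have hinv := Matrix.mul_nonsing_inv G hG
  -- Because the isotropic block of `G` is zero, the identity `G * G⁻¹ = 1` exhibits a block of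
  -- `G⁻¹` as a right inverse of the pairing between the isotropic part and its complement.
  obtain ⟨m, c, hc⟩ := exists_basis_mulVec_eq_zero
    (Matrix.of fun i j => G (Sum.inl i) (Sum.inr j))
    (Matrix.of fun i j => G⁻¹ (Sum.inr i) (Sum.inl j)) (by
      ext i j
      have := congrFun (congrFun hinv (Sum.inl i)) (Sum.inl j)
      simpa [Matrix.mul_apply, Fintype.sum_sum_type, h0, Matrix.one_apply] using this)
  let b := ((Pi.basisFun R (Fin k)).prod c).map
    ((LinearEquiv.sumArrowLequivProdArrow (Fin k) (Fin l) R R).symm.trans e.equivFun.symm)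
  refine ⟨m, b, fun j => ?_, fun a i => ?_⟩
  · simp [b, Module.Basis.equivFun_symm_apply, Fintype.sum_sum_type, Pi.single_apply]
  · have hr : ∀ j, e.repr (b (Sum.inr (Sum.inl a))) j =
        (Sum.elim (fun _ => 0) (c (Sum.inl a)) : Fin k ⊕ Fin l → R) j := by
      intro j
      rw [← e.equivFun_apply]
      simp only [b, Module.Basis.map_apply, LinearEquiv.trans_apply, LinearEquiv.apply_symm_apply]
      cases j <;> simp
    have := congrFun (hc a) i
    simpa [hr, Fintype.sum_sum_type, Matrix.mulVec, dotProduct] using this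

end LinearAlgebra

variable [IsIntegral X] {x : X} {E : OrthogonalBundle X} {F : X.Modules}
  {i : F ⟶ E.sheaf} {k : ℕ}

/-- Near `x` there is a frame of `E` which extends a frame of the isotropic subbundle `F` and a
frame of its orthogonal complement. -/
lemma exists_adapted_frame [IsDiscreteValuationRing (X.presheaf.stalk x)] (hi : IsSubbundle i k)
    (hiso : E.IsIsotropic i) :
    ∃ (U : X.Opens) (_ : x ∈ U) (m : ℕ) (f : Fin k → Γ(F, U))
      (e : Fin k ⊕ Fin m ⊕ Fin k → Γ(E.sheaf, U)), IsFrame F U f ∧ IsFrame E.sheaf U e ∧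
        (∀ j, i.app U (f j) = e (Sum.inl j)) ∧
        ∀ j a, E.form U (e (Sum.inl j)) (e (Sum.inr (Sum.inl a))) = 0 := by
  obtain ⟨U, hU, l, f, e, hf, he, hfe⟩ := hi x
  have hcard : Fintype.card (Fin k ⊕ Fin l) = E.rank := by
    obtain ⟨U', hU', e', he'⟩ := E.isVectorBundle x
    have := Fintype.card_congr ((he.stalkBasis hU).indexEquiv (he'.stalkBasis hU'))
    simpa using this
  let G : Matrix (Fin k ⊕ Fin l) (Fin k ⊕ Fin l) Γ(X, U) :=
    Matrix.of fun i j => E.form U (e i) (e j)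
  have hG : IsUnit G.det := by
    let σ : Fin E.rank ≃ Fin k ⊕ Fin l := (Fintype.equivFinOfCardEq hcard).symm
    have := E.form_nondegenerate U _ (he.reindex σ)
    rwa [← Matrix.det_submatrix_equiv_self σ]
  have hG' := hG.map (germFunHom hU)
  rw [RingHom.map_det] at hG'
  obtain ⟨m, b, hb, hb0⟩ := exists_adapted_basis (he.stalkBasis hU) _ hG' fun a c => by
    change germFun hU (E.form U (e _) (e _)) = 0
    rw [← hfe, ← hfe, hiso, germFun_zero]
  obtain ⟨V, hV, hVU, t, ht, htb⟩ := he.exists_spread hU b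
  -- The germs agree at `x`, hence at the generic point, and these determine sections of a vector
  -- bundle; no further shrinking is needed.
  have htl : ∀ j, t (Sum.inl j) = res _ hVU (e (Sum.inl j)) := by
    intro j
    have h1 : germ _ hV (t (Sum.inl j)) = germ _ hV (res _ hVU (e (Sum.inl j))) := by
      rw [htb, hb, IsFrame.stalkBasis_apply, germ_res]
    have h2 := congrArg (toGeneric E.sheaf x) h1
    rw [toGeneric_germ, toGeneric_germ] at h2
    exact E.isVectorBundle.germ_injective _ h2
  refine ⟨V, hV, m, fun j => res _ hVU (f j), t, hf.restrict hVU, ht, fun j => ?_, fun j a => ?_⟩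
  · rw [htl, app_res, hfe]
  · obtain ⟨d, hd⟩ := he.exists_coord hVU (t (Sum.inr (Sum.inl a)))
    have hrepr : ∀ c, (he.stalkBasis hU).repr (b (Sum.inr (Sum.inl a))) c = germFun hV (d c) := by
      intro c
      have : b (Sum.inr (Sum.inl a)) = ∑ c, germFun hV (d c) • he.stalkBasis hU c := by
        rw [← htb, ← hd, germ_sum]
        refine Finset.sum_congr rfl fun c _ => ?_
        rw [germ_smul, germ_res, IsFrame.stalkBasis_apply]
      rw [this, Module.Basis.repr_sum_self]
    refine germFun_injective hV ?_
    rw [germFun_zero, ← hb0 a j, htl, ← hd]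
    simp only [map_sum, map_smul, smul_eq_mul, E.form_res]
    rw [← germFunHom_apply, map_sum]
    refine Finset.sum_congr rfl fun c _ => ?_
    rw [hrepr, map_mul, mul_comm]
    congr 1
    exact germFun_res _ _ _

/-- An isotropic subbundle defines a Hecke frame at each closed point. -/
lemma exists_heckeFrame [IsLocallyNoetherian X] [IsDiscreteValuationRing (X.presheaf.stalk x)]
    (hx : IsClosed ({x} : Set X)) (hi : IsSubbundle i k) (hiso : E.IsIsotropic i) :
    ∃ (m : ℕ) (D : HeckeFrame E x (Fin k ⊕ Fin m ⊕ Fin k)) (f : Fin k → Γ(F, D.U)),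
      IsFrame F D.U f ∧ ∀ j, i.app D.U (f j) = D.e (Sum.inl j) ∧ D.wt (Sum.inl j) = 0 := by
  obtain ⟨U₀, hx₀, m, f, e, hf, he, hfe, hw⟩ := exists_adapted_frame (x := x) hi hiso
  obtain ⟨U, hxU, hU, ϖ, hϖ, hunit⟩ := exists_uniformizer hx hx₀
  -- With these weights `E'` is `F + ϖ F^⊥ + ϖ ^ 2 E` near `x`. Their sum is the rank because the
  -- first and last blocks have the same size.
  let wt : Fin k ⊕ Fin m ⊕ Fin k → ℕ := Sum.elim (fun _ => 0) (Sum.elim (fun _ => 1) fun _ => 2)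
  have hff : ∀ a c, E.form U₀ (e (Sum.inl a)) (e (Sum.inl c)) = 0 := fun a c => by
    rw [← hfe, ← hfe, hiso]
  let D : HeckeFrame E x (Fin k ⊕ Fin m ⊕ Fin k) :=
    { U := U
      mem := hxU
      ϖ := ϖ
      irreducible := hϖ
      isUnit := fun {V} h => hunit V h
      e := fun j => res _ hU (e j)
      isFrame := he.restrict hU
      wt := wt
      wt_le := by
        rintro (a | a | a) <;> simp [wt]
      sum_wt := by
        simp [wt, Fintype.sum_sum_type]
        ring
      -- An exponent below `2` occurs only for pairs within `F` or between `F` and its orthogonal.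
      -- Those pairings vanish, so the entry `0` is correct and no pole arises.
      γ := Matrix.of fun a c => if wt a + wt c < 2 then 0 else
        ϖ ^ (wt a + wt c - 2) * E.form U (res _ hU (e a)) (res _ hU (e c))
      γ_eq := fun a c => by
        rw [Matrix.of_apply]
        split_ifs with h
        · have : E.form U₀ (e a) (e c) = 0 := by
            rcases a with a | a | a <;> rcases c with c | c | c <;>
              first
              | exact hff _ _
              | exact hw _ _
              | (rw [E.form_symm]; exact hw _ _)
              | simp [wt] at h
          rw [E.form_res, this, resFun_zero, mul_zero, mul_zero]
        · rw [← mul_assoc, ← pow_add, Nat.add_sub_cancel' (not_lt.1 h)] }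
  exact ⟨m, D, fun j => res _ hU (f j), hf.restrict hU, fun j => ⟨by rw [app_res, hfe], rfl⟩⟩

variable [IsLocallyNoetherian X]

namespace OrthogonalBundle

/-- The isotropic subbundles of a superstable orthogonal bundle have slope less than `-1`. -/
theorem IsSuperstable.degree_lt (hE : E.IsSuperstable) (hx : IsClosed ({x} : Set X))
    [IsDiscreteValuationRing (X.presheaf.stalk x)] (hk : 0 < k) (hi : IsSubbundle i k)
    (hiso : E.IsIsotropic i) {d : ℤ} (hd : HasDegree F k d) : d < -k := by
  obtain ⟨m, D, f, hf, hfD⟩ := exists_heckeFrame hx hi hiso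
  have hD := D.isHeckeTransform hx
  -- Here `p = 0` and `q = 1`: sections of `F` have weight zero and so already lie in `E'`, and in
  -- `H` they are `ϖ` times regular sections. The saturation gains at least `k` in degree.
  obtain ⟨F', j, d', hj, hjiso, hd', hle⟩ := exists_isotropic_transfer hx hD.isIsoAway_incl
    hD.isIsoAway_twist (fun U s t => (hD.form_eq U s t).symm) hi hiso hd 0 1 D.mem D.irreducible
    fun U hU hxU g => by
      obtain ⟨c, hc⟩ := hf.exists_coord hU g
      have hig : i.app U g = ∑ j, c j • res _ hU (D.ϖ ^ D.wt (Sum.inl j) • D.e (Sum.inl j)) := by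
        rw [← hc, map_sum]
        refine Finset.sum_congr rfl fun j _ => ?_
        rw [i.app_smul, app_res, (hfD j).1, (hfD j).2, pow_zero, one_smul]
      have hmem : i.app U g ∈ D.kerSub.carrier U := by
        intro hx'
        rw [hig, germ_sum]
        refine Submodule.sum_mem _ fun j _ => ?_
        rw [germ_smul, germ_res]
        exact Submodule.smul_mem _ _ (Submodule.subset_span ⟨Sum.inl j, rfl⟩)
      have h1 : (toAway (punctured hx) E.sheaf).app U (i.app U g) =
          resFun hU D.ϖ • ∑ j, c j • res _ hU (D.θ hx (Sum.inl j)) := by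
        rw [hig, map_sum, Finset.smul_sum]
        refine Finset.sum_congr rfl fun j _ => ?_
        rw [(toAway _ _).app_smul, app_res, ← D.smul_θ, res_smul, smul_comm]
      have h2 : (D.twist hx).app U (D.kerSub.sec _ hmem) =
          resFun hU D.ϖ ^ 1 • ∑ j, c j • res _ hU (D.heckeFrame hx (Sum.inl j)) := by
        refine (D.heckeSub hx).ι_injective U ?_
        rw [D.ι_twist, LocalSubmodule.ι_sec, h1, pow_one, (D.heckeSub hx).ι.app_smul, map_sum]
        simp only [(D.heckeSub hx).ι.app_smul, app_res, D.ι_heckeFrame]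
      exact ⟨D.kerSub.sec _ hmem, _, by rw [pow_zero, one_smul]; rfl, h2⟩
  have := hE x hx _ D.isLagrangian _ _ _ _ hD F' j k d' hk hj hjiso hd'
  push_cast at hle
  linarith

end OrthogonalBundle

end OrthogonalHecke

end

/-! ### The slope criterion -/

theorem mainTheorem9 {K : Type*} [Field K] [IsAlgClosed K] (h2 : (2 : K) ≠ 0)
    (C : OrthogonalHecke.SmoothProjectiveCurve K)
    (E : OrthogonalHecke.OrthogonalBundle C.toScheme) :
    E.IsSuperstable ↔
      ∀ (F : C.toScheme.Modules) (i : F ⟶ E.sheaf) (k : ℕ) (d : ℤ), 0 < k →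
        OrthogonalHecke.IsSubbundle i k → E.IsIsotropic i → OrthogonalHecke.HasDegree F k d →
          (d : ℚ) / (k : ℚ) < -1 := by
  have key : ∀ {k : ℕ} {d : ℤ}, 0 < k → ((d : ℚ) / (k : ℚ) < -1 ↔ d < -k) := by
    intro k d hk
    rw [div_lt_iff₀ (Nat.cast_pos.2 hk), neg_one_mul]
    exact_mod_cast Iff.rfl
  constructor
  · intro hE F i k d hk hi hiso hd
    -- Hecke transforms at a single closed point already force the slope bound.
    obtain ⟨x, hx⟩ := C.exists_isClosed
    have := C.isDiscreteValuationRing_stalk hx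
    exact (key hk).2 (hE.degree_lt hx hk hi hiso hd)
  · intro hE x hx L _ H N incl twist hH
    have := C.isDiscreteValuationRing_stalk hx
    exact hH.isStable hx fun F i k d hk hi hiso hd => (key hk).1 (hE F i k d hk hi hiso hd)
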